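/- **Setting.** Let $d\ge1$, let $\Omega\subset\mathbb R^d$ be a bounded Lipschitz domain (open, connected), $T>0$, $\Omega_T=\Omega\times[0,T]$. Consider $$u_{tt}-\Delta u+a(x)u_t+f(x,u)=0\ \text{ on }\Omega\times[0,T],\quad u(\cdot,0)=u_0,\ u_t(\cdot,0)=u_1\ \text{ on }\Omega,\quad u=0\ \text{ on }\partial\Omega\times[0,T].\qquad(1)$$ Assume: (A1) $a\ge0$ and $a\ne0$ a.e., and $1/a\in L^p(\Omega)$ for some $0<p<\infty$; (A2) for some integer $k>3$ and some $c>0$, $f\in C^{k-1}(\overline\Omega\times\mathbb R)$ and every partial derivative of $f$ of order at most $k-1$ that contains $j$ derivatives in $u$ is bounded by $c|u|^{(r+1-j)^+}$ on $\overline\Omega\times\mathbb R$, where $r\ge1$, $r<\frac{d+2}{d-2}$ if $d\in\{3,4\}$, and $r<2$ if $d=5$. Write $\|g\|_{C^n}$ for the maximum over multi-indices $|\alpha|\le n$ of $\sup|\partial^\alpha g|$; for functions on $\Omega\times[0,T]$ the regularity and the norms are meant up to the boundary. A network $\theta\in\Theta_{L,W,R}$ has at most $L$ layers $z\mapsto W_kz+b_k$,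 all but the last followed by the activation function $\sigma$ in each coordinate, widths in $\{1,\dots,W\}$, entries of $W_k,b_k$ in $[-R,R]$, input $(x,t)\in\mathbb R^{d+1}$ and real output $u_\theta(x,t)$. Put $$A_n=16^L(d+1)^{2n}\bigl(e^2n^4W^3R^n\|\sigma\|_{C^n(\mathbb R)}\bigr)^{nL}.$$ The residuals are $\mathcal R_{PDE}=(u_\theta)_{tt}-\Delta u_\theta+a(u_\theta)_t+f(x,u_\theta)$ on $\Omega_T$; $\mathcal R_{s,u}=u_\theta$ and $\mathcal R_{s,u_t}=(u_\theta)_t$ on $\partial\Omega\times[0,T]$; $\mathcal R_{u_0}=u_\theta(\cdot,0)-u_0$, $\mathcal R_{u_1}=(u_\theta)_t(\cdot,0)-u_1$, $\mathcal R_{\nabla u}=\nabla u_\theta(\cdot,0)-\nabla u_0$ on $\Omega$. A training set $\mathcal S$ consists of the midpoints of the cubes in partitions of $\Omega\times(0,T)$, $\partial\Omega\times[0,T]$ and $\Omega$ into $M_{PDE}$, $M_s$ and $M_t$ cubes, respectively; within each partition the cubes have edges parallel to the axes, a common side length $1/N$ with $N\in\mathbb N$ (which may differ between the three partitions), dimension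 $d+1$, $d$ and $d$ respectively, and midpoints in the partitioned set. $(\mathcal E_T^{PDE})^2$, $(\mathcal E_T^{s,u})^2$, $(\mathcal E_T^{s,u_t})^2$, $(\mathcal E_T^{u_0})^2$, $(\mathcal E_T^{u_1})^2$, $(\mathcal E_T^{\nabla u})^2$ are the midpoint rules for the squared residuals (the sum of the values at the midpoints, each weighted with the volume of a cube, i.e. with $|\Lambda|/M$ for the partitioned set $\Lambda$), and $\mathcal E_T^2$ is the sum of all six. **Theorem.** There are constants $C_\Omega\ge 0$ depending only on $\Omega$, and $C_{\Omega_T},C_{\partial\Omega\times[0,T]}\ge0$ depending only on $\Omega$ and $T$, such that the following holds. Let $a\in C^2(\overline\Omega)$ and $f$ satisfy (A1), (A2), let $u\in C^4(\overline\Omega\times[0,T])$ be a classical solution of (1), and let $C_{pw}>0$ be a constant in the Poincaré–Wirtinger inequality $\|w-w_\Omega\|_{L^2(\Omega)}\le C_{pw}\|\nabla w\|_{L^2(\Omega)}$. Let $\sigma\in C^4(\mathbb R)$ have bounded derivatives of orders $0,\dots,4$, with $\|\sigma\|_{C^n}\ge1$ for $1\le n\le4$, and let $R\ge1$ be finite.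 (i) For every $\theta\in\Theta_{L,W,R}$ and every training set $\mathcal S$, $$\int_{\Omega_T}|u_\theta-u|^2+\int_{\Omega_T}|(u_\theta)_t-u_t|^2\le\mathcal B:=\mathcal C(M)\,T\exp\Bigl(T\max\{1,2C_{pw}^2\}\bigl(1+\hat C+\tfrac{2\sqrt T}{C_{pw}^2}\bigr)\Bigr),$$ where $\hat C=2^{r-1}c\bigl(\|u\|_{C^0}^r+\frac1{r+1}\|u_\theta-u\|_{C^0}^r\bigr)$ and $$\begin{aligned}\mathcal C(M)=\max\{1,2C_{pw}^2\}\Bigl(&C_1M_t^{-2/d}+(\mathcal E_T^{u_1})^2+C_2M_{PDE}^{-2/(d+1)}+(\mathcal E_T^{PDE})^2+C_3M_t^{-2/d}+(\mathcal E_T^{\nabla u})^2\\&+2\sqrt{T|\partial\Omega|}\,(A_1+\|u\|_{C^1})\bigl(C_4M_s^{-1/d}+\mathcal E_T^{s,u_t}\bigr)+C_5M_t^{-2/d}+\tfrac2{C_{pw}^2}(\mathcal E_T^{u_0})^2\Bigr)\end{aligned}$$ with $C_1=C_\Omega\|\mathcal R_{u_1}^2\|_{C^2}$, $C_2=C_{\Omega_T}\|\mathcal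 R_{PDE}^2\|_{C^2}$, $C_3=C_\Omega\bigl\||\mathcal R_{\nabla u}|^2\bigr\|_{C^2}$, $C_4=\bigl(C_{\partial\Omega\times[0,T]}\|\mathcal R_{s,u_t}^2\|_{C^2}\bigr)^{1/2}$ (derivatives of $(u_\theta)_t$ taken in space-time, supremum over $\partial\Omega\times[0,T]$), $C_5=\frac{2C_\Omega}{C_{pw}^2}\|\mathcal R_{u_0}^2\|_{C^2}$. (ii) If the network has at least two layers, the constants are bounded in terms of the size of the network: $$\begin{gathered}C_1\le8C_\Omega(A_3^2+\|u\|_{C^3}^2),\qquad C_2\le16C_{\Omega_T}\bigl((d+1)A_4^2+16\|a\|_{C^2}^2A_3^2+c^2A_2^{2(r+1)}\bigr),\qquad C_3\le8dC_\Omega(A_3^2+\|u\|_{C^3}^2),\\C_4\le2\sqrt{C_{\partial\Omega\times[0,T]}}\,A_3,\qquad C_5\le\tfrac{16C_\Omega}{C_{pw}^2}(A_2^2+\|u\|_{C^2}^2).\end{gathered}$$ (iii) There is a constant $K$, the same for all $\theta\in\Theta_{L,W,R}$ and all training sets, such that $\mathcal B\le K\bigl(\mathcal E_T^2+\mathcal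 E_T^{s,u_t}+M_t^{-2/d}+M_{PDE}^{-2/(d+1)}+M_s^{-1/d}\bigr)$. For each fixed $\theta\in\Theta_{L,W,R}$ there is a constant $K_\theta$ such that for all training sets $\mathcal B\le K_\theta\bigl(\mathcal E_T^2+M_t^{-2/d}+M_{PDE}^{-2/(d+1)}+M_s^{-1/d}\bigr)$. -/

import Mathlib

open MeasureTheory Set

noncomputable section

namespace PINN

/-! ### Space, space-time, cylinders -/

/-- Euclidean space `ℝⁿ`. -/
abbrev Eucl (n : ℕ) : Type := EuclideanSpace ℝ (Fin n)

/-- The `i`-th coordinate direction of `ℝⁿ`. -/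
def dir {n : ℕ} (i : Fin n) : Eucl n := EuclideanSpace.single i 1

/-- The point `(x, s)` of `ℝᵈ⁺¹ = ℝᵈ × ℝ`; the last coordinate is the time (or the value `u` in
the nonlinearity `f(x, u)`). -/
def pair {d : ℕ} (x : Eucl d) (s : ℝ) : Eucl (d + 1) :=
  WithLp.toLp 2 (Fin.snoc (α := fun _ => ℝ) (fun i => x i) s)

/-- The first `d` coordinates of a point of `ℝᵈ⁺¹`. -/
def xpart {d : ℕ} (z : Eucl (d + 1)) : Eucl d := WithLp.toLp 2 (fun i => z i.castSucc)

/-- The last coordinate of a point of `ℝᵈ⁺¹`. -/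
def tpart {d : ℕ} (z : Eucl (d + 1)) : ℝ := z (Fin.last d)

/-- The product `A × I` as a subset of `ℝᵈ⁺¹`. -/
def cyl {d : ℕ} (A : Set (Eucl d)) (I : Set ℝ) : Set (Eucl (d + 1)) :=
  {z | xpart z ∈ A ∧ tpart z ∈ I}

/-- The closed space-time cylinder, the closure of `Ω × [0, T]`. -/
def closedCyl {d : ℕ} (Ω : Set (Eucl d)) (T : ℝ) : Set (Eucl (d + 1)) :=
  cyl (closure Ω) (Icc 0 T)

/-- Bounded Lipschitz domain: open, connected, bounded, and near each boundary point the part of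
the space above the graph of a Lipschitz function, in some direction `e`. The Lipschitz function
is evaluated at the projection `x - ⟪e, x⟫ e` onto the hyperplane orthogonal to `e`. -/
def IsLipschitzDomain {n : ℕ} (Ω : Set (Eucl n)) : Prop :=
  IsOpen Ω ∧ IsConnected Ω ∧ Bornology.IsBounded Ω ∧
    ∀ p ∈ frontier Ω, ∃ (e : Eucl n) (ρ : ℝ) (K : NNReal) (φ : Eucl n → ℝ),
      ‖e‖ = 1 ∧ 0 < ρ ∧ LipschitzWith K φ ∧
        ∀ x ∈ Metric.ball p ρ, x ∈ Ω ↔ φ (x - (inner ℝ e x) • e) < inner ℝ e x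

/-- The surface area `|∂Ω|`: the `(n-1)`-dimensional Hausdorff measure of the boundary, normalised
as Euclidean area. -/
def surfaceArea {n : ℕ} (Ω : Set (Eucl n)) : ℝ :=
  ((Measure.euclideanHausdorffMeasure (n - 1) : Measure (Eucl n)) (frontier Ω)).toReal

/-! ### Partial derivatives and `Cᵐ` norms -/

/-- The `i`-th partial derivative of `g` on the set `S`. -/
def pd {n : ℕ} (S : Set (Eucl n)) (i : Fin n) (g : Eucl n → ℝ) (z : Eucl n) : ℝ :=
  fderivWithin ℝ g S z (dir i)

/-- The maximum over all multi-indices `|α| ≤ m` of `sup_{z ∈ P} |∂^α g(z)|`, where `P ⊆ S` and the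
derivatives are taken on the set `S`. -/
def cNormOn {n : ℕ} (S P : Set (Eucl n)) (m : ℕ) (g : Eucl n → ℝ) : ℝ :=
  sSup {y | ∃ j ≤ m, ∃ s : Fin j → Fin n, ∃ z ∈ P,
    y = |iteratedFDerivWithin ℝ j g S z (fun l => dir (s l))|}

/-- The norm of `Cᵐ(S)`: `max_{|α| ≤ m} sup_{z ∈ S} |∂^α g(z)|`. -/
def cNorm {n : ℕ} (S : Set (Eucl n)) (m : ℕ) (g : Eucl n → ℝ) : ℝ := cNormOn S S m g

/-- The norm of `Cᵐ(ℝ)` for the activation function. -/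
def actNorm (σ : ℝ → ℝ) (m : ℕ) : ℝ :=
  sSup {y | ∃ j ≤ m, ∃ x : ℝ, y = |iteratedDeriv j σ x|}

/-! ### Neural networks -/

/-- Parameters `θ = ((W₁, b₁), …, (W_k, b_k))` of a network with `k` layers, input dimension `m` and
output dimension `n`; the widths of the hidden layers are arbitrary. -/
inductive Net : ℕ → ℕ → ℕ → Type
  | output {m n : ℕ} (A : Matrix (Fin n) (Fin m) ℝ) (b : Fin n → ℝ) : Net 1 m n
  | layer {k m l n : ℕ} (A : Matrix (Fin l) (Fin m) ℝ) (b : Fin l → ℝ) (θ : Net k l n) :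
      Net (k + 1) m n

/-- The realization of a network: each layer applies `x ↦ A x + b`, followed by the activation
function, applied to each coordinate, except in the output layer. -/
def Net.realize (σ : ℝ → ℝ) : {k m n : ℕ} → Net k m n → (Fin m → ℝ) → (Fin n → ℝ)
  | _, _, _, .output A b, x => A.mulVec x + b
  | _, _, _, .layer A b θ, x => θ.realize σ (fun i => σ ((A.mulVec x + b) i))

/-- All widths lie in `{1, …, W}` and all weights and biases in `[-R, R]`. -/
def Net.SizeBound (W : ℕ) (R : ℝ) : {k m n : ℕ} → Net k m n → Prop
  | _, m, n, .output A b =>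
      m ∈ Icc 1 W ∧ n ∈ Icc 1 W ∧ (∀ i j, |A i j| ≤ R) ∧ ∀ i, |b i| ≤ R
  | _, m, _, .layer A b θ =>
      m ∈ Icc 1 W ∧ (∀ i j, |A i j| ≤ R) ∧ (∀ i, |b i| ≤ R) ∧ θ.SizeBound W R

/-- The scalar function `u_θ` on space-time given by a network with input `z = (x, t)`. -/
def Net.fn {k d : ℕ} (σ : ℝ → ℝ) (θ : Net k (d + 1) 1) (z : Eucl (d + 1)) : ℝ :=
  θ.realize σ (fun i => z i) 0

/-- The a priori bound `16^L (d+1)^{2n} (e² n⁴ W³ Rⁿ ‖σ‖_{Cⁿ})^{nL}` for the `Cⁿ` norm of a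
network. -/
def netBound (σ : ℝ → ℝ) (d L W : ℕ) (R : ℝ) (n : ℕ) : ℝ :=
  16 ^ L * ((d : ℝ) + 1) ^ (2 * n) *
    (Real.exp 2 * (n : ℝ) ^ 4 * (W : ℝ) ^ 3 * R ^ n * actNorm σ n) ^ (n * L)

/-! ### The semilinear wave equation -/

/-- The data of the problem `u_tt - Δu + a(x) u_t + f(x, u) = 0` on `Ω × [0, T]` with initial values
`u₀`, `u₁` and zero boundary values. -/
structure WaveData (d : ℕ) (Ω : Set (Eucl d)) (T : ℝ) where
  /-- damping coefficient -/
  a : Eucl d → ℝ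
  /-- nonlinearity -/
  f : Eucl d → ℝ → ℝ
  /-- initial position -/
  u₀ : Eucl d → ℝ
  /-- initial velocity -/
  u₁ : Eucl d → ℝ

/-- `a ≥ 0` and `a ≠ 0` almost everywhere, and `1/a ∈ Lᵖ(Ω)` for some `0 < p < ∞`. -/
def AssumptionA1 {d : ℕ} (Ω : Set (Eucl d)) (a : Eucl d → ℝ) : Prop :=
  (∀ᵐ x ∂(volume.restrict (closure Ω)), 0 ≤ a x ∧ a x ≠ 0) ∧
    ∃ p : ENNReal, 0 < p ∧ p < ⊤ ∧ MemLp (fun x => (a x)⁻¹) p (volume.restrict Ω)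

/-- `f` is of class `C^{k-1}` on `closure Ω × ℝ`, `k > 3`, and every partial derivative of order at
most `k - 1` that contains `j` derivatives in the last variable is bounded by
`c |u|^{max (r + 1 - j) 0}`; `r` is at least `1` and subcritical. -/
def AssumptionA2 {d : ℕ} (Ω : Set (Eucl d)) (f : Eucl d → ℝ → ℝ) (k : ℕ) (c r : ℝ) : Prop :=
  3 < k ∧ 0 < c ∧
  ContDiffOn ℝ ((k - 1 : ℕ) : WithTop ℕ∞) (fun z => f (xpart z) (tpart z))
    (cyl (closure Ω) univ) ∧
  (∀ m ≤ k - 1, ∀ s : Fin m → Fin (d + 1), ∀ z ∈ cyl (closure Ω) univ,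
    |iteratedFDerivWithin ℝ m (fun z => f (xpart z) (tpart z)) (cyl (closure Ω) univ) z
        (fun l => dir (s l))|
      ≤ c * |tpart z| ^ max (r + 1 - ((Finset.univ.filter (fun l => s l = Fin.last d)).card : ℝ)) 0) ∧
  1 ≤ r ∧ (2 < d → d ≤ 4 → r < ((d : ℝ) + 2) / ((d : ℝ) - 2)) ∧ (d = 5 → r < 2)

section Residuals

variable {d : ℕ} {Ω : Set (Eucl d)} {T : ℝ} (D : WaveData d Ω T) (v : Eucl (d + 1) → ℝ)

/-- The time derivative on the closed cylinder. -/
def dt (Ω : Set (Eucl d)) (T : ℝ) (v : Eucl (d + 1) → ℝ) : Eucl (d + 1) → ℝ :=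
  pd (closedCyl Ω T) (Fin.last d) v

/-- The `i`-th space derivative on the closed cylinder. -/
def dx (Ω : Set (Eucl d)) (T : ℝ) (i : Fin d) (v : Eucl (d + 1) → ℝ) : Eucl (d + 1) → ℝ :=
  pd (closedCyl Ω T) i.castSucc v

/-- `R_PDE[v] = v_tt - Δv + a v_t + f(x, v)`. -/
def resPDE (z : Eucl (d + 1)) : ℝ :=
  dt Ω T (dt Ω T v) z - ∑ i : Fin d, dx Ω T i (dx Ω T i v) z + D.a (xpart z) * dt Ω T v z
    + D.f (xpart z) (v z)

/-- `R_{u₀}[v](x) = v(x, 0) - u₀(x)`. -/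
def resU0 (x : Eucl d) : ℝ := v (pair x 0) - D.u₀ x

/-- `R_{u₁}[v](x) = v_t(x, 0) - u₁(x)`. -/
def resU1 (x : Eucl d) : ℝ := dt Ω T v (pair x 0) - D.u₁ x

/-- `‖R_{∇u}[v](x)‖²` with `R_{∇u}[v](x) = ∇v(x, 0) - ∇u₀(x)`. -/
def resGradSq (x : Eucl d) : ℝ := ∑ i : Fin d, (dx Ω T i v (pair x 0) - pd Ω i D.u₀ x) ^ 2

/-- `v` is a classical solution of the initial boundary value problem. -/
def IsClassicalSolution : Prop :=
  ContDiffOn ℝ 2 v (closedCyl Ω T) ∧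
  (∀ z ∈ cyl Ω (Icc 0 T), resPDE D v z = 0) ∧
  (∀ x ∈ Ω, v (pair x 0) = D.u₀ x) ∧
  (∀ x ∈ Ω, dt Ω T v (pair x 0) = D.u₁ x) ∧
  ∀ z ∈ cyl (frontier Ω) (Icc 0 T), v z = 0

end Residuals

/-- `C` is a constant in the Poincaré–Wirtinger inequality
`‖w - w_Ω‖_{L²(Ω)} ≤ C ‖∇w‖_{L²(Ω)}`, where `w_Ω` is the mean of `w` over `Ω`. -/
def IsPoincareWirtingerConst {d : ℕ} (Ω : Set (Eucl d)) (C : ℝ) : Prop :=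
  0 < C ∧ ∀ w : Eucl d → ℝ, ContDiff ℝ 1 w →
    √(∫ x in Ω, (w x - ⨍ y in Ω, w y) ^ 2) ≤ C * √(∫ x in Ω, ‖fderiv ℝ w x‖ ^ 2)

/-! ### Midpoint rule and training sets -/

/-- A partition of `Λ ⊆ ℝⁿ` into `M` cubes of dimension `k` and side length `1/N` (edges parallel to
the coordinate axes) whose midpoints lie in `Λ`. The cube number `m` has the midpoint `center m` and
extends in the `k` coordinate directions `free m`; for `k = n` these are all directions. The closed
cubes fill the closure of `Λ`, and their relative interiors are pairwise disjoint. -/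
structure CubePartition (k : ℕ) {n : ℕ} (Λ : Set (Eucl n)) where
  /-- inverse side length -/
  N : ℕ
  N_pos : 0 < N
  /-- number of cubes -/
  M : ℕ
  /-- midpoints -/
  center : Fin M → Eucl n
  /-- directions in which the cubes extend -/
  free : Fin M → Finset (Fin n)
  card_free : ∀ m, (free m).card = k
  cover : ⋃ m, {z : Eucl n | ∀ i, if i ∈ free m then |z i - center m i| ≤ 1 / (2 * (N : ℝ))
    else z i = center m i} = closure Λ
  disjoint : Pairwise fun m m' => Disjoint
    {z : Eucl n | ∀ i, if i ∈ free m then |z i - center m i| < 1 / (2 * (N : ℝ))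
      else z i = center m i}
    {z : Eucl n | ∀ i, if i ∈ free m' then |z i - center m' i| < 1 / (2 * (N : ℝ))
      else z i = center m' i}
  center_mem : ∀ m, center m ∈ Λ

/-- The midpoint rule: the sum of the values at the midpoints, each with the weight `N^{-k}`, the
`k`-dimensional volume of a cube (so the weight is `|Λ| / M`, and `1 / M` if `|Λ| = 1`). -/
def CubePartition.quad {k n : ℕ} {Λ : Set (Eucl n)} (P : CubePartition k Λ) (g : Eucl n → ℝ) : ℝ :=
  (1 / (P.N : ℝ)) ^ k * ∑ m, g (P.center m)

/-- Training sets: midpoints of cubes that partition `Ω × (0, T)`, `∂Ω × [0, T]` and `Ω`. -/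
structure TrainingSet {d : ℕ} (Ω : Set (Eucl d)) (T : ℝ) where
  /-- interior points -/
  pde : CubePartition (d + 1) (cyl Ω (Ioo 0 T))
  /-- points on the spatial boundary -/
  s : CubePartition d (cyl (frontier Ω) (Icc 0 T))
  /-- points at the initial time -/
  t : CubePartition d Ω

section Errors

variable {d : ℕ} {Ω : Set (Eucl d)} {T : ℝ} (D : WaveData d Ω T) (v : Eucl (d + 1) → ℝ)
  (S : TrainingSet Ω T)

/-- `(E_T^{PDE})²` -/
def trainPDESq : ℝ := S.pde.quad (fun z => resPDE D v z ^ 2)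

/-- `(E_T^{s,u})²` -/
def trainSuSq : ℝ := S.s.quad (fun z => v z ^ 2)

/-- `(E_T^{s,u_t})²` -/
def trainSutSq : ℝ := S.s.quad (fun z => dt Ω T v z ^ 2)

/-- `(E_T^{u₀})²` -/
def trainU0Sq : ℝ := S.t.quad (fun x => resU0 D v x ^ 2)

/-- `(E_T^{u₁})²` -/
def trainU1Sq : ℝ := S.t.quad (fun x => resU1 D v x ^ 2)

/-- `(E_T^{∇u})²` -/
def trainGradSq : ℝ := S.t.quad (resGradSq D v)

/-- The squared training error `E_T²`. -/
def trainSq : ℝ :=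
  trainPDESq D v S + trainSuSq v S + trainSutSq v S + trainU0Sq D v S + trainU1Sq D v S
    + trainGradSq D v S

/-- `M_t^{-2/d} + M_PDE^{-2/(d+1)} + M_s^{-1/d}` -/
def quadRate : ℝ :=
  (S.t.M : ℝ) ^ (-2 / (d : ℝ)) + (S.pde.M : ℝ) ^ (-2 / ((d : ℝ) + 1))
    + (S.s.M : ℝ) ^ (-1 / (d : ℝ))

/-- `∫ |v - u|² + ∫ |v_t - u_t|²` over `Ω × [0, T]`, the squared error in `H¹([0,T]; L²(Ω))`. -/
def totalErrorSq (Ω : Set (Eucl d)) (T : ℝ) (u v : Eucl (d + 1) → ℝ) : ℝ :=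
  (∫ z in cyl Ω (Icc 0 T), |v z - u z| ^ 2)
    + ∫ z in cyl Ω (Icc 0 T), |dt Ω T v z - dt Ω T u z| ^ 2

/-! The five constants of the error bound; `CΩ`, `CΩT`, `CΓ` are the constants of the midpoint rule
on `Ω`, `Ω × [0, T]`, `∂Ω × [0, T]`. -/

/-- `C₁ = CΩ ‖R_{u₁}²‖_{C²(Ω)}` -/
def const1 (CΩ : ℝ) : ℝ := CΩ * cNorm Ω 2 (fun x => resU1 D v x ^ 2)

/-- `C₂ = CΩT ‖R_PDE²‖_{C²(Ω × [0,T])}` -/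
def const2 (CΩT : ℝ) : ℝ := CΩT * cNorm (closedCyl Ω T) 2 (fun z => resPDE D v z ^ 2)

/-- `C₃ = CΩ ‖R_{∇u}²‖_{C²(Ω)}` -/
def const3 (CΩ : ℝ) : ℝ := CΩ * cNorm Ω 2 (resGradSq D v)

/-- `C₄ = (CΓ ‖R_{s,u_t}²‖_{C²(∂Ω × [0,T])})^{1/2}` -/
def const4 (Ω : Set (Eucl d)) (T : ℝ) (v : Eucl (d + 1) → ℝ) (CΓ : ℝ) : ℝ :=
  √(CΓ * cNormOn (closedCyl Ω T) (cyl (frontier Ω) (Icc 0 T)) 2 (fun z => dt Ω T v z ^ 2))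

/-- `C₅ = (2 CΩ / C_pw²) ‖R_{u₀}²‖_{C²(Ω)}` -/
def const5 (CΩ Cpw : ℝ) : ℝ := 2 * CΩ / Cpw ^ 2 * cNorm Ω 2 (fun x => resU0 D v x ^ 2)

/-- `Ĉ = 2^{r-1} c (‖u‖_{C⁰}^r + ‖v - u‖_{C⁰}^r / (r+1))` -/
def cHat (Ω : Set (Eucl d)) (T c r : ℝ) (u v : Eucl (d + 1) → ℝ) : ℝ :=
  2 ^ (r - 1) * c * (cNorm (closedCyl Ω T) 0 u ^ r
    + 1 / (r + 1) * cNorm (closedCyl Ω T) 0 (fun z => v z - u z) ^ r)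

/-- `𝒞(M)`; the argument `B` is the a priori bound for `‖v‖_{C¹}`. -/
def constM (u : Eucl (d + 1) → ℝ) (CΩ CΩT CΓ Cpw B : ℝ) : ℝ :=
  max 1 (2 * Cpw ^ 2) *
    (const1 D v CΩ * (S.t.M : ℝ) ^ (-2 / (d : ℝ)) + trainU1Sq D v S
      + const2 D v CΩT * (S.pde.M : ℝ) ^ (-2 / ((d : ℝ) + 1)) + trainPDESq D v S
      + const3 D v CΩ * (S.t.M : ℝ) ^ (-2 / (d : ℝ)) + trainGradSq D v S
      + 2 * √(T * surfaceArea Ω) * (B + cNorm (closedCyl Ω T) 1 u)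
          * (const4 Ω T v CΓ * (S.s.M : ℝ) ^ (-1 / (d : ℝ)) + √(trainSutSq v S))
      + const5 D v CΩ Cpw * (S.t.M : ℝ) ^ (-2 / (d : ℝ))
      + 2 / Cpw ^ 2 * trainU0Sq D v S)

/-- `𝒞(M) T exp (T max{1, 2 C_pw²} (1 + Ĉ + 2 √T / C_pw²))` -/
def errorBound (u : Eucl (d + 1) → ℝ) (c r CΩ CΩT CΓ Cpw B : ℝ) : ℝ :=
  constM D v S u CΩ CΩT CΓ Cpw B * T *
    Real.exp (T * (max 1 (2 * Cpw ^ 2) * (1 + cHat Ω T c r u v + 2 * √T / Cpw ^ 2)))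

end Errors

end PINN

end

open PINN

noncomputable section

namespace PINN

/-! ### Coordinates and cylinders -/

/-! Let `v` be the network function and `w = v - u`. The time derivative of the energy density w_t²
+ |∇w|² is 2 w_t (w_tt - Δw) + 2 div(w_t ∇w) (`dt_energy`). The source w_tt - Δw is the PDE residual
of `v`, minus a w_t, minus f(x, v) - f(x, u). The damping term has a good sign, and the growth of
∂f/∂u bounds the last difference by Ĉ |w| (`two_mul_source_le`). The divergence contributes only on
∂Ω × [0, T]. There u_t = 0, so w_t is the boundary residual v_t, while the components of ∇w are
bounded by a C¹ bound of `v` plus ‖u‖_{C¹}; the Cauchy–Schwarz inequality on a set of area at most T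
|∂Ω| produces the square root of ∫ v_t². The energy does not contain w itself, so w² is controlled
by the fundamental theorem of calculus in time (`sq_le_initial_add_integral`), with factors 4 and
4√T that fit the stated constants because max{1, 2 C_pw²} · 2 / C_pw² ≥ 4. Adding the two estimates
and applying Grönwall's inequality (`integral_le_of_le_add_integral`) bounds the total error by
integrals of residuals (`totalErrorSq_le_of_integrals`).

Each integral is then replaced by its midpoint rule. On one cube the first-order terms cancel by
reflection in the midpoint, and second derivatives bound the rest (`integral_ball_le_midpoint`,
`second_difference_le`). The side length is converted into a power of the number of cubes by means
of the total volume (`rate_le`).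

The training set also supplies the geometry for integration by parts: the closed cylinder is a union
of cubes and its lateral boundary a union of faces. On almost every line parallel to a spatial axis,
the increments over consecutive cubes telescope, and the endpoints that survive lie on faces
orthogonal to that axis (`ae_abs_sum_increment_le`, `abs_integral_pd_le`). Boundary integrals are
therefore sums over faces, and their total area is compared with the Hausdorff measure of ∂Ω one
time slice at a time (`CubePartition.card_mul_pow_le`).

For networks, induction over the layers with the composition estimate for iterated derivatives gives
‖Dʲ u_θ‖ ≤ (W R n! ‖σ‖_{Cⁿ})^{nl} for 1 ≤ j ≤ n (`Net.norm_iteratedFDeriv_realize_le`). This lies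
far below A_n, and the spare factor absorbs the numerical constants in the bound for C₂. The Leibniz
and chain rules give the other constants.

The uniform part of (iii) follows from one C⁴ bound on the whole class over the bounded cylinder
(`exists_errorBound_le`). For a single network the unsquared boundary error must be removed
(`exists_sqrt_quad_sq_le`). If v_t does not vanish on the lateral boundary, then fine partitions see
a fixed positive amount of it, so the square root is a multiple of the square; coarse partitions
have boundedly many faces, so M_s^{-1/d} is bounded below. -/

lemma dir_apply {n : ℕ} (i j : Fin n) : (dir i : Eucl n) j = if j = i then 1 else 0 := by
  simp [dir]

@[simp] lemma norm_dir {n : ℕ} (i : Fin n) : ‖(dir i : Eucl n)‖ = 1 := by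
  simp [dir]

@[simp] lemma xpart_pair {d : ℕ} (x : Eucl d) (s : ℝ) : xpart (pair x s) = x := by
  ext i; simp [xpart, pair]

@[simp] lemma tpart_pair {d : ℕ} (x : Eucl d) (s : ℝ) : tpart (pair x s) = s := by
  simp [tpart, pair]

@[simp] lemma pair_xpart_tpart {d : ℕ} (z : Eucl (d + 1)) : pair (xpart z) (tpart z) = z := by
  ext i
  refine Fin.lastCases ?_ (fun i => ?_) i <;> simp [xpart, tpart, pair]

@[simp] lemma pair_apply_castSucc {d : ℕ} (x : Eucl d) (s : ℝ) (i : Fin d) :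
    pair x s i.castSucc = x i := by simp [pair]

@[simp] lemma pair_apply_last {d : ℕ} (x : Eucl d) (s : ℝ) : pair x s (Fin.last d) = s := by
  simp [pair]

@[simp] lemma xpart_apply {d : ℕ} (z : Eucl (d + 1)) (i : Fin d) : xpart z i = z i.castSucc := rfl

lemma mem_cyl {d : ℕ} {A : Set (Eucl d)} {I : Set ℝ} {z : Eucl (d + 1)} :
    z ∈ cyl A I ↔ xpart z ∈ A ∧ tpart z ∈ I := Iff.rfl

@[simp] lemma pair_mem_cyl {d : ℕ} {A : Set (Eucl d)} {I : Set ℝ} {x : Eucl d} {s : ℝ} :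
    pair x s ∈ cyl A I ↔ x ∈ A ∧ s ∈ I := by simp [mem_cyl]

/-- Space-time as a product of space and time. -/
def splitL (d : ℕ) : Eucl (d + 1) ≃L[ℝ] Eucl d × ℝ :=
  LinearEquiv.toContinuousLinearEquiv
    { toFun := fun z => (xpart z, tpart z)
      invFun := fun p => pair p.1 p.2
      left_inv := fun z => by simp
      right_inv := fun p => by simp
      map_add' := fun x y => by ext <;> simp [tpart]
      map_smul' := fun c x => by ext <;> simp [tpart] }

@[simp] lemma splitL_apply {d : ℕ} (z : Eucl (d + 1)) : splitL d z = (xpart z, tpart z) := rfl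

@[simp] lemma splitL_symm_apply {d : ℕ} (p : Eucl d × ℝ) : (splitL d).symm p = pair p.1 p.2 := rfl

lemma cyl_eq_preimage {d : ℕ} (A : Set (Eucl d)) (I : Set ℝ) :
    cyl A I = (splitL d) ⁻¹' (A ×ˢ I) := by
  ext z; simp [mem_cyl]

lemma closure_cyl {d : ℕ} (A : Set (Eucl d)) (I : Set ℝ) :
    closure (cyl A I) = cyl (closure A) (closure I) := by
  rw [cyl_eq_preimage, cyl_eq_preimage, ← closure_prod_eq]
  exact ((splitL d).toHomeomorph.preimage_closure _).symm

lemma interior_cyl {d : ℕ} (A : Set (Eucl d)) (I : Set ℝ) :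
    interior (cyl A I) = cyl (interior A) (interior I) := by
  rw [cyl_eq_preimage, cyl_eq_preimage, ← interior_prod_eq]
  exact ((splitL d).toHomeomorph.preimage_interior _).symm

lemma isCompact_cyl {d : ℕ} {A : Set (Eucl d)} {I : Set ℝ} (hA : IsCompact A) (hI : IsCompact I) :
    IsCompact (cyl A I) := by
  rw [cyl_eq_preimage]
  exact (splitL d).toHomeomorph.isCompact_preimage.2 (hA.prod hI)

lemma isOpen_cyl {d : ℕ} {A : Set (Eucl d)} {I : Set ℝ} (hA : IsOpen A) (hI : IsOpen I) :
    IsOpen (cyl A I) := by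
  rw [cyl_eq_preimage]
  exact (hA.prod hI).preimage (splitL d).continuous

lemma isClosed_cyl {d : ℕ} {A : Set (Eucl d)} {I : Set ℝ} (hA : IsClosed A) (hI : IsClosed I) :
    IsClosed (cyl A I) := by
  rw [cyl_eq_preimage]
  exact (hA.prod hI).preimage (splitL d).continuous

lemma continuous_tpart {d : ℕ} : Continuous (tpart : Eucl (d + 1) → ℝ) :=
  continuous_snd.comp (splitL d).continuous

lemma continuous_pair {d : ℕ} : Continuous (fun p : Eucl d × ℝ => pair p.1 p.2) :=
  (splitL d).symm.continuous

lemma measurableSet_cyl {d : ℕ} {A : Set (Eucl d)} {I : Set ℝ} (hA : MeasurableSet A)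
    (hI : MeasurableSet I) : MeasurableSet (cyl A I) := by
  rw [cyl_eq_preimage]
  exact (splitL d).continuous.measurable (hA.prod hI)

lemma pair_mem_closedCyl {d : ℕ} {Ω : Set (Eucl d)} {T t : ℝ} {x : Eucl d} (hx : x ∈ Ω)
    (ht : t ∈ Icc 0 T) : pair x t ∈ closedCyl Ω T :=
  pair_mem_cyl.2 ⟨subset_closure hx, ht⟩

lemma isCompact_closedCyl {d : ℕ} {Ω : Set (Eucl d)} (hΩ : IsLipschitzDomain Ω) (T : ℝ) :
    IsCompact (closedCyl Ω T) :=
  isCompact_cyl hΩ.2.2.1.isCompact_closure isCompact_Icc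

/-! ### Splitting off one coordinate -/

/-- The point of `ℝⁿ⁺¹` with `i`-th coordinate `s` and other coordinates `y`. -/
def ins {n : ℕ} (i : Fin (n + 1)) (s : ℝ) (y : Fin n → ℝ) : Eucl (n + 1) :=
  WithLp.toLp 2 (i.insertNth (α := fun _ => ℝ) s y)

@[simp] lemma ins_same {n : ℕ} (i : Fin (n + 1)) (s : ℝ) (y : Fin n → ℝ) : ins i s y i = s := by
  simp [ins]

@[simp] lemma ins_succAbove {n : ℕ} (i : Fin (n + 1)) (s : ℝ) (y : Fin n → ℝ) (j : Fin n) :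
    ins i s y (i.succAbove j) = y j := by
  simp [ins]

lemma ins_self_removeNth {n : ℕ} (i : Fin (n + 1)) (z : Eucl (n + 1)) :
    ins i (z i) (fun j => z (i.succAbove j)) = z := by
  ext j
  refine Fin.succAboveCases i ?_ (fun j => ?_) j <;> simp

lemma continuous_ins {n : ℕ} (i : Fin (n + 1)) :
    Continuous (fun p : ℝ × (Fin n → ℝ) => ins i p.1 p.2) := by
  unfold ins
  refine (PiLp.continuous_toLp 2 _).comp ?_
  exact Continuous.finInsertNth i continuous_fst continuous_snd

lemma measurePreserving_ins {n : ℕ} (i : Fin (n + 1)) :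
    MeasurePreserving (fun p : ℝ × (Fin n → ℝ) => ins i p.1 p.2) volume volume :=
  (PiLp.volume_preserving_toLp (Fin (n + 1))).comp
    (volume_preserving_piFinSuccAbove (fun _ => ℝ) i).symm

lemma measurableEmbedding_ins {n : ℕ} (i : Fin (n + 1)) :
    MeasurableEmbedding (fun p : ℝ × (Fin n → ℝ) => ins i p.1 p.2) :=
  ((MeasurableEquiv.piFinSuccAbove (fun _ => ℝ) i).symm.trans
    (MeasurableEquiv.toLp 2 (Fin (n + 1) → ℝ))).measurableEmbedding

lemma pair_eq_ins {d : ℕ} (x : Eucl d) (s : ℝ) : pair x s = ins (Fin.last d) s (fun i => x i) := by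
  simp [pair, ins, Fin.insertNth_last']

lemma measurePreserving_pair {d : ℕ} :
    MeasurePreserving (fun p : Eucl d × ℝ => pair p.1 p.2) volume volume := by
  have h1 : MeasurePreserving (Prod.swap : Eucl d × ℝ → ℝ × Eucl d) volume volume :=
    Measure.measurePreserving_swap
  have h2 : MeasurePreserving (fun p : ℝ × Eucl d => (p.1, (WithLp.ofLp p.2 : Fin d → ℝ)))
      volume volume :=
    (MeasurePreserving.id volume).prod (PiLp.volume_preserving_ofLp (Fin d))
  have h3 := (measurePreserving_ins (Fin.last d)).comp (h2.comp h1)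
  convert h3 using 1
  ext p : 1
  exact pair_eq_ins p.1 p.2

lemma measurableEmbedding_pair {d : ℕ} :
    MeasurableEmbedding (fun p : Eucl d × ℝ => pair p.1 p.2) :=
  (splitL d).symm.toHomeomorph.measurableEmbedding

/-- Fubini's theorem on cylinders, the time integral inside. -/
lemma integral_cyl {d : ℕ} {A : Set (Eucl d)} {I : Set ℝ} {g : Eucl (d + 1) → ℝ}
    (hg : IntegrableOn g (cyl A I)) :
    ∫ z in cyl A I, g z = ∫ x in A, ∫ t in I, g (pair x t) := by
  have hpre : (fun p : Eucl d × ℝ => pair p.1 p.2) ⁻¹' cyl A I = A ×ˢ I := by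
    ext p; simp
  rw [← measurePreserving_pair.setIntegral_preimage_emb measurableEmbedding_pair, hpre,
    Measure.volume_eq_prod, setIntegral_prod]
  rw [← Measure.volume_eq_prod, ← hpre]
  exact (measurePreserving_pair.integrableOn_comp_preimage measurableEmbedding_pair).2 hg

/-- Fubini's theorem on cylinders, the space integral inside. -/
lemma integral_cyl' {d : ℕ} {A : Set (Eucl d)} {I : Set ℝ} {g : Eucl (d + 1) → ℝ}
    (hg : IntegrableOn g (cyl A I)) :
    ∫ z in cyl A I, g z = ∫ t in I, ∫ x in A, g (pair x t) := by
  have hpre : (fun p : Eucl d × ℝ => pair p.1 p.2) ⁻¹' cyl A I = A ×ˢ I := by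
    ext p; simp
  have hi : IntegrableOn (fun p : Eucl d × ℝ => g (pair p.1 p.2)) (A ×ˢ I) := by
    rw [← hpre]
    exact (measurePreserving_pair.integrableOn_comp_preimage measurableEmbedding_pair).2 hg
  rw [← measurePreserving_pair.setIntegral_preimage_emb measurableEmbedding_pair, hpre]
  rw [Measure.volume_eq_prod] at hi ⊢
  rw [← setIntegral_prod_swap, setIntegral_prod]
  · rfl
  · exact hi.swap

/-! ### Lipschitz domains -/

/-- At a boundary point the cone K ‖x' - p'‖ < ⟪e, x - p⟫, where x' is the projection orthogonal to
`e`, lies above the graph near `p` because `φ` is `K`-Lipschitz. Open convex sets that touch `p`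
from inside make derivatives within the closure unique. -/
lemma exists_convex_cone {n : ℕ} {Ω : Set (Eucl n)} (hΩ : IsLipschitzDomain Ω) {p : Eucl n}
    (hp : p ∈ closure Ω) :
    ∃ U : Set (Eucl n), Convex ℝ U ∧ IsOpen U ∧ U.Nonempty ∧ p ∈ closure U ∧ U ⊆ Ω := by
  obtain ⟨hopen, -, -, hL⟩ := hΩ
  by_cases hpΩ : p ∈ Ω
  · obtain ⟨ε, hε, hb⟩ := Metric.isOpen_iff.1 hopen p hpΩ
    exact ⟨Metric.ball p ε, convex_ball p ε, Metric.isOpen_ball, ⟨p, Metric.mem_ball_self hε⟩,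
      subset_closure (Metric.mem_ball_self hε), hb⟩
  have hfr : p ∈ frontier Ω := ⟨hp, fun h => hpΩ (interior_subset h)⟩
  obtain ⟨e, ρ, K, φ, he, hρ, hφ, hball⟩ := hL p hfr
  have hPc : Continuous fun x : Eucl n => x - (inner ℝ e x) • e := by fun_prop
  -- Only this half of `p` lying on the graph is needed; it is a closed condition that holds at the
  -- points of `Ω` near `p`.
  have hφp : φ (p - (inner ℝ e p) • e) ≤ inner ℝ e p := by
    have h1 : p ∈ closure (Ω ∩ Metric.ball p ρ) := by
      rw [inter_comm]
      exact Metric.isOpen_ball.inter_closure ⟨Metric.mem_ball_self hρ, hp⟩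
    have h2 : IsClosed {x : Eucl n | φ (x - (inner ℝ e x) • e) ≤ inner ℝ e x} :=
      isClosed_le (hφ.continuous.comp hPc) (by fun_prop)
    exact closure_minimal (fun x hx => ((hball x hx.2).1 hx.1).le) h2 h1
  -- The cone is `q < 0`. It is convex because `q` is a nonnegative multiple of the norm of an
  -- affine map, minus an affine function.
  set q : Eucl n → ℝ := fun x =>
    K * ‖(x - p) - (inner ℝ e (x - p)) • e‖ - inner ℝ e (x - p) with hq
  have hqc : Continuous q := by rw [hq]; fun_prop
  have hqt : ∀ t : ℝ, q (p + t • e) = -t := by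
    intro t
    simp [hq, inner_smul_right, he]
  have hmem : ∀ t : ℝ, 0 < t → t < ρ → p + t • e ∈ Metric.ball p ρ ∩ {x | q x < 0} := by
    intro t h0 h1
    refine ⟨?_, ?_⟩
    · simp [norm_smul, he, abs_of_pos h0, h1]
    · simp only [mem_ofPred_eq, hqt]; linarith
  refine ⟨Metric.ball p ρ ∩ {x | q x < 0}, ?_, ?_, ?_, ?_, ?_⟩
  · refine (convex_ball p ρ).inter ?_
    have hconv : ConvexOn ℝ univ q := by
      refine ⟨convex_univ, ?_⟩
      intro x _ y _ a b ha hb hab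
      have h1 : (a • x + b • y) - p = a • (x - p) + b • (y - p) := by
        have : p = a • p + b • p := by rw [← add_smul, hab, one_smul]
        nth_rewrite 1 [this]
        module
      simp only [hq, h1, inner_add_right, inner_smul_right, smul_eq_mul]
      have h2 : a • (x - p) + b • (y - p)
          - (a * inner ℝ e (x - p) + b * inner ℝ e (y - p)) • e
          = a • ((x - p) - (inner ℝ e (x - p)) • e)
            + b • ((y - p) - (inner ℝ e (y - p)) • e) := by module
      rw [h2]
      have h3 := norm_add_le (a • ((x - p) - (inner ℝ e (x - p)) • e))
        (b • ((y - p) - (inner ℝ e (y - p)) • e))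
      rw [norm_smul, norm_smul, Real.norm_of_nonneg ha, Real.norm_of_nonneg hb] at h3
      have h4 := mul_le_mul_of_nonneg_left h3 K.2
      have h5 : (K : ℝ) = K.1 := rfl
      rw [← h5] at h4
      linarith
    simpa using hconv.convex_lt 0
  · exact Metric.isOpen_ball.inter (isOpen_lt hqc continuous_const)
  · exact ⟨p + (ρ / 2) • e, hmem _ (by linarith) (by linarith)⟩
  · have hlim : Filter.Tendsto (fun t : ℝ => p + t • e) (nhdsWithin 0 (Ioi 0)) (nhds p) := by
      have : Filter.Tendsto (fun t : ℝ => p + t • e) (nhds 0) (nhds (p + (0 : ℝ) • e)) :=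
        (by fun_prop : Continuous fun t : ℝ => p + t • e).tendsto 0
      rw [zero_smul, add_zero] at this
      exact this.mono_left nhdsWithin_le_nhds
    refine mem_closure_of_tendsto hlim ?_
    filter_upwards [Ioo_mem_nhdsGT hρ] with t ht
    exact hmem t ht.1 ht.2
  · rintro x ⟨hx, hqx⟩
    rw [hball x hx]
    have h1 := hφ.dist_le_mul (x - (inner ℝ e x) • e) (p - (inner ℝ e p) • e)
    rw [Real.dist_eq, dist_eq_norm] at h1
    have h2 : x - (inner ℝ e x) • e - (p - (inner ℝ e p) • e)
        = (x - p) - (inner ℝ e (x - p)) • e := by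
      rw [inner_sub_right]; module
    rw [h2] at h1
    have h3 := le_abs_self (φ (x - (inner ℝ e x) • e) - φ (p - (inner ℝ e p) • e))
    simp only [hq, mem_ofPred_eq, inner_sub_right] at hqx h1
    linarith

/-- A step from a boundary point in the direction `-e` lands in an open set strictly below the
graph, hence outside the closure of `Ω`. This is what puts the open cubes of a partition, a priori
only in the closure, inside `Ω` itself. -/
lemma interior_closure_eq {n : ℕ} {Ω : Set (Eucl n)} (hΩ : IsLipschitzDomain Ω) :
    interior (closure Ω) = Ω := by
  refine Subset.antisymm ?_ (hΩ.1.subset_interior_iff.2 subset_closure)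
  intro p hp
  by_contra hpΩ
  have hfr : p ∈ frontier Ω := ⟨interior_subset hp, fun h => hpΩ (interior_subset h)⟩
  obtain ⟨e, ρ, K, φ, he, hρ, hφ, hball⟩ := hΩ.2.2.2 p hfr
  have hPc : Continuous fun x : Eucl n => x - (inner ℝ e x) • e := by fun_prop
  have hφp : inner ℝ e p ≤ φ (p - (inner ℝ e p) • e) :=
    not_lt.1 fun h => hpΩ ((hball p (Metric.mem_ball_self hρ)).2 h)
  have hlim : Filter.Tendsto (fun t : ℝ => p - t • e) (nhdsWithin 0 (Ioi 0)) (nhds p) := by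
    have : Filter.Tendsto (fun t : ℝ => p - t • e) (nhds 0) (nhds (p - (0 : ℝ) • e)) :=
      (by fun_prop : Continuous fun t : ℝ => p - t • e).tendsto 0
    rw [zero_smul, sub_zero] at this
    exact this.mono_left nhdsWithin_le_nhds
  have hev := hlim.eventually (Filter.inter_mem (isOpen_interior.mem_nhds hp)
    (Metric.isOpen_ball.mem_nhds (Metric.mem_ball_self (x := p) hρ)))
  obtain ⟨t, ⟨htc, htb⟩, ht⟩ := (hev.and self_mem_nhdsWithin).exists
  have hV : IsOpen (Metric.ball p ρ ∩
      {x : Eucl n | inner ℝ e x < φ (x - (inner ℝ e x) • e)}) :=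
    Metric.isOpen_ball.inter (isOpen_lt (by fun_prop) (hφ.continuous.comp hPc))
  have hmem : p - t • e ∈ Metric.ball p ρ ∩
      {x : Eucl n | inner ℝ e x < φ (x - (inner ℝ e x) • e)} := by
    refine ⟨htb, ?_⟩
    have h1 : (inner ℝ e (p - t • e) : ℝ) = inner ℝ e p - t := by
      rw [inner_sub_right, inner_smul_right, real_inner_self_eq_norm_sq, he]; ring
    have h2 : p - t • e - (inner ℝ e p - t) • e = p - (inner ℝ e p) • e := by module
    simp only [mem_ofPred_eq, h1, h2]
    have : 0 < t := ht
    linarith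
  obtain ⟨x, ⟨hxb, hx⟩, hxΩ⟩ := mem_closure_iff.1 (interior_subset htc) _ hV hmem
  exact absurd ((hball x hxb).1 hxΩ) (not_lt.2 (le_of_lt hx))

lemma uniqueDiffOn_of_cones {E : Type*} [NormedAddCommGroup E] [NormedSpace ℝ E] {S : Set E}
    (h : ∀ p ∈ S, ∃ U : Set E, Convex ℝ U ∧ IsOpen U ∧ U.Nonempty ∧ p ∈ closure U ∧ U ⊆ S) :
    UniqueDiffOn ℝ S := by
  intro p hp
  obtain ⟨U, hc, ho, hn, hcl, hs⟩ := h p hp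
  exact (uniqueDiffWithinAt_convex hc (by rwa [ho.interior_eq]) hcl).mono hs

lemma uniqueDiffOn_closure {n : ℕ} {Ω : Set (Eucl n)} (hΩ : IsLipschitzDomain Ω) :
    UniqueDiffOn ℝ (closure Ω) := by
  refine uniqueDiffOn_of_cones fun p hp => ?_
  obtain ⟨U, hc, ho, hn, hcl, hs⟩ := exists_convex_cone hΩ hp
  exact ⟨U, hc, ho, hn, hcl, hs.trans subset_closure⟩

lemma uniqueDiffOn_cyl {d : ℕ} {Ω : Set (Eucl d)} (hΩ : IsLipschitzDomain Ω) {I : Set ℝ}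
    (hI : UniqueDiffOn ℝ I) : UniqueDiffOn ℝ (cyl (closure Ω) I) := by
  rw [cyl_eq_preimage]
  exact (splitL d).uniqueDiffOn_preimage_iff.2 ((uniqueDiffOn_closure hΩ).prod hI)

lemma uniqueDiffOn_closedCyl {d : ℕ} {Ω : Set (Eucl d)} (hΩ : IsLipschitzDomain Ω) {T : ℝ}
    (hT : 0 < T) : UniqueDiffOn ℝ (closedCyl Ω T) :=
  uniqueDiffOn_cyl hΩ (uniqueDiffOn_Icc hT)

lemma interior_closedCyl {d : ℕ} {Ω : Set (Eucl d)} (hΩ : IsLipschitzDomain Ω) (T : ℝ) :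
    interior (closedCyl Ω T) = cyl Ω (Ioo 0 T) := by
  rw [closedCyl, interior_cyl, interior_closure_eq hΩ, interior_Icc]

lemma closure_cyl_Ioo {d : ℕ} {Ω : Set (Eucl d)} {T : ℝ} (hT : 0 < T) :
    closure (cyl Ω (Ioo 0 T)) = closedCyl Ω T := by
  rw [closure_cyl, closure_Ioo hT.ne, closedCyl]

/-! ### Partial derivatives -/

section PartialDerivatives

variable {n : ℕ} {S P : Set (Eucl n)} {g h : Eucl n → ℝ} {z : Eucl n}

lemma pd_congr (hgh : EqOn g h S) (hz : z ∈ S) (i : Fin n) : pd S i g z = pd S i h z := by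
  unfold pd
  rw [fderivWithin_congr hgh (hgh hz)]

lemma pd_add (hS : UniqueDiffOn ℝ S) (hz : z ∈ S) (hg : DifferentiableOn ℝ g S)
    (hh : DifferentiableOn ℝ h S) (i : Fin n) :
    pd S i (fun y => g y + h y) z = pd S i g z + pd S i h z := by
  unfold pd
  rw [fderivWithin_fun_add (hS z hz) (hg z hz) (hh z hz)]
  rfl

lemma pd_sub (hS : UniqueDiffOn ℝ S) (hz : z ∈ S) (hg : DifferentiableOn ℝ g S)
    (hh : DifferentiableOn ℝ h S) (i : Fin n) :
    pd S i (fun y => g y - h y) z = pd S i g z - pd S i h z := by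
  unfold pd
  rw [fderivWithin_fun_sub (hS z hz) (hg z hz) (hh z hz)]
  rfl

lemma pd_mul (hS : UniqueDiffOn ℝ S) (hz : z ∈ S) (hg : DifferentiableOn ℝ g S)
    (hh : DifferentiableOn ℝ h S) (i : Fin n) :
    pd S i (fun y => g y * h y) z = g z * pd S i h z + pd S i g z * h z := by
  unfold pd
  rw [fderivWithin_fun_mul (hS z hz) (hg z hz) (hh z hz)]
  simp
  ring

lemma pd_sum {ι : Type*} {s : Finset ι} {G : ι → Eucl n → ℝ} (hS : UniqueDiffOn ℝ S) (hz : z ∈ S)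
    (hG : ∀ k ∈ s, DifferentiableOn ℝ (G k) S) (i : Fin n) :
    pd S i (fun y => ∑ k ∈ s, G k y) z = ∑ k ∈ s, pd S i (G k) z := by
  unfold pd
  rw [fderivWithin_fun_sum (hS z hz) (fun k hk => hG k hk z hz)]
  simp

lemma contDiffOn_pd {m k : WithTop ℕ∞} (hg : ContDiffOn ℝ m g S) (hS : UniqueDiffOn ℝ S)
    (hmk : k + 1 ≤ m) (i : Fin n) : ContDiffOn ℝ k (pd S i g) S :=
  (hg.fderivWithin hS hmk).clm_apply contDiffOn_const

/-- The innermost derivative occupies the last slot, hence `Fin.snoc`. Bounds of order `j` for a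
partial derivative thus become bounds of order `j + 1` for the function. -/
lemma iteratedFDerivWithin_pd {j : ℕ} (hS : UniqueDiffOn ℝ S)
    (hg : ContDiffOn ℝ ((j + 1 : ℕ) : WithTop ℕ∞) g S) (hz : z ∈ S) (i : Fin n)
    (w : Fin j → Eucl n) :
    iteratedFDerivWithin ℝ j (pd S i g) S z w
      = iteratedFDerivWithin ℝ (j + 1) g S z (Fin.snoc (α := fun _ => Eucl n) w (dir i)) := by
  rw [iteratedFDerivWithin_succ_apply_right hS hz]
  have h1 : ContDiffWithinAt ℝ (j : WithTop ℕ∞) (fun y => fderivWithin ℝ g S y) S z :=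
    (hg.fderivWithin hS (by push_cast; exact le_rfl)) z hz
  have h2 := (ContinuousLinearMap.apply ℝ ℝ (dir i : Eucl n)).iteratedFDerivWithin_comp_left
    h1 hS hz (i := j) le_rfl
  have h3 : pd S i g
      = (ContinuousLinearMap.apply ℝ ℝ (dir i : Eucl n)) ∘ fun y => fderivWithin ℝ g S y := rfl
  rw [h3, h2]
  simp

lemma iteratedFDerivWithin_one_dir (hS : UniqueDiffOn ℝ S) (hz : z ∈ S) (s : Fin 1 → Fin n) :
    iteratedFDerivWithin ℝ 1 g S z (fun l => dir (s l)) = pd S (s 0) g z := by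
  rw [iteratedFDerivWithin_one_apply (hS z hz)]
  rfl

lemma iteratedFDerivWithin_two_dir (hS : UniqueDiffOn ℝ S) (hg : ContDiffOn ℝ 2 g S) (hz : z ∈ S)
    (s : Fin 2 → Fin n) :
    iteratedFDerivWithin ℝ 2 g S z (fun l => dir (s l)) = pd S (s 0) (pd S (s 1) g) z := by
  have h1 := iteratedFDerivWithin_pd (j := 1) hS (by exact_mod_cast hg) hz (s 1)
    (fun l => dir (s 0))
  have h2 : (fun l => dir (s l)) = Fin.snoc (α := fun _ => Eucl n) (fun _ : Fin 1 => dir (s 0))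
      (dir (s 1)) := by
    ext l : 1
    fin_cases l
    · rfl
    · rfl
  rw [h2, ← h1]
  exact iteratedFDerivWithin_one_dir hS hz (fun _ => s 0)

/-- At boundary points the symmetry of second derivatives comes from the interior by continuity,
which is why `z` must be a limit of interior points. The energy identity needs it up to the boundary
of the cylinder. -/
lemma pd_comm {m : WithTop ℕ∞} (hS : UniqueDiffOn ℝ S) (hg : ContDiffOn ℝ m g S) (hm : 2 ≤ m)
    (hz : z ∈ S) (hcl : z ∈ closure (interior S)) (i j : Fin n) :
    pd S i (pd S j g) z = pd S j (pd S i g) z := by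
  have hsymm : IsSymmSndFDerivWithinAt ℝ g S z :=
    (hg z hz).isSymmSndFDerivWithinAt (by simpa using hm) hS hcl hz
  have key : ∀ i j : Fin n, pd S i (pd S j g) z
      = fderivWithin ℝ (fderivWithin ℝ g S) S z (dir i) (dir j) := by
    intro i j
    unfold pd
    have h1 : DifferentiableWithinAt ℝ (fderivWithin ℝ g S) S z :=
      ((hg.of_le hm).fderivWithin hS (m := 1) (by norm_num)).differentiableOn (by norm_num) z hz
    rw [fderivWithin_clm_apply (hS z hz) h1 (by fun_prop)]
    simp
  rw [key, key]
  exact hsymm _ _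

/-! ### Bounds for derivatives -/

/-- `B` bounds all partial derivatives of order at most `m` on `P`, taken on the set `S`. -/
def DerivBound (S P : Set (Eucl n)) (m : ℕ) (B : ℝ) (g : Eucl n → ℝ) : Prop :=
  ∀ j ≤ m, ∀ s : Fin j → Fin n, ∀ z ∈ P,
    |iteratedFDerivWithin ℝ j g S z (fun l => dir (s l))| ≤ B

lemma DerivBound.mono {m m' : ℕ} {B B' : ℝ} {P' : Set (Eucl n)} (hg : DerivBound S P m B g)
    (hm : m' ≤ m) (hB : B ≤ B') (hP : P' ⊆ P) : DerivBound S P' m' B' g :=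
  fun j hj s z hz => (hg j (hj.trans hm) s z (hP hz)).trans hB

lemma DerivBound.cNormOn_le {m : ℕ} {B : ℝ} (hg : DerivBound S P m B g) (hB : 0 ≤ B) :
    cNormOn S P m g ≤ B := by
  refine Real.sSup_le ?_ hB
  rintro y ⟨j, hj, s, z, hz, rfl⟩
  exact hg j hj s z hz

/-- The real supremum of an unbounded set is 0, so `cNormOn` controls the derivatives only once some
bound is known to exist. -/
lemma DerivBound.derivBound_cNormOn {m : ℕ} {B : ℝ} (hg : DerivBound S P m B g) :
    DerivBound S P m (cNormOn S P m g) g := by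
  intro j hj s z hz
  refine le_csSup ⟨B, ?_⟩ ⟨j, hj, s, z, hz, rfl⟩
  rintro y ⟨j, hj, s, z, hz, rfl⟩
  exact hg j hj s z hz

lemma cNormOn_nonneg (S P : Set (Eucl n)) (m : ℕ) (g : Eucl n → ℝ) : 0 ≤ cNormOn S P m g := by
  refine Real.sSup_nonneg ?_
  rintro y ⟨j, hj, s, z, hz, rfl⟩
  exact abs_nonneg _

lemma cNorm_nonneg (S : Set (Eucl n)) (m : ℕ) (g : Eucl n → ℝ) : 0 ≤ cNorm S m g :=
  cNormOn_nonneg S S m g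

lemma abs_iteratedFDerivWithin_dir_le {j : ℕ} (s : Fin j → Fin n) :
    |iteratedFDerivWithin ℝ j g S z (fun l => dir (s l))| ≤ ‖iteratedFDerivWithin ℝ j g S z‖ := by
  have := (iteratedFDerivWithin ℝ j g S z).le_opNorm (fun l => dir (s l))
  simpa using this

lemma exists_derivBound_of_isCompact {m : ℕ} (hS : UniqueDiffOn ℝ S) (hc : IsCompact S)
    (hg : ContDiffOn ℝ (m : WithTop ℕ∞) g S) : ∃ B, DerivBound S S m B g := by
  have h1 : ∀ j : ℕ, ∃ B, j ≤ m → ∀ z ∈ S, ‖iteratedFDerivWithin ℝ j g S z‖ ≤ B := by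
    intro j
    by_cases hj : j ≤ m
    · obtain ⟨B, hB⟩ := hc.exists_bound_of_continuousOn
        (hg.continuousOn_iteratedFDerivWithin (m := j) (by exact_mod_cast hj) hS)
      exact ⟨B, fun _ => hB⟩
    · exact ⟨0, fun h => absurd h hj⟩
  choose B hB using h1
  refine ⟨∑ j ∈ Finset.range (m + 1), |B j|, fun j hj s z hz => ?_⟩
  refine (abs_iteratedFDerivWithin_dir_le s).trans ((hB j hj z hz).trans ((le_abs_self _).trans ?_))
  exact Finset.single_le_sum (f := fun j => |B j|) (fun _ _ => abs_nonneg _)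
    (Finset.mem_range.2 (by omega))

lemma derivBound_cNorm_of_isCompact {m : ℕ} (hS : UniqueDiffOn ℝ S) (hc : IsCompact S)
    (hg : ContDiffOn ℝ (m : WithTop ℕ∞) g S) : DerivBound S S m (cNorm S m g) g := by
  obtain ⟨B, hB⟩ := exists_derivBound_of_isCompact hS hc hg
  exact hB.derivBound_cNormOn

lemma DerivBound.abs_le {m : ℕ} {B : ℝ} (hg : DerivBound S P m B g) (hz : z ∈ P) :
    |g z| ≤ B := by
  have := hg 0 (Nat.zero_le _) Fin.elim0 z hz
  simpa using this

lemma derivBound_zero {B : ℝ} (hg : ∀ z ∈ P, |g z| ≤ B) : DerivBound S P 0 B g := by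
  intro j hj s z hz
  obtain rfl : j = 0 := by omega
  simpa using hg z hz

lemma derivBound_pd {m : ℕ} {B : ℝ} (hS : UniqueDiffOn ℝ S)
    (hg : ContDiffOn ℝ ((m + 1 : ℕ) : WithTop ℕ∞) g S) (hP : P ⊆ S)
    (hB : DerivBound S P (m + 1) B g) (i : Fin n) : DerivBound S P m B (pd S i g) := by
  intro j hj s z hz
  rw [iteratedFDerivWithin_pd hS (hg.of_le (by exact_mod_cast (by omega))) (hP hz)]
  convert hB (j + 1) (by omega) (Fin.snoc (α := fun _ => Fin n) s i) z hz using 4 with l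
  refine Fin.lastCases ?_ (fun l => ?_) l <;> simp

/-- Reduces C² bounds to first-order operators applied at most twice, where the sum, product and
chain rules can be used by hand. -/
lemma derivBound_two_iff {B : ℝ} (hS : UniqueDiffOn ℝ S) (hg : ContDiffOn ℝ 2 g S) (hP : P ⊆ S) :
    DerivBound S P 2 B g ↔ ∀ z ∈ P, |g z| ≤ B ∧ (∀ i, |pd S i g z| ≤ B) ∧
      ∀ i j, |pd S i (pd S j g) z| ≤ B := by
  constructor
  · intro h z hz
    refine ⟨h.abs_le hz, fun i => ?_, fun i j => ?_⟩
    · have := h 1 (by norm_num) (fun _ => i) z hz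
      rwa [iteratedFDerivWithin_one_dir hS (hP hz)] at this
    · have := h 2 le_rfl ![i, j] z hz
      rwa [iteratedFDerivWithin_two_dir hS hg (hP hz)] at this
  · intro h j hj s z hz
    obtain ⟨h0, h1, h2⟩ := h z hz
    interval_cases j
    · simpa using h0
    · rw [iteratedFDerivWithin_one_dir hS (hP hz)]
      exact h1 _
    · rw [iteratedFDerivWithin_two_dir hS hg (hP hz)]
      exact h2 _ _

/-! ### Bounds for sums, products and squares. -/

section Algebra

variable {A B : ℝ}

lemma DerivBound.sub (hS : UniqueDiffOn ℝ S) (hP : P ⊆ S) (hg : ContDiffOn ℝ 2 g S)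
    (hh : ContDiffOn ℝ 2 h S) (hA : DerivBound S P 2 A g) (hB : DerivBound S P 2 B h) :
    DerivBound S P 2 (A + B) (fun z => g z - h z) := by
  rw [derivBound_two_iff hS hg hP] at hA
  rw [derivBound_two_iff hS hh hP] at hB
  rw [derivBound_two_iff hS (hg.sub hh) hP]
  have dg := hg.differentiableOn (by norm_num)
  have dh := hh.differentiableOn (by norm_num)
  intro z hz
  obtain ⟨a0, a1, a2⟩ := hA z hz
  obtain ⟨b0, b1, b2⟩ := hB z hz
  refine ⟨(abs_sub _ _).trans (add_le_add a0 b0), fun i => ?_, fun i j => ?_⟩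
  · rw [pd_sub hS (hP hz) dg dh]
    exact (abs_sub _ _).trans (add_le_add (a1 i) (b1 i))
  · rw [pd_congr (fun y hy => pd_sub hS hy dg dh j) (hP hz),
      pd_sub hS (hP hz) ((contDiffOn_pd hg hS (k := 1) (by norm_num) j).differentiableOn (by norm_num))
        ((contDiffOn_pd hh hS (k := 1) (by norm_num) j).differentiableOn (by norm_num))]
    exact (abs_sub _ _).trans (add_le_add (a2 i j) (b2 i j))

lemma DerivBound.add (hS : UniqueDiffOn ℝ S) (hP : P ⊆ S) (hg : ContDiffOn ℝ 2 g S)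
    (hh : ContDiffOn ℝ 2 h S) (hA : DerivBound S P 2 A g) (hB : DerivBound S P 2 B h) :
    DerivBound S P 2 (A + B) (fun z => g z + h z) := by
  rw [derivBound_two_iff hS hg hP] at hA
  rw [derivBound_two_iff hS hh hP] at hB
  rw [derivBound_two_iff hS (hg.add hh) hP]
  have dg := hg.differentiableOn (by norm_num)
  have dh := hh.differentiableOn (by norm_num)
  intro z hz
  obtain ⟨a0, a1, a2⟩ := hA z hz
  obtain ⟨b0, b1, b2⟩ := hB z hz
  refine ⟨(abs_add_le _ _).trans (add_le_add a0 b0), fun i => ?_, fun i j => ?_⟩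
  · rw [pd_add hS (hP hz) dg dh]
    exact (abs_add_le _ _).trans (add_le_add (a1 i) (b1 i))
  · rw [pd_congr (fun y hy => pd_add hS hy dg dh j) (hP hz),
      pd_add hS (hP hz) ((contDiffOn_pd hg hS (k := 1) (by norm_num) j).differentiableOn (by norm_num))
        ((contDiffOn_pd hh hS (k := 1) (by norm_num) j).differentiableOn (by norm_num))]
    exact (abs_add_le _ _).trans (add_le_add (a2 i j) (b2 i j))

/-- A second derivative of a product has four terms, each at most `A * B`. -/
lemma DerivBound.mul (hS : UniqueDiffOn ℝ S) (hP : P ⊆ S) (hg : ContDiffOn ℝ 2 g S)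
    (hh : ContDiffOn ℝ 2 h S) (hA : DerivBound S P 2 A g) (hB : DerivBound S P 2 B h) :
    DerivBound S P 2 (4 * (A * B)) (fun z => g z * h z) := by
  rw [derivBound_two_iff hS hg hP] at hA
  rw [derivBound_two_iff hS hh hP] at hB
  rw [derivBound_two_iff hS (hg.mul hh) hP]
  have dg := hg.differentiableOn (by norm_num)
  have dh := hh.differentiableOn (by norm_num)
  intro z hz
  obtain ⟨a0, a1, a2⟩ := hA z hz
  obtain ⟨b0, b1, b2⟩ := hB z hz
  have hA0 : 0 ≤ A := (abs_nonneg _).trans a0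
  have hB0 : 0 ≤ B := (abs_nonneg _).trans b0
  have hAB := mul_nonneg hA0 hB0
  have mul_le : ∀ x y : ℝ, |x| ≤ A → |y| ≤ B → |x * y| ≤ A * B := fun x y hx hy => by
    rw [abs_mul]; exact mul_le_mul hx hy (abs_nonneg _) hA0
  refine ⟨(mul_le _ _ a0 b0).trans (by linarith), fun i => ?_, fun i j => ?_⟩
  · rw [pd_mul hS (hP hz) dg dh]
    have e1 := mul_le _ _ a0 (b1 i)
    have e2 := mul_le _ _ (a1 i) b0
    exact (abs_add_le _ _).trans (by linarith)
  · have dg' := (contDiffOn_pd hg hS (k := 1) (by norm_num) j).differentiableOn (by norm_num)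
    have dh' := (contDiffOn_pd hh hS (k := 1) (by norm_num) j).differentiableOn (by norm_num)
    rw [pd_congr (fun y hy => pd_mul hS hy dg dh j) (hP hz),
      pd_add hS (hP hz) (dg.fun_mul dh') (dg'.fun_mul dh), pd_mul hS (hP hz) dg dh',
      pd_mul hS (hP hz) dg' dh]
    have e1 := mul_le _ _ a0 (b2 i j)
    have e2 := mul_le _ _ (a1 i) (b1 j)
    have e3 := mul_le _ _ (a1 j) (b1 i)
    have e4 := mul_le _ _ (a2 i j) b0
    have f1 := abs_add_le (g z * pd S i (pd S j h) z + pd S i g z * pd S j h z)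
      (pd S j g z * pd S i h z + pd S i (pd S j g) z * h z)
    have f2 := abs_add_le (g z * pd S i (pd S j h) z) (pd S i g z * pd S j h z)
    have f3 := abs_add_le (pd S j g z * pd S i h z)
      (pd S i (pd S j g) z * h z)
    linarith

lemma DerivBound.sq (hS : UniqueDiffOn ℝ S) (hP : P ⊆ S) (hg : ContDiffOn ℝ 2 g S)
    (hA : DerivBound S P 2 A g) : DerivBound S P 2 (4 * A ^ 2) (fun z => g z ^ 2) := by
  have h := hA.mul hS hP hg hg hA
  simp only [← pow_two] at h
  exact h

lemma derivBound_const_zero {m : ℕ} :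
    DerivBound S P m 0 (fun _ => 0) := by
  intro j _ s z hz
  have : iteratedFDerivWithin ℝ j (fun _ : Eucl n => (0 : ℝ)) S z = 0 := by
    simp
  simp [this]

lemma DerivBound.sum {ι : Type*} {s : Finset ι} {G : ι → Eucl n → ℝ} {A : ι → ℝ}
    (hS : UniqueDiffOn ℝ S) (hP : P ⊆ S) (hG : ∀ k ∈ s, ContDiffOn ℝ 2 (G k) S)
    (hA : ∀ k ∈ s, DerivBound S P 2 (A k) (G k)) :
    DerivBound S P 2 (∑ k ∈ s, A k) (fun z => ∑ k ∈ s, G k z) := by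
  classical
  induction s using Finset.induction_on with
  | empty => simpa using derivBound_const_zero
  | insert a s ha ih =>
    simp only [Finset.sum_insert ha]
    refine DerivBound.add hS hP (hG a (Finset.mem_insert_self _ _))
      (ContDiffOn.sum fun k hk => hG k (Finset.mem_insert_of_mem hk))
      (hA a (Finset.mem_insert_self _ _))
      (ih (fun k hk => hG k (Finset.mem_insert_of_mem hk))
        (fun k hk => hA k (Finset.mem_insert_of_mem hk)))

lemma DerivBound.congr {m : ℕ} (hgh : EqOn g h S) (hP : P ⊆ S) (hB : DerivBound S P m B h) :
    DerivBound S P m B g := by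
  intro j hj s z hz
  rw [iteratedFDerivWithin_congr hgh (hP hz)]
  exact hB j hj s z hz

end Algebra

end PartialDerivatives

/-! ### Derivatives of networks -/

section Networks

variable {E : Type*} [NormedAddCommGroup E] [NormedSpace ℝ E]

lemma norm_iteratedFDeriv_clm_le (f : E →L[ℝ] ℝ) (hf : ‖f‖ ≤ 1) {j : ℕ} (hj : 1 ≤ j) (x : E) :
    ‖iteratedFDeriv ℝ j f x‖ ≤ 1 := by
  obtain ⟨j, rfl⟩ : ∃ i, j = i + 1 := ⟨j - 1, by omega⟩
  rw [← norm_iteratedFDeriv_fderiv]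
  have h : fderiv ℝ f = fun _ => f := by ext1 x; exact f.fderiv
  rw [h]
  rcases Nat.eq_zero_or_pos j with rfl | hj
  · simpa using hf
  · rw [iteratedFDeriv_const_of_ne hj.ne']
    simp

lemma actNorm_nonneg (σ : ℝ → ℝ) (n : ℕ) : 0 ≤ actNorm σ n := by
  refine Real.sSup_nonneg ?_
  rintro y ⟨j, _, x, rfl⟩
  exact abs_nonneg _

lemma abs_iteratedDeriv_le_actNorm {σ : ℝ → ℝ} {n j : ℕ}
    (hσ : ∀ j ≤ n, ∃ b, ∀ x, |iteratedDeriv j σ x| ≤ b) (hj : j ≤ n) (x : ℝ) :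
    |iteratedDeriv j σ x| ≤ actNorm σ n := by
  choose! b hb using hσ
  refine le_csSup ⟨∑ j ∈ Finset.range (n + 1), |b j|, ?_⟩ ⟨j, hj, x, rfl⟩
  rintro y ⟨j, hj, x, rfl⟩
  refine ((hb j hj x).trans (le_abs_self _)).trans ?_
  exact Finset.single_le_sum (f := fun j => |b j|) (fun _ _ => abs_nonneg _)
    (Finset.mem_range.2 (by omega))

lemma contDiff_affine {m : ℕ} {N : WithTop ℕ∞} {h : E → Fin m → ℝ}
    (hh : ∀ i, ContDiff ℝ N fun z => h z i) (a : Fin m → ℝ) (b : ℝ) :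
    ContDiff ℝ N fun z => ∑ i, a i * h z i + b :=
  (ContDiff.sum fun i _ => contDiff_const.mul (hh i)).add contDiff_const

/-- For `j ≥ 1` the bias disappears, and at most `W` inputs remain, each with a weight of size at
most `R`. -/
lemma norm_iteratedFDeriv_affine_le {m W j : ℕ} {N : WithTop ℕ∞} {h : E → Fin m → ℝ}
    (hh : ∀ i, ContDiff ℝ N fun z => h z i) (hj : 1 ≤ j) (hjN : j ≤ N) {a : Fin m → ℝ} {b R Q : ℝ}
    (hR : 0 ≤ R) (ha : ∀ i, |a i| ≤ R) (hm : m ≤ W) (x : E) (hQ0 : 0 ≤ Q)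
    (hQ : ∀ i, ‖iteratedFDeriv ℝ j (fun z => h z i) x‖ ≤ Q) :
    ‖iteratedFDeriv ℝ j (fun z => ∑ i, a i * h z i + b) x‖ ≤ W * R * Q := by
  have hc : ∀ i, ContDiff ℝ j fun z => a i • h z i := fun i =>
    contDiff_const.fun_smul ((hh i).of_le hjN)
  have h1 : (fun z => ∑ i, a i * h z i + b) = (fun z => ∑ i, a i • h z i) + fun _ => b := by
    ext z; simp
  rw [h1, iteratedFDeriv_add_apply (ContDiff.sum fun i _ => hc i).contDiffAt
    contDiff_const.contDiffAt, iteratedFDeriv_const_of_ne (by omega), Pi.zero_apply, add_zero,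
    iteratedFDeriv_fun_sum_apply fun i _ => (hc i).contDiffAt]
  refine (norm_sum_le _ _).trans ?_
  have h2 : ∀ i ∈ Finset.univ, ‖iteratedFDeriv ℝ j (fun z => a i • h z i) x‖ ≤ R * Q := by
    intro i _
    rw [iteratedFDeriv_const_smul_apply' ((hh i).of_le hjN).contDiffAt, norm_smul]
    exact mul_le_mul (ha i) (hQ i) (norm_nonneg _) hR
  refine (Finset.sum_le_sum h2).trans ?_
  rw [Finset.sum_const, Finset.card_univ, Fintype.card_fin, nsmul_eq_mul, mul_assoc]
  exact mul_le_mul_of_nonneg_right (by exact_mod_cast hm) (mul_nonneg hR hQ0)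

lemma Net.SizeBound.one_le_width {k m n W : ℕ} {R : ℝ} {θ : Net k m n} (h : θ.SizeBound W R) :
    1 ≤ W := by
  cases θ with
  | output A b => exact h.1.1.trans h.1.2
  | layer A b θ => exact h.1.1.trans h.1.2

lemma Net.contDiff_realize {σ : ℝ → ℝ} {N : WithTop ℕ∞} (hσ : ContDiff ℝ N σ) {k m n : ℕ}
    (θ : Net k m n) {h : E → Fin m → ℝ} (hh : ∀ i, ContDiff ℝ N fun z => h z i) (i : Fin n) :
    ContDiff ℝ N fun z => θ.realize σ (h z) i := by
  induction θ with
  | output A b => exact contDiff_affine hh (fun k => A i k) (b i)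
  | layer A b θ ih =>
    exact ih (h := fun z i => σ ((A.mulVec (h z) + b) i))
      (fun k => hσ.comp (contDiff_affine hh (fun l => A k l) (b k))) i

/-- Here `h` is the map computed by the layers already passed, and the invariant is ‖Dʲ h_i‖ ≤ n₀! s
Dʲ. The affine part of a layer turns this into a bound (W R n₀! s D)ʲ; composing with `σ` restores
the invariant with `D` multiplied by W R n₀! s. Each of the `k` layers contributes one such factor.
-/
lemma Net.norm_iteratedFDeriv_realize_le {σ : ℝ → ℝ} {N : WithTop ℕ∞} (hσ : ContDiff ℝ N σ)
    {n₀ W : ℕ} {R s : ℝ} (hn₀ : n₀ ≤ N) (hR : 1 ≤ R) (hs : 1 ≤ s)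
    (hσs : ∀ j ≤ n₀, ∀ x, |iteratedDeriv j σ x| ≤ s) {k m n : ℕ}
    (θ : Net k m n) (hθ : θ.SizeBound W R) {h : E → Fin m → ℝ}
    (hh : ∀ i, ContDiff ℝ N fun z => h z i) {D : ℝ} (hD : 1 ≤ D) (x : E)
    (hb : ∀ i, ∀ j, 1 ≤ j → j ≤ n₀ →
      ‖iteratedFDeriv ℝ j (fun z => h z i) x‖ ≤ n₀.factorial * s * D ^ j)
    (i : Fin n) {j : ℕ} (hj : 1 ≤ j) (hj' : j ≤ n₀) :
    ‖iteratedFDeriv ℝ j (fun z => θ.realize σ (h z) i) x‖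
      ≤ ((W * R * (n₀.factorial * s)) ^ k * D) ^ j := by
  have hW : (1 : ℝ) ≤ W := by exact_mod_cast hθ.one_le_width
  have hfac : (1 : ℝ) ≤ n₀.factorial := Nat.one_le_cast.2 (Nat.factorial_pos n₀)
  have hq : 1 ≤ n₀.factorial * s := one_le_mul_of_one_le_of_one_le hfac hs
  have hWR : 1 ≤ W * R := one_le_mul_of_one_le_of_one_le hW hR
  have hX : 1 ≤ W * R * (n₀.factorial * s) := one_le_mul_of_one_le_of_one_le hWR hq
  -- The prefactor W R n₀! s is at least 1, so it may be raised to the power `j` and absorbed into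
  -- the geometric bound.
  have pre : ∀ {m l : ℕ} (A : Matrix (Fin l) (Fin m) ℝ) (b : Fin l → ℝ) (h : E → Fin m → ℝ),
      (∀ i, ContDiff ℝ N fun z => h z i) → m ≤ W → (∀ i j, |A i j| ≤ R) → ∀ (D : ℝ), 1 ≤ D →
      (∀ i, ∀ j, 1 ≤ j → j ≤ n₀ →
        ‖iteratedFDeriv ℝ j (fun z => h z i) x‖ ≤ n₀.factorial * s * D ^ j) →
      ∀ i, ∀ j, 1 ≤ j → j ≤ n₀ → ‖iteratedFDeriv ℝ j (fun z => (A.mulVec (h z) + b) i) x‖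
        ≤ (W * R * (n₀.factorial * s) * D) ^ j := by
    intro m l A b h hh hm hA D hD hb i j hj hj'
    have hDj : 0 ≤ D ^ j := by positivity
    have h1 := norm_iteratedFDeriv_affine_le (b := b i) hh hj
      (le_trans (by exact_mod_cast hj') hn₀)
      (by linarith) (hA i) hm x (by positivity) (fun i => hb i j hj hj')
    refine h1.trans ?_
    rw [mul_pow, ← mul_assoc]
    refine mul_le_mul_of_nonneg_right ?_ hDj
    exact le_self_pow₀ hX (by omega)
  induction θ generalizing D with
  | output A b =>
    rw [pow_one]
    exact pre A b h hh hθ.1.2 hθ.2.2.1 D hD hb i j hj hj'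
  | @layer k m l n A b θ ih =>
    have hA := hθ.2.1
    have hD' : 1 ≤ W * R * (n₀.factorial * s) * D := one_le_mul_of_one_le_of_one_le hX hD
    have h1 := ih (h := fun z i => σ ((A.mulVec (h z) + b) i)) hθ.2.2.2
      (fun k => hσ.comp (contDiff_affine hh (fun l => A k l) (b k))) hD' ?_ i
    · refine h1.trans (le_of_eq ?_)
      ring
    · intro i j hj hj'
      have h2 := norm_iteratedFDeriv_comp_le (n := j) (N := N) hσ
        (contDiff_affine hh (fun l => A i l) (b i)) (le_trans (by exact_mod_cast hj') hn₀) x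
        (C := s) (D := W * R * (n₀.factorial * s) * D)
        (fun p hp => by
          rw [norm_iteratedFDeriv_eq_norm_iteratedDeriv]
          exact hσs p (hp.trans hj') _)
        (fun p hp hp' => pre A b h hh hθ.1.2 hA D hD hb i p hp (hp'.trans hj'))
      refine h2.trans ?_
      have h3 : (j.factorial : ℝ) ≤ n₀.factorial := by
        exact_mod_cast Nat.factorial_le hj'
      gcongr

/-- Whatever happens in the hidden layers, the output layer receives values of `σ`, which are
bounded by `s`. The bound on `x` serves the network that consists of an output layer alone. -/
lemma Net.abs_realize_le {σ : ℝ → ℝ} {W : ℕ} {R s : ℝ} (hR : 0 ≤ R) (hs : 0 ≤ s)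
    (hσs : ∀ x, |σ x| ≤ s) {k m n : ℕ} (θ : Net k m n) (hθ : θ.SizeBound W R) {x : Fin m → ℝ}
    (hx : ∀ i, |x i| ≤ s) (i : Fin n) : |θ.realize σ x i| ≤ W * R * s + R := by
  induction θ with
  | @output m n A b =>
    have hb : |b i| ≤ R := hθ.2.2.2 i
    have h1 : |∑ k, A i k * x k| ≤ W * R * s := by
      refine (Finset.abs_sum_le_sum_abs _ _).trans ?_
      have h2 : ∀ k ∈ Finset.univ, |A i k * x k| ≤ R * s := fun k _ => by
        rw [abs_mul]
        exact mul_le_mul (hθ.2.2.1 i k) (hx k) (abs_nonneg _) hR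
      refine (Finset.sum_le_sum h2).trans ?_
      rw [Finset.sum_const, Finset.card_univ, Fintype.card_fin, nsmul_eq_mul, mul_assoc]
      exact mul_le_mul_of_nonneg_right (by exact_mod_cast hθ.1.2) (mul_nonneg hR hs)
    exact (abs_add_le _ _).trans (add_le_add h1 hb)
  | layer A b θ ih => exact ih hθ.2.2.2 (fun k => hσs _) i

lemma Net.contDiff_fn {σ : ℝ → ℝ} {N : WithTop ℕ∞} (hσ : ContDiff ℝ N σ) {k d : ℕ}
    (θ : Net k (d + 1) 1) : ContDiff ℝ N (θ.fn σ) :=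
  θ.contDiff_realize hσ (h := fun (z : Eucl (d + 1)) i => z i)
    (fun i => (EuclideanSpace.proj (𝕜 := ℝ) i).contDiff) 0

lemma norm_euclideanProj_le {n : ℕ} (i : Fin n) :
    ‖(EuclideanSpace.proj i : Eucl n →L[ℝ] ℝ)‖ ≤ 1 := by
  refine ContinuousLinearMap.opNorm_le_bound _ zero_le_one fun x => ?_
  rw [one_mul]
  exact PiLp.norm_apply_le x i

/-- The induction over the layers starts with the coordinate functions, which are linear of norm at
most 1, so `D = 1`. The base of the power is at least 1, hence the exponent for order `n` serves all
orders `j ≤ n`. -/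
lemma Net.norm_iteratedFDeriv_fn_le {σ : ℝ → ℝ} (hσ : ContDiff ℝ 4 σ)
    (hσb : ∀ n ≤ 4, ∃ b, ∀ x, |iteratedDeriv n σ x| ≤ b)
    (hσ1 : ∀ n ∈ Finset.Icc 1 4, 1 ≤ actNorm σ n) {W : ℕ} {R : ℝ} (hR : 1 ≤ R) {l d : ℕ}
    (θ : Net l (d + 1) 1) (hθ : θ.SizeBound W R) {n j : ℕ} (hn : n ∈ Finset.Icc 1 4) (hj : 1 ≤ j)
    (hjn : j ≤ n) (z : Eucl (d + 1)) :
    ‖iteratedFDeriv ℝ j (θ.fn σ) z‖ ≤ (W * R * (n.factorial * actNorm σ n)) ^ (n * l) := by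
  have hn4 : n ≤ 4 := (Finset.mem_Icc.1 hn).2
  have hW : (1 : ℝ) ≤ W := by exact_mod_cast hθ.one_le_width
  have hfac : (1 : ℝ) ≤ n.factorial := Nat.one_le_cast.2 (Nat.factorial_pos n)
  have hq : 1 ≤ n.factorial * actNorm σ n := one_le_mul_of_one_le_of_one_le hfac (hσ1 n hn)
  have hX : 1 ≤ W * R * (n.factorial * actNorm σ n) :=
    one_le_mul_of_one_le_of_one_le (one_le_mul_of_one_le_of_one_le hW hR) hq
  have h1 := θ.norm_iteratedFDeriv_realize_le hσ (n₀ := n) (s := actNorm σ n)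
    (by exact_mod_cast hn4) hR (hσ1 n hn)
    (fun j hj x => abs_iteratedDeriv_le_actNorm (fun j hj => hσb j (hj.trans hn4)) hj x) hθ
    (h := fun (z : Eucl (d + 1)) i => z i)
    (fun i => (EuclideanSpace.proj (𝕜 := ℝ) i).contDiff) (D := 1) le_rfl z
    (fun i j hj _ => by
      rw [one_pow, mul_one]
      exact (norm_iteratedFDeriv_clm_le _ (norm_euclideanProj_le i) hj z).trans hq) 0 hj hjn
  refine h1.trans ?_
  rw [mul_one, ← pow_mul, mul_comm n l]
  exact pow_le_pow_right₀ hX (Nat.mul_le_mul_left l hjn)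

/-- The bound `(W R n! ‖σ‖_{Cⁿ})^{nL}` for the derivatives of a network is much smaller than the
bound `netBound`. -/
lemma le_netBound {σ : ℝ → ℝ} {W L l d n : ℕ} {R : ℝ} (hR : 1 ≤ R) (hW : 1 ≤ W) (hl : l ≤ L)
    (hn : n ∈ Finset.Icc 1 4) (hσ1 : 1 ≤ actNorm σ n) :
    16 ^ l * ((d : ℝ) + 1) ^ (2 * n) * (W * R * (n.factorial * actNorm σ n)) ^ (n * l)
      ≤ netBound σ d L W R n := by
  obtain ⟨hn1, hn4⟩ := Finset.mem_Icc.1 hn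
  have hW' : (1 : ℝ) ≤ W := by exact_mod_cast hW
  have hfac : (1 : ℝ) ≤ n.factorial := Nat.one_le_cast.2 (Nat.factorial_pos n)
  have hX : 1 ≤ W * R * (n.factorial * actNorm σ n) :=
    one_le_mul_of_one_le_of_one_le (one_le_mul_of_one_le_of_one_le hW' hR)
      (one_le_mul_of_one_le_of_one_le hfac hσ1)
  have hXY : W * R * (n.factorial * actNorm σ n)
      ≤ Real.exp 2 * (n : ℝ) ^ 4 * (W : ℝ) ^ 3 * R ^ n * actNorm σ n := by
    have h1 : (n.factorial : ℝ) ≤ (n : ℝ) ^ 4 := by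
      have : n.factorial ≤ n ^ 4 := by interval_cases n <;> decide
      exact_mod_cast this
    have h2 : (W : ℝ) ≤ (W : ℝ) ^ 3 := le_self_pow₀ hW' (by norm_num)
    have h3 : R ≤ R ^ n := le_self_pow₀ hR (by omega)
    have h4 : (1 : ℝ) ≤ Real.exp 2 := Real.one_le_exp (by norm_num)
    have h5 : (W : ℝ) * R * (n.factorial * actNorm σ n)
        = 1 * n.factorial * W * R * actNorm σ n := by ring
    rw [h5]
    gcongr
  unfold netBound
  have h6 : (W * R * (n.factorial * actNorm σ n)) ^ (n * l)
      ≤ (Real.exp 2 * (n : ℝ) ^ 4 * (W : ℝ) ^ 3 * R ^ n * actNorm σ n) ^ (n * L) :=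
    (pow_le_pow_right₀ hX (Nat.mul_le_mul_left n hl)).trans
      (pow_le_pow_left₀ (by linarith) hXY _)
  have h7 : (16 : ℝ) ^ l ≤ 16 ^ L := pow_le_pow_right₀ (by norm_num) hl
  gcongr

end Networks

/-! ### Chain rules -/

section Chain

variable {d : ℕ} {Ω : Set (Eucl d)} {T : ℝ}

lemma xpart_dir_castSucc (i : Fin d) : xpart (dir i.castSucc : Eucl (d + 1)) = dir i := by
  ext j; simp [dir_apply]

lemma xpart_dir_last : xpart (dir (Fin.last d) : Eucl (d + 1)) = 0 := by
  ext j; simp [dir_apply, (Fin.castSucc_lt_last j).ne]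

lemma tpart_dir_castSucc (i : Fin d) : tpart (dir i.castSucc : Eucl (d + 1)) = 0 := by
  simp [tpart, dir_apply, (Fin.castSucc_lt_last i).ne']

lemma tpart_dir_last : tpart (dir (Fin.last d) : Eucl (d + 1)) = 1 := by
  simp [tpart, dir_apply]

lemma pair_dir_zero (i : Fin d) : pair (dir i) 0 = (dir i.castSucc : Eucl (d + 1)) := by
  rw [← xpart_dir_castSucc, ← tpart_dir_castSucc i, pair_xpart_tpart]

lemma pair_zero_one : pair (0 : Eucl d) 1 = dir (Fin.last d) := by
  rw [← xpart_dir_last, ← tpart_dir_last (d := d), pair_xpart_tpart]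

lemma pair_add (x y : Eucl d) (s t : ℝ) : pair (x + y) (s + t) = pair x s + pair y t :=
  (splitL d).symm.map_add (x, s) (y, t)

lemma pair_smul (c : ℝ) (x : Eucl d) (s : ℝ) : pair (c • x) (c * s) = c • pair x s :=
  (splitL d).symm.map_smul c (x, s)

lemma hasFDerivAt_pair_left (t : ℝ) (x : Eucl d) :
    HasFDerivAt (fun x => pair x t)
      ((splitL d).symm.toContinuousLinearMap.comp (ContinuousLinearMap.inl ℝ (Eucl d) ℝ)) x :=
  (splitL d).symm.hasFDerivAt.comp x ((hasFDerivAt_id x).prodMk (hasFDerivAt_const t x))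

lemma contDiff_pair {E : Type*} [NormedAddCommGroup E] [NormedSpace ℝ E] {m : WithTop ℕ∞}
    {S : Set E} {p : E → Eucl d} {q : E → ℝ} (hp : ContDiffOn ℝ m p S) (hq : ContDiffOn ℝ m q S) :
    ContDiffOn ℝ m (fun z => pair (p z) (q z)) S :=
  (splitL d).symm.contDiff.comp_contDiffOn (hp.prodMk hq)

lemma contDiff_xpart {m : WithTop ℕ∞} : ContDiff ℝ m (xpart : Eucl (d + 1) → Eucl d) :=
  contDiff_fst.comp (splitL d).contDiff

lemma mapsTo_pair_zero (hT : 0 < T) : MapsTo (fun x => pair x 0) Ω (closedCyl Ω T) :=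
  fun _ hx => pair_mem_closedCyl hx ⟨le_rfl, hT.le⟩

lemma pd_slice (hΩ : IsOpen Ω) (hT : 0 < T) {g : Eucl (d + 1) → ℝ}
    (hg : DifferentiableOn ℝ g (closedCyl Ω T)) {x : Eucl d} (hx : x ∈ Ω) (i : Fin d) :
    pd Ω i (fun x => g (pair x 0)) x = dx Ω T i g (pair x 0) := by
  have h1 := (hg _ (mapsTo_pair_zero hT hx)).hasFDerivWithinAt.comp x
    (hasFDerivAt_pair_left 0 x).hasFDerivWithinAt (mapsTo_pair_zero hT)
  unfold pd dx pd
  have h2 := h1.fderivWithin (hΩ.uniqueDiffWithinAt hx)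
  simp only [Function.comp_def] at h2
  rw [h2]
  simp [pair_dir_zero]

lemma contDiffOn_slice (hT : 0 < T) {m : WithTop ℕ∞} {g : Eucl (d + 1) → ℝ}
    (hg : ContDiffOn ℝ m g (closedCyl Ω T)) : ContDiffOn ℝ m (fun x => g (pair x 0)) Ω :=
  hg.comp (contDiff_pair contDiffOn_id contDiffOn_const) (mapsTo_pair_zero hT)

lemma DerivBound.slice (hL : IsLipschitzDomain Ω) (hT : 0 < T) {B : ℝ} {g : Eucl (d + 1) → ℝ}
    (hg : ContDiffOn ℝ 2 g (closedCyl Ω T))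
    (hB : DerivBound (closedCyl Ω T) (closedCyl Ω T) 2 B g) :
    DerivBound Ω Ω 2 B (fun x => g (pair x 0)) := by
  have hS := uniqueDiffOn_closedCyl hL hT
  rw [derivBound_two_iff hS hg Subset.rfl] at hB
  rw [derivBound_two_iff hL.1.uniqueDiffOn (contDiffOn_slice hT hg) Subset.rfl]
  have dg := hg.differentiableOn (by norm_num)
  intro x hx
  obtain ⟨h0, h1, h2⟩ := hB _ (mapsTo_pair_zero hT hx)
  refine ⟨h0, fun i => ?_, fun i j => ?_⟩
  · rw [pd_slice hL.1 hT dg hx]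
    exact h1 _
  · rw [pd_congr (fun y hy => pd_slice hL.1 hT dg hy j) hx,
      pd_slice (g := dx Ω T j g) hL.1 hT
        ((contDiffOn_pd hg hS (k := 1) (by norm_num) _).differentiableOn (by norm_num)) hx]
    exact h2 _ _

lemma mapsTo_xpart : MapsTo xpart (closedCyl Ω T) (closure Ω) := fun _ hz => hz.1

lemma pd_xpart (hL : IsLipschitzDomain Ω) (hT : 0 < T) {a : Eucl d → ℝ}
    (ha : DifferentiableOn ℝ a (closure Ω)) {z : Eucl (d + 1)} (hz : z ∈ closedCyl Ω T)
    (i : Fin (d + 1)) :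
    pd (closedCyl Ω T) i (fun z => a (xpart z)) z
      = fderivWithin ℝ a (closure Ω) (xpart z) (xpart (dir i)) := by
  have h0 : HasFDerivAt (xpart : Eucl (d + 1) → Eucl d)
      ((ContinuousLinearMap.fst ℝ (Eucl d) ℝ).comp (splitL d).toContinuousLinearMap) z :=
    ((ContinuousLinearMap.fst ℝ (Eucl d) ℝ).comp (splitL d).toContinuousLinearMap).hasFDerivAt
  have h1 := (ha _ (mapsTo_xpart hz)).hasFDerivWithinAt.comp z h0.hasFDerivWithinAt
    (mapsTo_xpart (T := T))
  have h2 := h1.fderivWithin (uniqueDiffOn_closedCyl hL hT z hz)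
  simp only [Function.comp_def] at h2
  unfold pd
  rw [h2]
  simp

lemma contDiffOn_comp_xpart {m : WithTop ℕ∞} {a : Eucl d → ℝ} (ha : ContDiffOn ℝ m a (closure Ω)) :
    ContDiffOn ℝ m (fun z => a (xpart z)) (closedCyl Ω T) :=
  ha.comp contDiff_xpart.contDiffOn mapsTo_xpart

lemma DerivBound.comp_xpart (hL : IsLipschitzDomain Ω) (hT : 0 < T) {B : ℝ} {a : Eucl d → ℝ}
    (ha : ContDiffOn ℝ 2 a (closure Ω)) (hB : DerivBound (closure Ω) (closure Ω) 2 B a) :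
    DerivBound (closedCyl Ω T) (closedCyl Ω T) 2 B (fun z => a (xpart z)) := by
  have hS := uniqueDiffOn_closedCyl hL hT
  have hC := uniqueDiffOn_closure hL
  rw [derivBound_two_iff hC ha Subset.rfl] at hB
  rw [derivBound_two_iff hS (contDiffOn_comp_xpart ha) Subset.rfl]
  have da := ha.differentiableOn (by norm_num)
  intro z hz
  obtain ⟨h0, h1, h2⟩ := hB _ (mapsTo_xpart hz)
  have hB0 : 0 ≤ B := (abs_nonneg _).trans h0
  refine ⟨h0, fun i => ?_, fun i j => ?_⟩
  · rw [pd_xpart hL hT da hz]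
    refine Fin.lastCases ?_ (fun i => ?_) i
    · simpa [xpart_dir_last] using hB0
    · rw [xpart_dir_castSucc]
      exact h1 _
  · rw [pd_congr (fun y hy => pd_xpart hL hT da hy j) hz]
    refine Fin.lastCases ?_ (fun j => ?_) j
    · simpa [xpart_dir_last, pd] using hB0
    · rw [xpart_dir_castSucc]
      have h3 := pd_xpart (a := pd (closure Ω) j a) hL hT
        ((contDiffOn_pd ha hC (k := 1) (by norm_num) _).differentiableOn (by norm_num)) hz i
      simp only [pd] at h3 ⊢
      rw [h3]
      refine Fin.lastCases ?_ (fun i => ?_) i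
      · simpa [xpart_dir_last] using hB0
      · rw [xpart_dir_castSucc]
        exact h2 _ _

/-- The derivative of `F(x, u)` in the direction `i` with `u` held fixed. -/
def pdx (S : Set (Eucl (d + 1))) (i : Fin (d + 1)) (F : Eucl (d + 1) → ℝ) : Eucl (d + 1) → ℝ :=
  if i = Fin.last d then fun _ => 0 else pd S i F

lemma mapsTo_pair_xpart (v : Eucl (d + 1) → ℝ) :
    MapsTo (fun z => pair (xpart z) (v z)) (closedCyl Ω T) (cyl (closure Ω) univ) :=
  fun _ hz => pair_mem_cyl.2 ⟨hz.1, mem_univ _⟩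

lemma contDiffOn_nemytskii {m : WithTop ℕ∞} {F v : Eucl (d + 1) → ℝ}
    (hF : ContDiffOn ℝ m F (cyl (closure Ω) univ)) (hv : ContDiffOn ℝ m v (closedCyl Ω T)) :
    ContDiffOn ℝ m (fun z => F (pair (xpart z) (v z))) (closedCyl Ω T) :=
  hF.comp (contDiff_pair contDiff_xpart.contDiffOn hv) (mapsTo_pair_xpart v)

lemma pd_nemytskii (hL : IsLipschitzDomain Ω) (hT : 0 < T) {F v : Eucl (d + 1) → ℝ}
    (hF : DifferentiableOn ℝ F (cyl (closure Ω) univ))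
    (hv : DifferentiableOn ℝ v (closedCyl Ω T)) {z : Eucl (d + 1)} (hz : z ∈ closedCyl Ω T)
    (i : Fin (d + 1)) :
    pd (closedCyl Ω T) i (fun z => F (pair (xpart z) (v z))) z
      = pdx (cyl (closure Ω) univ) i F (pair (xpart z) (v z))
        + pd (cyl (closure Ω) univ) (Fin.last d) F (pair (xpart z) (v z))
          * pd (closedCyl Ω T) i v z := by
  have h0 : HasFDerivWithinAt (xpart : Eucl (d + 1) → Eucl d)
      ((ContinuousLinearMap.fst ℝ (Eucl d) ℝ).comp (splitL d).toContinuousLinearMap)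
      (closedCyl Ω T) z :=
    ((ContinuousLinearMap.fst ℝ (Eucl d) ℝ).comp
      (splitL d).toContinuousLinearMap).hasFDerivAt.hasFDerivWithinAt
  have h1 := (splitL d).symm.hasFDerivAt.comp_hasFDerivWithinAt z
    (h0.prodMk (hv z hz).hasFDerivWithinAt)
  have h2 := (hF _ (mapsTo_pair_xpart v hz)).hasFDerivWithinAt.comp z h1 (mapsTo_pair_xpart v)
  have h3 := h2.fderivWithin (uniqueDiffOn_closedCyl hL hT z hz)
  simp only [Function.comp_def, splitL_symm_apply] at h3
  -- A step in direction `i` moves the argument of `F` by its spatial part, which is zero in the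
  -- time direction, and moves the last argument by the derivative of `v`.
  have h4 : pair (xpart (dir i)) (fderivWithin ℝ v (closedCyl Ω T) z (dir i))
      = (if i = Fin.last d then 0 else dir i)
        + (fderivWithin ℝ v (closedCyl Ω T) z (dir i)) • dir (Fin.last d) := by
    rw [← pair_zero_one, ← pair_smul, smul_zero, mul_one]
    refine Fin.lastCases ?_ (fun i => ?_) i
    · simp [xpart_dir_last]
    · rw [if_neg (Fin.castSucc_lt_last i).ne, ← pair_dir_zero, ← pair_add]
      simp [pair_dir_zero, xpart_dir_castSucc]
  unfold pdx pd
  rw [h3]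
  simp only [ContinuousLinearMap.comp_apply, ContinuousLinearMap.prod_apply,
    ContinuousLinearEquiv.coe_coe, splitL_symm_apply, splitL_apply, ContinuousLinearMap.coe_fst']
  rw [h4, map_add, map_smul, smul_eq_mul]
  split_ifs with hi
  · simp; ring
  · ring

end Chain

/-! ### The nonlinearity -/

section Nonlinearity

variable {d : ℕ} {Ω : Set (Eucl d)} {T : ℝ} {f : Eucl d → ℝ → ℝ} {k : ℕ} {c r : ℝ}

lemma AssumptionA2.contDiffOn (h : AssumptionA2 Ω f k c r) :
    ContDiffOn ℝ 3 (fun z => f (xpart z) (tpart z)) (cyl (closure Ω) univ) :=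
  h.2.2.1.of_le (by have := h.1; exact_mod_cast (by omega : 3 ≤ k - 1))

lemma AssumptionA2.bound_zero (h : AssumptionA2 Ω f k c r) {z : Eucl (d + 1)}
    (hz : z ∈ cyl (closure Ω) univ) :
    |f (xpart z) (tpart z)| ≤ c * |tpart z| ^ (r + 1) := by
  have h1 := h.2.2.2.1 0 (by omega) Fin.elim0 z hz
  have hr := h.2.2.2.2.1
  simpa [max_eq_left (by linarith : (0 : ℝ) ≤ r + 1)] using h1

lemma AssumptionA2.bound_one (h : AssumptionA2 Ω f k c r) (hL : IsLipschitzDomain Ω)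
    {z : Eucl (d + 1)} (hz : z ∈ cyl (closure Ω) univ) (i : Fin (d + 1)) :
    |pd (cyl (closure Ω) univ) i (fun z => f (xpart z) (tpart z)) z|
      ≤ c * |tpart z| ^ (r + 1 - if i = Fin.last d then 1 else 0) := by
  have h1 := h.2.2.2.1 1 (by have := h.1; omega) (fun _ => i) z hz
  have hr := h.2.2.2.2.1
  rw [iteratedFDerivWithin_one_dir (uniqueDiffOn_cyl hL uniqueDiffOn_univ) hz] at h1
  convert h1 using 3
  split_ifs with hi
  · simp only [hi, Finset.filter_true, Finset.card_univ, Fintype.card_fin, Nat.cast_one]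
    rw [max_eq_left (by linarith)]
  · simp only [hi, Finset.filter_false, Finset.card_empty, Nat.cast_zero]
    rw [max_eq_left (by linarith)]

lemma AssumptionA2.bound_two (h : AssumptionA2 Ω f k c r) (hL : IsLipschitzDomain Ω)
    {z : Eucl (d + 1)} (hz : z ∈ cyl (closure Ω) univ) (i j : Fin (d + 1)) :
    |pd (cyl (closure Ω) univ) i
        (pd (cyl (closure Ω) univ) j (fun z => f (xpart z) (tpart z))) z|
      ≤ c * |tpart z| ^ (r + 1 - ((if i = Fin.last d then 1 else 0)
        + if j = Fin.last d then 1 else 0)) := by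
  have h1 := h.2.2.2.1 2 (by have := h.1; omega) ![i, j] z hz
  have hr := h.2.2.2.2.1
  rw [iteratedFDerivWithin_two_dir (uniqueDiffOn_cyl hL uniqueDiffOn_univ)
    (h.contDiffOn.of_le (by norm_num)) hz] at h1
  have h2 : ((Finset.univ.filter fun l : Fin 2 => ![i, j] l = Fin.last d).card : ℝ)
      = (if i = Fin.last d then 1 else 0) + if j = Fin.last d then 1 else 0 := by
    rw [Finset.card_filter, Fin.sum_univ_two]
    by_cases hi : i = Fin.last d <;> by_cases hj : j = Fin.last d <;>
      simp [hi, hj, one_add_one_eq_two]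
  rw [h2, max_eq_left] at h1
  · exact h1
  · split_ifs <;> linarith

/-- Each derivative in the last variable lowers the growth exponent of `f` by one and brings one
factor that is a derivative of `v`, so every term has the same total power `r + 1`. The remaining
exponent is nonnegative since `r ≥ 1` and `p ≤ 2`. -/
lemma rpow_sub_mul_le {w A r : ℝ} {p q : ℕ} (hr : 1 ≤ r) (hw : |w| ≤ A) (hp : p ≤ 2)
    (hpq : p = q) : |w| ^ (r + 1 - p) * A ^ q ≤ A ^ (r + 1) := by
  subst hpq
  have hA : 0 ≤ A := (abs_nonneg _).trans hw
  have hp' : (p : ℝ) ≤ 2 := by exact_mod_cast hp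
  calc |w| ^ (r + 1 - p) * A ^ p ≤ A ^ (r + 1 - p) * A ^ p := by
        gcongr
        linarith
    _ = A ^ (r + 1) := by
        rw [← Real.rpow_natCast A p, ← Real.rpow_add_of_nonneg hA (by linarith) (by positivity)]
        congr 1; ring

/-- A second derivative of f(x, v) has five terms: f_ij, f_iu v_j, f_uj v_i, f_uu v_i v_j and f_u
v_ij. Each is at most c A^{r+1}. -/
lemma AssumptionA2.derivBound (h : AssumptionA2 Ω f k c r) (hL : IsLipschitzDomain Ω) (hT : 0 < T)
    {v : Eucl (d + 1) → ℝ} (hv : ContDiffOn ℝ 2 v (closedCyl Ω T)) {A : ℝ}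
    (hA : DerivBound (closedCyl Ω T) (closedCyl Ω T) 2 A v) :
    DerivBound (closedCyl Ω T) (closedCyl Ω T) 2 (5 * (c * A ^ (r + 1)))
      (fun z => f (xpart z) (v z)) := by
  have hS := uniqueDiffOn_closedCyl hL hT
  have hC : UniqueDiffOn ℝ (cyl (closure Ω) univ) := uniqueDiffOn_cyl hL uniqueDiffOn_univ
  have hc := h.2.1
  have hr := h.2.2.2.2.1
  set C : Set (Eucl (d + 1)) := cyl (closure Ω) univ with hCdef
  set S := closedCyl Ω T with hSdef
  set F : Eucl (d + 1) → ℝ := fun z => f (xpart z) (tpart z) with hF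
  have hF3 : ContDiffOn ℝ 3 F C := h.contDiffOn
  have hFv : (fun z => f (xpart z) (v z)) = fun z => F (pair (xpart z) (v z)) := by
    ext z; simp [hF]
  rw [hFv, derivBound_two_iff hS
    (contDiffOn_nemytskii (hF3.of_le (by norm_num)) hv) Subset.rfl]
  rw [derivBound_two_iff hS hv Subset.rfl] at hA
  have dF := hF3.differentiableOn (by norm_num)
  have dv := hv.differentiableOn (by norm_num)
  have dF' : ∀ i, ContDiffOn ℝ 2 (pd C i F) C := fun i =>
    contDiffOn_pd hF3 hC (by norm_num) i
  have dF'' : ∀ i, ContDiffOn ℝ 2 (pdx C i F) C := fun i => by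
    unfold pdx
    split_ifs
    · exact contDiffOn_const
    · exact dF' i
  have dv' : ∀ i, DifferentiableOn ℝ (pd S i v) S := fun i =>
    (contDiffOn_pd hv hS (k := 1) (by norm_num) i).differentiableOn (by norm_num)
  intro z hz
  obtain ⟨a0, a1, a2⟩ := hA z hz
  have hA0 : 0 ≤ A := (abs_nonneg _).trans a0
  have hAr : 0 ≤ A ^ (r + 1) := by positivity
  set y := pair (xpart z) (v z) with hy
  have hyC : y ∈ C := mapsTo_pair_xpart v hz
  have hty : tpart y = v z := tpart_pair _ _
  have b0 : |F y| ≤ c * A ^ (r + 1) := by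
    refine (h.bound_zero hyC).trans (mul_le_mul_of_nonneg_left ?_ hc.le)
    have := rpow_sub_mul_le (p := 0) (q := 0) hr a0 (by norm_num) rfl
    simpa [hty] using this
  have b1 : |pd C (Fin.last d) F y| * A ≤ c * A ^ (r + 1) := by
    have h1 := h.bound_one hL hyC (Fin.last d)
    rw [if_pos rfl, hty] at h1
    have h2 := rpow_sub_mul_le (p := 1) (q := 1) hr a0 (by norm_num) rfl
    rw [pow_one, Nat.cast_one] at h2
    calc _ ≤ c * |v z| ^ (r + 1 - 1) * A := mul_le_mul_of_nonneg_right h1 hA0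
      _ = c * (|v z| ^ (r + 1 - 1) * A) := by ring
      _ ≤ _ := mul_le_mul_of_nonneg_left h2 hc.le
  have b1x : ∀ i, |pdx C i F y| ≤ c * A ^ (r + 1) := by
    intro i
    unfold pdx
    split_ifs with hi
    · simpa using mul_nonneg hc.le hAr
    · have h1 := h.bound_one hL hyC i
      rw [if_neg hi, hty, sub_zero] at h1
      refine h1.trans (mul_le_mul_of_nonneg_left ?_ hc.le)
      simpa using rpow_sub_mul_le (p := 0) (q := 0) hr a0 (by norm_num) rfl
  have b2 : |pd C (Fin.last d) (pd C (Fin.last d) F) y| * A ^ 2 ≤ c * A ^ (r + 1) := by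
    have h1 := h.bound_two hL hyC (Fin.last d) (Fin.last d)
    rw [if_pos rfl, hty, one_add_one_eq_two] at h1
    have h2 := rpow_sub_mul_le (p := 2) (q := 2) hr a0 (by norm_num) rfl
    rw [Nat.cast_two] at h2
    calc _ ≤ c * |v z| ^ (r + 1 - 2) * A ^ 2 := mul_le_mul_of_nonneg_right h1 (by positivity)
      _ = c * (|v z| ^ (r + 1 - 2) * A ^ 2) := by ring
      _ ≤ _ := mul_le_mul_of_nonneg_left h2 hc.le
  have b2x : ∀ i, |pdx C i (pd C (Fin.last d) F) y| * A ≤ c * A ^ (r + 1) := by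
    intro i
    unfold pdx
    split_ifs with hi
    · simpa using mul_nonneg hc.le hAr
    · have h1 := h.bound_two hL hyC i (Fin.last d)
      rw [if_neg hi, if_pos rfl, hty, zero_add] at h1
      have h2 := rpow_sub_mul_le (p := 1) (q := 1) hr a0 (by norm_num) rfl
      rw [pow_one, Nat.cast_one] at h2
      calc _ ≤ c * |v z| ^ (r + 1 - 1) * A := mul_le_mul_of_nonneg_right h1 hA0
        _ = c * (|v z| ^ (r + 1 - 1) * A) := by ring
        _ ≤ _ := mul_le_mul_of_nonneg_left h2 hc.le
  have b2x' : ∀ j, |pd C (Fin.last d) (pdx C j F) y| * A ≤ c * A ^ (r + 1) := by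
    intro j
    by_cases hj : j = Fin.last d
    · have : pd C (Fin.last d) (pdx C j F) y = 0 := by simp [pdx, hj, pd]
      rw [this]
      simpa using mul_nonneg hc.le hAr
    · have h1 := h.bound_two hL hyC (Fin.last d) j
      rw [if_neg hj, if_pos rfl, hty, add_zero] at h1
      have h2 := rpow_sub_mul_le (p := 1) (q := 1) hr a0 (by norm_num) rfl
      rw [pow_one, Nat.cast_one] at h2
      rw [pdx, if_neg hj]
      calc _ ≤ c * |v z| ^ (r + 1 - 1) * A := mul_le_mul_of_nonneg_right h1 hA0
        _ = c * (|v z| ^ (r + 1 - 1) * A) := by ring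
        _ ≤ _ := mul_le_mul_of_nonneg_left h2 hc.le
  have b2xx : ∀ i j, |pdx C i (pdx C j F) y| ≤ c * A ^ (r + 1) := by
    intro i j
    by_cases hi : i = Fin.last d
    · simpa [pdx, hi] using mul_nonneg hc.le hAr
    by_cases hj : j = Fin.last d
    · simpa [pdx, hi, hj, pd] using mul_nonneg hc.le hAr
    have h1 := h.bound_two hL hyC i j
    rw [if_neg hi, if_neg hj, hty, add_zero, sub_zero] at h1
    rw [pdx, pdx, if_neg hi, if_neg hj]
    refine h1.trans (mul_le_mul_of_nonneg_left ?_ hc.le)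
    simpa using rpow_sub_mul_le (p := 0) (q := 0) hr a0 (by norm_num) rfl
  have hcA : 0 ≤ c * A ^ (r + 1) := mul_nonneg hc.le hAr
  refine ⟨b0.trans (by linarith), fun i => ?_, fun i j => ?_⟩
  · rw [pd_nemytskii hL hT dF dv hz i]
    refine (abs_add_le _ _).trans ?_
    rw [abs_mul]
    have := mul_le_mul_of_nonneg_left (a1 i) (abs_nonneg (pd C (Fin.last d) F y))
    have := b1x i
    linarith
  · have e1 : DifferentiableOn ℝ (fun z => pdx C j F (pair (xpart z) (v z))) S :=
      (contDiffOn_nemytskii (dF'' j) hv).differentiableOn (by norm_num)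
    have e2 : DifferentiableOn ℝ (fun z => pd C (Fin.last d) F (pair (xpart z) (v z))) S :=
      (contDiffOn_nemytskii (dF' _) hv).differentiableOn (by norm_num)
    rw [pd_congr (fun y hy => pd_nemytskii hL hT dF dv hy j) hz,
      pd_add hS hz e1 (e2.fun_mul (dv' j)), pd_mul hS hz e2 (dv' j),
      pd_nemytskii hL hT ((dF'' j).differentiableOn (by norm_num)) dv hz i,
      pd_nemytskii hL hT ((dF' _).differentiableOn (by norm_num)) dv hz i]
    have f1 := b2xx i j
    have f2 : |pd C (Fin.last d) (pdx C j F) y * pd S i v z| ≤ c * A ^ (r + 1) := by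
      rw [abs_mul]
      exact (mul_le_mul_of_nonneg_left (a1 i) (abs_nonneg _)).trans (b2x' j)
    have f3 : |pd C (Fin.last d) F y * pd S i (pd S j v) z| ≤ c * A ^ (r + 1) := by
      rw [abs_mul]
      exact (mul_le_mul_of_nonneg_left (a2 i j) (abs_nonneg _)).trans b1
    have f4 : |pdx C i (pd C (Fin.last d) F) y * pd S j v z| ≤ c * A ^ (r + 1) := by
      rw [abs_mul]
      exact (mul_le_mul_of_nonneg_left (a1 j) (abs_nonneg _)).trans (b2x i)
    have f5 : |pd C (Fin.last d) (pd C (Fin.last d) F) y * pd S i v z * pd S j v z|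
        ≤ c * A ^ (r + 1) := by
      rw [abs_mul, abs_mul, mul_assoc]
      refine (mul_le_mul_of_nonneg_left ?_ (abs_nonneg _)).trans b2
      rw [sq]
      exact mul_le_mul (a1 i) (a1 j) (abs_nonneg _) hA0
    rw [add_mul]
    have g1 := abs_add_le (pdx C i (pdx C j F) y + pd C (Fin.last d) (pdx C j F) y * pd S i v z)
      (pd C (Fin.last d) F y * pd S i (pd S j v) z
        + (pdx C i (pd C (Fin.last d) F) y * pd S j v z
          + pd C (Fin.last d) (pd C (Fin.last d) F) y * pd S i v z * pd S j v z))
    have g2 := abs_add_le (pdx C i (pdx C j F) y) (pd C (Fin.last d) (pdx C j F) y * pd S i v z)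
    have g3 := abs_add_le (pd C (Fin.last d) F y * pd S i (pd S j v) z)
      (pdx C i (pd C (Fin.last d) F) y * pd S j v z
          + pd C (Fin.last d) (pd C (Fin.last d) F) y * pd S i v z * pd S j v z)
    have g4 := abs_add_le (pdx C i (pd C (Fin.last d) F) y * pd S j v z)
      (pd C (Fin.last d) (pd C (Fin.last d) F) y * pd S i v z * pd S j v z)
    linarith

end Nonlinearity

/-! ### Bounds for the residuals -/

section ResidualBounds

variable {d : ℕ} {Ω : Set (Eucl d)} {T : ℝ} {D : WaveData d Ω T} {u v : Eucl (d + 1) → ℝ}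
  {A B : ℝ}

/-- The initial value comes without its own smoothness assumption; on `Ω` it is the trace of `u` at
time 0 and inherits its derivatives from there. -/
lemma resU0_regular (hL : IsLipschitzDomain Ω) (hT : 0 < T)
    (hu : ContDiffOn ℝ 4 u (closedCyl Ω T)) (hsol : IsClassicalSolution D u)
    (hv : ContDiffOn ℝ 4 v (closedCyl Ω T))
    (hA : DerivBound (closedCyl Ω T) (closedCyl Ω T) 2 A v)
    (hB : DerivBound (closedCyl Ω T) (closedCyl Ω T) 2 B u) :
    ContDiffOn ℝ 2 (resU0 D v) Ω ∧ DerivBound Ω Ω 2 (A + B) (resU0 D v) := by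
  have hv2 : ContDiffOn ℝ 2 v (closedCyl Ω T) := hv.of_le (by norm_num)
  have hu2 : ContDiffOn ℝ 2 u (closedCyl Ω T) := hu.of_le (by norm_num)
  have heq : EqOn (resU0 D v) (fun x => v (pair x 0) - u (pair x 0)) Ω := fun x hx => by
    simp only [resU0, hsol.2.2.1 x hx]
  refine ⟨((contDiffOn_slice hT hv2).sub (contDiffOn_slice hT hu2)).congr heq,
    DerivBound.congr heq Subset.rfl ?_⟩
  exact (hA.slice hL hT hv2).sub hL.1.uniqueDiffOn Subset.rfl (contDiffOn_slice hT hv2)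
    (contDiffOn_slice hT hu2) (hB.slice hL hT hu2)

lemma resU1_regular (hL : IsLipschitzDomain Ω) (hT : 0 < T)
    (hu : ContDiffOn ℝ 4 u (closedCyl Ω T)) (hsol : IsClassicalSolution D u)
    (hv : ContDiffOn ℝ 4 v (closedCyl Ω T))
    (hA : DerivBound (closedCyl Ω T) (closedCyl Ω T) 3 A v)
    (hB : DerivBound (closedCyl Ω T) (closedCyl Ω T) 3 B u) :
    ContDiffOn ℝ 2 (resU1 D v) Ω ∧ DerivBound Ω Ω 2 (A + B) (resU1 D v) := by
  have hS := uniqueDiffOn_closedCyl hL hT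
  have hv2 : ContDiffOn ℝ 2 (dt Ω T v) (closedCyl Ω T) := contDiffOn_pd hv hS (by norm_num) _
  have hu2 : ContDiffOn ℝ 2 (dt Ω T u) (closedCyl Ω T) := contDiffOn_pd hu hS (by norm_num) _
  have heq : EqOn (resU1 D v) (fun x => dt Ω T v (pair x 0) - dt Ω T u (pair x 0)) Ω :=
    fun x hx => by simp only [resU1, hsol.2.2.2.1 x hx]
  have hA' : DerivBound (closedCyl Ω T) (closedCyl Ω T) 2 A (dt Ω T v) :=
    derivBound_pd hS (hv.of_le (by norm_num)) Subset.rfl hA _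
  have hB' : DerivBound (closedCyl Ω T) (closedCyl Ω T) 2 B (dt Ω T u) :=
    derivBound_pd hS (hu.of_le (by norm_num)) Subset.rfl hB _
  refine ⟨((contDiffOn_slice hT hv2).sub (contDiffOn_slice hT hu2)).congr heq,
    DerivBound.congr heq Subset.rfl ?_⟩
  exact (hA'.slice hL hT hv2).sub hL.1.uniqueDiffOn Subset.rfl (contDiffOn_slice hT hv2)
    (contDiffOn_slice hT hu2) (hB'.slice hL hT hu2)

lemma pd_initial_eq (hL : IsLipschitzDomain Ω) (hT : 0 < T)
    (hu : ContDiffOn ℝ 4 u (closedCyl Ω T)) (hsol : IsClassicalSolution D u) (i : Fin d) :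
    EqOn (pd Ω i D.u₀) (fun x => dx Ω T i u (pair x 0)) Ω := fun x hx => by
  have h1 : EqOn D.u₀ (fun x => u (pair x 0)) Ω := fun y hy => (hsol.2.2.1 y hy).symm
  rw [pd_congr h1 hx, pd_slice hL.1 hT (hu.differentiableOn (by norm_num)) hx]

lemma resGrad_regular (hL : IsLipschitzDomain Ω) (hT : 0 < T)
    (hu : ContDiffOn ℝ 4 u (closedCyl Ω T)) (hsol : IsClassicalSolution D u)
    (hv : ContDiffOn ℝ 4 v (closedCyl Ω T))
    (hA : DerivBound (closedCyl Ω T) (closedCyl Ω T) 3 A v)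
    (hB : DerivBound (closedCyl Ω T) (closedCyl Ω T) 3 B u) :
    ContDiffOn ℝ 2 (resGradSq D v) Ω ∧ DerivBound Ω Ω 2 (d * (4 * (A + B) ^ 2))
      (resGradSq D v) := by
  have hS := uniqueDiffOn_closedCyl hL hT
  have hv2 : ∀ i, ContDiffOn ℝ 2 (dx Ω T i v) (closedCyl Ω T) := fun i =>
    contDiffOn_pd hv hS (by norm_num) _
  have hu2 : ∀ i, ContDiffOn ℝ 2 (dx Ω T i u) (closedCyl Ω T) := fun i =>
    contDiffOn_pd hu hS (by norm_num) _
  have heq : EqOn (resGradSq D v)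
      (fun x => ∑ i, (dx Ω T i v (pair x 0) - dx Ω T i u (pair x 0)) ^ 2) Ω :=
    fun x hx => by
      simp only [resGradSq, fun i => pd_initial_eq hL hT hu hsol i hx]
  have hA' : ∀ i, DerivBound (closedCyl Ω T) (closedCyl Ω T) 2 A (dx Ω T i v) := fun i =>
    derivBound_pd hS (hv.of_le (by norm_num)) Subset.rfl hA _
  have hB' : ∀ i, DerivBound (closedCyl Ω T) (closedCyl Ω T) 2 B (dx Ω T i u) := fun i =>
    derivBound_pd hS (hu.of_le (by norm_num)) Subset.rfl hB _
  have hr : ∀ i, ContDiffOn ℝ 2 (fun x => dx Ω T i v (pair x 0) - dx Ω T i u (pair x 0)) Ω :=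
    fun i => (contDiffOn_slice hT (hv2 i)).sub (contDiffOn_slice hT (hu2 i))
  refine ⟨ContDiffOn.congr (ContDiffOn.sum fun i _ => (hr i).pow 2) heq,
    DerivBound.congr heq Subset.rfl ?_⟩
  have := DerivBound.sum (s := Finset.univ) (A := fun _ : Fin d => 4 * (A + B) ^ 2)
    hL.1.uniqueDiffOn Subset.rfl (fun i _ => (hr i).pow 2) (fun i _ =>
      DerivBound.sq hL.1.uniqueDiffOn Subset.rfl (hr i)
        (((hA' i).slice hL hT (hv2 i)).sub hL.1.uniqueDiffOn Subset.rfl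
          (contDiffOn_slice hT (hv2 i)) (contDiffOn_slice hT (hu2 i)) ((hB' i).slice hL hT (hu2 i))))
  simpa using this

/-- The factors `1 + d`, 4 and 5 come from the pure second derivatives, from the Leibniz rule for
the damping term and from the five terms of the nonlinearity. -/
lemma resPDE_regular (hL : IsLipschitzDomain Ω) (hT : 0 < T) {k : ℕ} {c r α A₂ A₃ A₄ : ℝ}
    (ha : ContDiffOn ℝ 2 D.a (closure Ω)) (hα : DerivBound (closure Ω) (closure Ω) 2 α D.a)
    (hf : AssumptionA2 Ω D.f k c r) (hv : ContDiffOn ℝ 4 v (closedCyl Ω T))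
    (h2 : DerivBound (closedCyl Ω T) (closedCyl Ω T) 2 A₂ v)
    (h3 : DerivBound (closedCyl Ω T) (closedCyl Ω T) 3 A₃ v)
    (h4 : DerivBound (closedCyl Ω T) (closedCyl Ω T) 4 A₄ v) :
    ContDiffOn ℝ 2 (resPDE D v) (closedCyl Ω T) ∧
      DerivBound (closedCyl Ω T) (closedCyl Ω T) 2
        (A₄ + d * A₄ + 4 * (α * A₃) + 5 * (c * A₂ ^ (r + 1))) (resPDE D v) := by
  have hS := uniqueDiffOn_closedCyl hL hT
  have v3 : ∀ i, ContDiffOn ℝ 3 (pd (closedCyl Ω T) i v) (closedCyl Ω T) := fun i =>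
    contDiffOn_pd hv hS (by norm_num) _
  have v2 : ∀ i, ContDiffOn ℝ 2 (pd (closedCyl Ω T) i (pd (closedCyl Ω T) i v)) (closedCyl Ω T) :=
    fun i => contDiffOn_pd (v3 i) hS (by norm_num) _
  have b3 : ∀ i, DerivBound (closedCyl Ω T) (closedCyl Ω T) 3 A₄ (pd (closedCyl Ω T) i v) :=
    fun i => derivBound_pd hS (hv.of_le (by norm_num)) Subset.rfl h4 _
  have b2 : ∀ i, DerivBound (closedCyl Ω T) (closedCyl Ω T) 2 A₄
      (pd (closedCyl Ω T) i (pd (closedCyl Ω T) i v)) :=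
    fun i => derivBound_pd hS ((v3 i).of_le (by norm_num)) Subset.rfl (b3 i) _
  have b2' : DerivBound (closedCyl Ω T) (closedCyl Ω T) 2 A₃ (dt Ω T v) :=
    derivBound_pd hS (hv.of_le (by norm_num)) Subset.rfl h3 _
  have r1 : ContDiffOn ℝ 2 (fun z => ∑ i : Fin d, dx Ω T i (dx Ω T i v) z) (closedCyl Ω T) :=
    ContDiffOn.sum fun i _ => v2 _
  have s1 : DerivBound (closedCyl Ω T) (closedCyl Ω T) 2 (d * A₄)
      (fun z => ∑ i : Fin d, dx Ω T i (dx Ω T i v) z) := by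
    have := DerivBound.sum (s := Finset.univ) (A := fun _ : Fin d => A₄)
      (G := fun i => dx Ω T i (dx Ω T i v)) hS Subset.rfl
      (fun i _ => v2 i.castSucc) (fun i _ => b2 i.castSucc)
    simpa using this
  have rt : ContDiffOn ℝ 2 (dt Ω T v) (closedCyl Ω T) := (v3 _).of_le (by norm_num)
  have ra : ContDiffOn ℝ 2 (fun z => D.a (xpart z)) (closedCyl Ω T) := contDiffOn_comp_xpart ha
  have rf : ContDiffOn ℝ 2 (fun z => D.f (xpart z) (v z)) (closedCyl Ω T) := by
    have := contDiffOn_nemytskii (hf.contDiffOn.of_le (by norm_num : (2 : WithTop ℕ∞) ≤ 3))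
      (hv.of_le (by norm_num : (2 : WithTop ℕ∞) ≤ 4))
    simpa using this
  have q1 := (v2 (Fin.last d)).sub r1
  have q2 := q1.add (ra.mul rt)
  have p1 := (b2 (Fin.last d)).sub hS Subset.rfl (v2 _) r1 s1
  have p2 := p1.add hS Subset.rfl q1 (ra.mul rt)
    ((hα.comp_xpart hL hT ha).mul hS Subset.rfl ra rt b2')
  exact ⟨q2.add rf, p2.add hS Subset.rfl q2 rf
    (hf.derivBound hL hT (hv.of_le (by norm_num)) h2)⟩

/-- The Leibniz factor 4 of a square and (A + B)² ≤ 2 (A² + B²) give 8. -/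
lemma const1_le (hL : IsLipschitzDomain Ω) (hT : 0 < T)
    (hu : ContDiffOn ℝ 4 u (closedCyl Ω T)) (hsol : IsClassicalSolution D u)
    (hv : ContDiffOn ℝ 4 v (closedCyl Ω T))
    (hA : DerivBound (closedCyl Ω T) (closedCyl Ω T) 3 A v)
    (hB : DerivBound (closedCyl Ω T) (closedCyl Ω T) 3 B u) {CΩ : ℝ} (hC : 0 ≤ CΩ) :
    const1 D v CΩ ≤ 8 * CΩ * (A ^ 2 + B ^ 2) := by
  obtain ⟨h1, h2⟩ := resU1_regular hL hT hu hsol hv hA hB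
  have h3 := (h2.sq hL.1.uniqueDiffOn Subset.rfl h1).cNormOn_le (by positivity)
  calc CΩ * cNorm Ω 2 (fun x => resU1 D v x ^ 2) ≤ CΩ * (8 * (A ^ 2 + B ^ 2)) :=
        mul_le_mul_of_nonneg_left (h3.trans (by nlinarith [sq_nonneg (A - B)])) hC
    _ = _ := by ring

lemma const3_le (hL : IsLipschitzDomain Ω) (hT : 0 < T)
    (hu : ContDiffOn ℝ 4 u (closedCyl Ω T)) (hsol : IsClassicalSolution D u)
    (hv : ContDiffOn ℝ 4 v (closedCyl Ω T))
    (hA : DerivBound (closedCyl Ω T) (closedCyl Ω T) 3 A v)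
    (hB : DerivBound (closedCyl Ω T) (closedCyl Ω T) 3 B u) {CΩ : ℝ} (hC : 0 ≤ CΩ) :
    const3 D v CΩ ≤ 8 * d * CΩ * (A ^ 2 + B ^ 2) := by
  obtain ⟨h1, h2⟩ := resGrad_regular hL hT hu hsol hv hA hB
  have h3 := h2.cNormOn_le (by positivity)
  calc CΩ * cNorm Ω 2 (resGradSq D v) ≤ CΩ * (d * (8 * (A ^ 2 + B ^ 2))) :=
        mul_le_mul_of_nonneg_left (h3.trans (mul_le_mul_of_nonneg_left
          (by nlinarith [sq_nonneg (A - B)]) (by positivity))) hC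
    _ = _ := by ring

lemma const5_le (hL : IsLipschitzDomain Ω) (hT : 0 < T)
    (hu : ContDiffOn ℝ 4 u (closedCyl Ω T)) (hsol : IsClassicalSolution D u)
    (hv : ContDiffOn ℝ 4 v (closedCyl Ω T))
    (hA : DerivBound (closedCyl Ω T) (closedCyl Ω T) 2 A v)
    (hB : DerivBound (closedCyl Ω T) (closedCyl Ω T) 2 B u) {CΩ Cpw : ℝ} (hC : 0 ≤ CΩ) :
    const5 D v CΩ Cpw ≤ 16 * CΩ / Cpw ^ 2 * (A ^ 2 + B ^ 2) := by
  obtain ⟨h1, h2⟩ := resU0_regular hL hT hu hsol hv hA hB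
  have h3 := (h2.sq hL.1.uniqueDiffOn Subset.rfl h1).cNormOn_le (by positivity)
  calc 2 * CΩ / Cpw ^ 2 * cNorm Ω 2 (fun x => resU0 D v x ^ 2)
      ≤ 2 * CΩ / Cpw ^ 2 * (8 * (A ^ 2 + B ^ 2)) :=
        mul_le_mul_of_nonneg_left (h3.trans (by nlinarith [sq_nonneg (A - B)])) (by positivity)
    _ = _ := by ring

lemma dt_sq_regular (hL : IsLipschitzDomain Ω) (hT : 0 < T)
    (hv : ContDiffOn ℝ 4 v (closedCyl Ω T))
    (hA : DerivBound (closedCyl Ω T) (closedCyl Ω T) 3 A v) :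
    ContDiffOn ℝ 2 (fun z => dt Ω T v z ^ 2) (closedCyl Ω T) ∧
      DerivBound (closedCyl Ω T) (closedCyl Ω T) 2 (4 * A ^ 2) (fun z => dt Ω T v z ^ 2) := by
  have hS := uniqueDiffOn_closedCyl hL hT
  have v2 : ContDiffOn ℝ 2 (dt Ω T v) (closedCyl Ω T) := contDiffOn_pd hv hS (by norm_num) _
  have b2 : DerivBound (closedCyl Ω T) (closedCyl Ω T) 2 A (dt Ω T v) :=
    derivBound_pd hS (hv.of_le (by norm_num)) Subset.rfl hA _
  exact ⟨v2.pow 2, b2.sq hS Subset.rfl v2⟩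

lemma cyl_frontier_subset : cyl (frontier Ω) (Icc 0 T) ⊆ closedCyl Ω T :=
  fun _ hz => ⟨frontier_subset_closure hz.1, hz.2⟩

lemma const4_le (hL : IsLipschitzDomain Ω) (hT : 0 < T)
    (hv : ContDiffOn ℝ 4 v (closedCyl Ω T)) (hA0 : 0 ≤ A)
    (hA : DerivBound (closedCyl Ω T) (closedCyl Ω T) 3 A v) {CΓ : ℝ} (hC : 0 ≤ CΓ) :
    const4 Ω T v CΓ ≤ 2 * √CΓ * A := by
  obtain ⟨h1, h2⟩ := dt_sq_regular hL hT hv hA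
  have h3 := (h2.mono le_rfl le_rfl cyl_frontier_subset).cNormOn_le (by positivity)
  refine (Real.sqrt_le_sqrt (mul_le_mul_of_nonneg_left h3 hC)).trans (le_of_eq ?_)
  rw [Real.sqrt_mul hC, show 4 * A ^ 2 = (2 * A) ^ 2 by ring, Real.sqrt_sq (by positivity)]
  ring

/-- The factor 12 is 4, from squaring the residual, times 3, from (X + 4Y + 5Z)² ≤ 3 (X² + 16 Y² +
25 Z²). -/
lemma const2_le (hL : IsLipschitzDomain Ω) (hT : 0 < T) {k : ℕ} {c r α A₂ A₃ A₄ : ℝ}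
    (ha : ContDiffOn ℝ 2 D.a (closure Ω)) (hα : DerivBound (closure Ω) (closure Ω) 2 α D.a)
    (hf : AssumptionA2 Ω D.f k c r) (hv : ContDiffOn ℝ 4 v (closedCyl Ω T))
    (h2 : DerivBound (closedCyl Ω T) (closedCyl Ω T) 2 A₂ v)
    (h3 : DerivBound (closedCyl Ω T) (closedCyl Ω T) 3 A₃ v)
    (h4 : DerivBound (closedCyl Ω T) (closedCyl Ω T) 4 A₄ v) {C : ℝ} (hC : 0 ≤ C) :
    const2 D v C ≤ C * (12 * (((d + 1) * A₄) ^ 2 + 16 * (α * A₃) ^ 2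
      + 25 * (c * A₂ ^ (r + 1)) ^ 2)) := by
  obtain ⟨r1, r2⟩ := resPDE_regular hL hT ha hα hf hv h2 h3 h4
  have h5 := (r2.sq (uniqueDiffOn_closedCyl hL hT) Subset.rfl r1).cNormOn_le (by positivity)
  refine mul_le_mul_of_nonneg_left (h5.trans ?_) hC
  generalize c * A₂ ^ (r + 1) = Z
  generalize α * A₃ = Y
  have e : A₄ + d * A₄ = (d + 1) * A₄ := by ring
  rw [e]
  generalize ((d : ℝ) + 1) * A₄ = X
  nlinarith [sq_nonneg (X - 4 * Y), sq_nonneg (X - 5 * Z), sq_nonneg (4 * Y - 5 * Z)]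

end ResidualBounds

/-! ### Networks on the space-time cylinder -/

section NetworkBounds

variable {d : ℕ} {σ : ℝ → ℝ} {W l L : ℕ} {R : ℝ} {S : Set (Eucl (d + 1))}

/-- The factor 16^l (d+1)^{2n} in the a priori bound is not used up by the derivatives; with `l ≥ 2`
it is at least 256 (d+1)^{2n}. One factor 2 pays for the values of the network, and the rest is kept
for later. A single layer is affine, so its values depend on the size of the domain and not on the
weights alone. -/
lemma Net.derivBound_fn_of_two_le (hσ : ContDiff ℝ 4 σ)
    (hσb : ∀ n ≤ 4, ∃ b, ∀ x, |iteratedDeriv n σ x| ≤ b)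
    (hσ1 : ∀ n ∈ Finset.Icc 1 4, 1 ≤ actNorm σ n) (hR : 1 ≤ R) (hS : UniqueDiffOn ℝ S)
    (hl : 2 ≤ l) (hlL : l ≤ L)
    (θ : Net l (d + 1) 1) (hθ : θ.SizeBound W R) {n : ℕ} (hn : n ∈ Finset.Icc 1 4) :
    DerivBound S S n (netBound σ d L W R n / (128 * ((d : ℝ) + 1) ^ (2 * n))) (θ.fn σ) := by
  obtain ⟨hn1, hn4⟩ := Finset.mem_Icc.1 hn
  have hW : (1 : ℝ) ≤ W := by exact_mod_cast hθ.one_le_width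
  have hfac : (1 : ℝ) ≤ n.factorial := Nat.one_le_cast.2 (Nat.factorial_pos n)
  have hs := hσ1 n hn
  have hWR : 1 ≤ W * R := one_le_mul_of_one_le_of_one_le hW hR
  have hX : 1 ≤ W * R * (n.factorial * actNorm σ n) :=
    one_le_mul_of_one_le_of_one_le hWR (one_le_mul_of_one_le_of_one_le hfac hs)
  have hle := le_netBound (d := d) hR hθ.one_le_width hlL hn hs
  have hdpos : (0 : ℝ) < ((d : ℝ) + 1) ^ (2 * n) := by positivity
  have h16 : (256 : ℝ) ≤ 16 ^ l := by
    calc (256 : ℝ) = 16 ^ 2 := by norm_num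
      _ ≤ 16 ^ l := pow_le_pow_right₀ (by norm_num) hl
  have key : 2 * (W * R * (n.factorial * actNorm σ n)) ^ (n * l)
      ≤ netBound σ d L W R n / (128 * ((d : ℝ) + 1) ^ (2 * n)) := by
    rw [le_div_iff₀ (by positivity)]
    refine le_trans ?_ hle
    have : 0 ≤ ((d : ℝ) + 1) ^ (2 * n) * (W * R * (n.factorial * actNorm σ n)) ^ (n * l) := by
      positivity
    nlinarith
  intro j hj s z hz
  refine le_trans ?_ key
  have hXp : 1 ≤ (W * R * (n.factorial * actNorm σ n)) ^ (n * l) := one_le_pow₀ hX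
  rcases Nat.eq_zero_or_pos j with rfl | hj0
  · simp only [iteratedFDerivWithin_zero_apply]
    have hσ0 : ∀ x, |σ x| ≤ actNorm σ n := fun x => by
      simpa using abs_iteratedDeriv_le_actNorm (j := 0)
        (fun j hj => hσb j (hj.trans hn4)) (Nat.zero_le n) x
    have h1 : |θ.fn σ z| ≤ W * R * actNorm σ n + R := by
      cases θ with
      | output A b => omega
      | layer A b θ =>
        exact Net.abs_realize_le (by linarith) (actNorm_nonneg σ n) hσ0 θ hθ.2.2.2
          (fun i => hσ0 _) 0
    refine h1.trans ?_
    have h2 : W * R * actNorm σ n ≤ W * R * (n.factorial * actNorm σ n) := by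
      refine mul_le_mul_of_nonneg_left ?_ (by linarith)
      exact le_mul_of_one_le_left (by linarith) hfac
    have h3 : W * R * (n.factorial * actNorm σ n)
        ≤ (W * R * (n.factorial * actNorm σ n)) ^ (n * l) := by
      refine le_self_pow₀ hX ?_
      have := Nat.mul_pos hn1 (by omega : 0 < l)
      omega
    have h4 : R ≤ W * R * actNorm σ n := by
      have := one_le_mul_of_one_le_of_one_le hW hs
      nlinarith
    linarith
  · rw [iteratedFDerivWithin_eq_iteratedFDeriv hS
      ((θ.contDiff_fn hσ).of_le (by exact_mod_cast hj.trans hn4)).contDiffAt hz]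
    have h1 := (iteratedFDeriv ℝ j (θ.fn σ) z).le_opNorm (fun l => dir (s l))
    simp only [norm_dir, Finset.prod_const_one, mul_one, Real.norm_eq_abs] at h1
    refine h1.trans ((θ.norm_iteratedFDeriv_fn_le hσ hσb hσ1 hR hθ hn hj0 hj z).trans ?_)
    linarith

/-- First derivatives, unlike values, are controlled by the weights for networks with one layer too.
This supplies the constant of the boundary term for every network in the class. -/
lemma Net.abs_pd_fn_le (hσ : ContDiff ℝ 4 σ)
    (hσb : ∀ n ≤ 4, ∃ b, ∀ x, |iteratedDeriv n σ x| ≤ b)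
    (hσ1 : ∀ n ∈ Finset.Icc 1 4, 1 ≤ actNorm σ n) (hR : 1 ≤ R) (hS : UniqueDiffOn ℝ S)
    (hlL : l ≤ L) (θ : Net l (d + 1) 1) (hθ : θ.SizeBound W R) {z : Eucl (d + 1)} (hz : z ∈ S)
    (i : Fin (d + 1)) : |pd S i (θ.fn σ) z| ≤ netBound σ d L W R 1 := by
  have hn : (1 : ℕ) ∈ Finset.Icc 1 4 := by simp
  have h0 := iteratedFDerivWithin_one_dir (g := θ.fn σ) hS hz (fun _ => i)
  rw [← h0, iteratedFDerivWithin_eq_iteratedFDeriv hS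
      ((θ.contDiff_fn hσ).of_le (by norm_num)).contDiffAt hz]
  have h1 := (iteratedFDeriv ℝ 1 (θ.fn σ) z).le_opNorm (fun l => dir i)
  simp only [norm_dir, Finset.prod_const_one, mul_one, Real.norm_eq_abs] at h1
  refine h1.trans ((θ.norm_iteratedFDeriv_fn_le hσ hσb hσ1 hR hθ hn le_rfl le_rfl z).trans ?_)
  refine le_trans ?_ (le_netBound (d := d) hR hθ.one_le_width hlL hn (hσ1 1 hn))
  have hW : (1 : ℝ) ≤ W := by exact_mod_cast hθ.one_le_width
  have hs := actNorm_nonneg σ 1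
  refine le_mul_of_one_le_left (by positivity) ?_
  refine one_le_mul_of_one_le_of_one_le (one_le_pow₀ (by norm_num)) (one_le_pow₀ ?_)
  have : (0 : ℝ) ≤ d := by positivity
  linarith

/-- One-layer networks are included because the domain is bounded: `s` dominates both the input
coordinates and the values of `σ`. -/
lemma Net.exists_derivBound_fn (hσ : ContDiff ℝ 4 σ)
    (hσb : ∀ n ≤ 4, ∃ b, ∀ x, |iteratedDeriv n σ x| ≤ b)
    (hσ1 : ∀ n ∈ Finset.Icc 1 4, 1 ≤ actNorm σ n) (hR : 1 ≤ R) (hS : UniqueDiffOn ℝ S)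
    (hSb : Bornology.IsBounded S) (L : ℕ) :
    ∃ B : ℝ, 0 ≤ B ∧ ∀ l ≤ L, ∀ θ : Net l (d + 1) 1, θ.SizeBound W R →
      DerivBound S S 4 B (θ.fn σ) := by
  obtain ⟨X, hX⟩ := hSb.exists_norm_le
  have hn : (4 : ℕ) ∈ Finset.Icc 1 4 := by simp
  set s := max |X| (actNorm σ 4) with hs
  set Y := W * R * (Nat.factorial 4 * actNorm σ 4) with hY
  have hs0 : 0 ≤ s := (abs_nonneg _).trans (le_max_left _ _)
  have ha0 := actNorm_nonneg σ 4
  refine ⟨W * R * s + R + Y ^ (4 * L), by positivity, fun l hl θ hθ j hj t z hz => ?_⟩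
  have hW : (1 : ℝ) ≤ W := by exact_mod_cast hθ.one_le_width
  have hY0 : 0 ≤ Y ^ (4 * L) := by positivity
  rcases Nat.eq_zero_or_pos j with rfl | hj0
  · simp only [iteratedFDerivWithin_zero_apply]
    have h1 : |θ.fn σ z| ≤ W * R * s + R := by
      refine Net.abs_realize_le (by linarith) hs0 (fun x => ?_) θ hθ (fun i => ?_) 0
      · refine le_trans ?_ (le_max_right _ _)
        simpa using abs_iteratedDeriv_le_actNorm (j := 0) hσb (Nat.zero_le 4) x
      · refine le_trans ?_ (le_max_left _ _)
        exact (PiLp.norm_apply_le z i).trans ((hX z hz).trans (le_abs_self _))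
    linarith
  · rw [iteratedFDerivWithin_eq_iteratedFDeriv hS
      ((θ.contDiff_fn hσ).of_le (by exact_mod_cast hj)).contDiffAt hz]
    have h1 := (iteratedFDeriv ℝ j (θ.fn σ) z).le_opNorm (fun l => dir (t l))
    simp only [norm_dir, Finset.prod_const_one, mul_one, Real.norm_eq_abs] at h1
    refine h1.trans ((θ.norm_iteratedFDeriv_fn_le hσ hσb hσ1 hR hθ hn hj0 hj z).trans ?_)
    have hY1 : 1 ≤ Y := one_le_mul_of_one_le_of_one_le (one_le_mul_of_one_le_of_one_le hW hR)
      (one_le_mul_of_one_le_of_one_le (Nat.one_le_cast.2 (Nat.factorial_pos 4)) (hσ1 4 hn))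
    have h2 : Y ^ (4 * l) ≤ Y ^ (4 * L) := pow_le_pow_right₀ hY1 (Nat.mul_le_mul_left 4 hl)
    have h3 : 0 ≤ W * R * s + R := by positivity
    linarith

lemma netBound_nonneg (hR : 0 ≤ R) (n : ℕ) : 0 ≤ netBound σ d L W R n := by
  have := actNorm_nonneg σ n
  unfold netBound
  positivity

end NetworkBounds

/-- Only the bound for C₂ needs the spare factor 128 (d+1)^{2n}: it absorbs the 25 in front of the
nonlinear term and one power of `d + 1` in front of the fourth derivatives. The damping term fits as
it is, since 12 ≤ 16. -/
lemma constants_le {d : ℕ} {Ω : Set (Eucl d)} (hL : IsLipschitzDomain Ω) {T : ℝ} (hT : 0 < T)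
    {CΩ CΩT CΓ : ℝ} (hCΩ : 0 ≤ CΩ) (hCΩT : 0 ≤ CΩT) (hCΓ : 0 ≤ CΓ) {D : WaveData d Ω T} {k : ℕ}
    {c r : ℝ} (ha : ContDiffOn ℝ 2 D.a (closure Ω)) (hf : AssumptionA2 Ω D.f k c r)
    {u : Eucl (d + 1) → ℝ} (hu : ContDiffOn ℝ 4 u (closedCyl Ω T)) (hsol : IsClassicalSolution D u)
    (Cpw : ℝ) {σ : ℝ → ℝ} (hσ : ContDiff ℝ 4 σ)
    (hσb : ∀ n ≤ 4, ∃ b, ∀ x, |iteratedDeriv n σ x| ≤ b)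
    (hσ1 : ∀ n ∈ Finset.Icc 1 4, 1 ≤ actNorm σ n) {l L W : ℕ} {R : ℝ} (hR : 1 ≤ R)
    (hl : 2 ≤ l) (hlL : l ≤ L) (θ : Net l (d + 1) 1) (hθ : θ.SizeBound W R) :
    const1 D (θ.fn σ) CΩ ≤
        8 * CΩ * (netBound σ d L W R 3 ^ 2 + cNorm (closedCyl Ω T) 3 u ^ 2) ∧
    const2 D (θ.fn σ) CΩT ≤
        16 * CΩT * (((d : ℝ) + 1) * netBound σ d L W R 4 ^ 2
          + 16 * cNorm (closure Ω) 2 D.a ^ 2 * netBound σ d L W R 3 ^ 2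
          + c ^ 2 * netBound σ d L W R 2 ^ (2 * (r + 1))) ∧
    const3 D (θ.fn σ) CΩ ≤
        8 * d * CΩ * (netBound σ d L W R 3 ^ 2 + cNorm (closedCyl Ω T) 3 u ^ 2) ∧
    const4 Ω T (θ.fn σ) CΓ ≤ 2 * √CΓ * netBound σ d L W R 3 ∧
    const5 D (θ.fn σ) CΩ Cpw ≤
        16 * CΩ / Cpw ^ 2 * (netBound σ d L W R 2 ^ 2 + cNorm (closedCyl Ω T) 2 u ^ 2) := by
  have hS := uniqueDiffOn_closedCyl hL hT
  have hK := isCompact_closedCyl hL T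
  have hv : ContDiffOn ℝ 4 (θ.fn σ) (closedCyl Ω T) := (θ.contDiff_fn hσ).contDiffOn
  have hA : ∀ n, 0 ≤ netBound σ d L W R n := fun n => netBound_nonneg (by linarith) n
  have hd1 : (1 : ℝ) ≤ d + 1 := by
    have : (0 : ℝ) ≤ d := by positivity
    linarith
  have hb : ∀ n ∈ Finset.Icc 1 4, DerivBound (closedCyl Ω T) (closedCyl Ω T) n
      (netBound σ d L W R n / (128 * ((d : ℝ) + 1) ^ (2 * n))) (θ.fn σ) := fun n hn =>
    θ.derivBound_fn_of_two_le hσ hσb hσ1 hR hS hl hlL hθ hn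
  have hle : ∀ n, netBound σ d L W R n / (128 * ((d : ℝ) + 1) ^ (2 * n))
      ≤ netBound σ d L W R n / 128 := fun n => by
    refine div_le_div_of_nonneg_left (hA n) (by norm_num) ?_
    exact le_mul_of_one_le_right (by norm_num) (one_le_pow₀ hd1)
  have hle' : ∀ n, netBound σ d L W R n / 128 ≤ netBound σ d L W R n := fun n => by
    linarith [hA n]
  have hb' : ∀ n ∈ Finset.Icc 1 4, DerivBound (closedCyl Ω T) (closedCyl Ω T) n
      (netBound σ d L W R n) (θ.fn σ) := fun n hn =>
    (hb n hn).mono le_rfl ((hle n).trans (hle' n)) Subset.rfl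
  have hB : ∀ n ≤ 4, DerivBound (closedCyl Ω T) (closedCyl Ω T) n (cNorm (closedCyl Ω T) n u) u :=
    fun n hn => derivBound_cNorm_of_isCompact hS hK (hu.of_le (by exact_mod_cast hn))
  have hα := derivBound_cNorm_of_isCompact (m := 2) (uniqueDiffOn_closure hL)
    hL.2.2.1.isCompact_closure ha
  refine ⟨const1_le hL hT hu hsol hv (hb' 3 (by simp)) (hB 3 (by simp)) hCΩ, ?_,
    const3_le hL hT hu hsol hv (hb' 3 (by simp)) (hB 3 (by simp)) hCΩ,
    const4_le hL hT hv (hA 3) (hb' 3 (by simp)) hCΓ,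
    const5_le hL hT hu hsol hv (hb' 2 (by simp)) (hB 2 (by simp)) hCΩ⟩
  refine (const2_le hL hT ha hα hf hv (hb 2 (by simp)) (hb' 3 (by simp)) (hb 4 (by simp))
    hCΩT).trans ?_
  have hc := hf.2.1
  have hr := hf.2.2.2.2.1
  have h1 : (((d : ℝ) + 1) * (netBound σ d L W R 4 / (128 * ((d : ℝ) + 1) ^ (2 * 4)))) ^ 2
      ≤ ((d : ℝ) + 1) * netBound σ d L W R 4 ^ 2 := by
    have h2 : ((d : ℝ) + 1) * (netBound σ d L W R 4 / (128 * ((d : ℝ) + 1) ^ (2 * 4)))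
        ≤ netBound σ d L W R 4 := by
      rw [mul_div_assoc', div_le_iff₀ (by positivity), mul_comm]
      refine mul_le_mul_of_nonneg_left ?_ (hA 4)
      have := le_self_pow₀ hd1 (n := 2 * 4) (by norm_num)
      linarith
    have h0 : 0 ≤ ((d : ℝ) + 1) * (netBound σ d L W R 4 / (128 * ((d : ℝ) + 1) ^ (2 * 4))) :=
      mul_nonneg (by positivity) (div_nonneg (hA 4) (by positivity))
    exact (pow_le_pow_left₀ h0 h2 2).trans (le_mul_of_one_le_left (by positivity) hd1)
  have h3 : 25 * (c * (netBound σ d L W R 2 / (128 * ((d : ℝ) + 1) ^ (2 * 2))) ^ (r + 1)) ^ 2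
      ≤ c ^ 2 * netBound σ d L W R 2 ^ (2 * (r + 1)) := by
    set N := netBound σ d L W R 2 with hN
    have hN0 : 0 ≤ N := hA 2
    have h4 : (N / (128 * ((d : ℝ) + 1) ^ (2 * 2))) ^ (r + 1) ≤ N ^ (r + 1) / 128 := by
      calc _ ≤ (N / 128) ^ (r + 1) := Real.rpow_le_rpow (div_nonneg hN0 (by positivity)) (hle 2)
            (by linarith)
        _ = N ^ (r + 1) / 128 ^ (r + 1) := Real.div_rpow hN0 (by norm_num) _
        _ ≤ N ^ (r + 1) / 128 := by
            refine div_le_div_of_nonneg_left (by positivity) (by norm_num) ?_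
            exact Real.self_le_rpow_of_one_le (by norm_num) (by linarith)
    have h5 : N ^ (2 * (r + 1)) = (N ^ (r + 1)) ^ 2 := by
      rw [mul_comm, Real.rpow_mul hN0]; norm_cast
    have h6 : 0 ≤ (N / (128 * ((d : ℝ) + 1) ^ (2 * 2))) ^ (r + 1) :=
      Real.rpow_nonneg (div_nonneg hN0 (by positivity)) _
    rw [h5, mul_pow]
    have h7 := pow_le_pow_left₀ h6 h4 2
    have h8 : 0 ≤ c ^ 2 := by positivity
    have h9 : 0 ≤ (N ^ (r + 1)) ^ 2 := by positivity
    nlinarith [mul_le_mul_of_nonneg_left h7 h8, mul_nonneg h8 h9]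
  have h10 : 0 ≤ ((d : ℝ) + 1) * netBound σ d L W R 4 ^ 2 := by positivity
  have h11 : 0 ≤ (cNorm (closure Ω) 2 D.a * netBound σ d L W R 3) ^ 2 := by positivity
  have h12 : 0 ≤ c ^ 2 * netBound σ d L W R 2 ^ (2 * (r + 1)) :=
    mul_nonneg (by positivity) (Real.rpow_nonneg (hA 2) _)
  calc _ ≤ CΩT * (16 * (((d : ℝ) + 1) * netBound σ d L W R 4 ^ 2
          + 16 * (cNorm (closure Ω) 2 D.a * netBound σ d L W R 3) ^ 2
          + c ^ 2 * netBound σ d L W R 2 ^ (2 * (r + 1)))) :=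
        mul_le_mul_of_nonneg_left (by linarith) hCΩT
    _ = _ := by ring

/-! ### The midpoint rule on a cube -/

/-- If symmetric second differences of `φ` about `c` are at most `2 B`, the midpoint rule on a cube
is off by at most `B` times the volume. -/
lemma integral_ball_le_midpoint {n : ℕ} {φ : (Fin n → ℝ) → ℝ} {c : Fin n → ℝ} {ρ B : ℝ}
    (hρ : 0 < ρ) (hφ : IntegrableOn φ (Metric.ball c ρ))
    (h : ∀ w ∈ Metric.ball (0 : Fin n → ℝ) ρ, φ (c + w) + φ (c - w) ≤ 2 * φ c + 2 * B) :
    ∫ y in Metric.ball c ρ, φ y ≤ (2 * ρ) ^ n * (φ c + B) := by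
  -- Translation and reflection carry the centred cube onto the given one; averaging both
  -- parametrisations makes only symmetric second differences appear.
  have m1 : MeasurePreserving (fun w : Fin n → ℝ => c + w) volume volume :=
    measurePreserving_add_left volume c
  have m2 : MeasurePreserving (fun w : Fin n → ℝ => c - w) volume volume :=
    Measure.measurePreserving_sub_left volume c
  have e1 : MeasurableEmbedding (fun w : Fin n → ℝ => c + w) := measurableEmbedding_addLeft c
  have e2 : MeasurableEmbedding (fun w : Fin n → ℝ => c - w) :=
    (Homeomorph.subLeft c).measurableEmbedding
  have p1 : (fun w : Fin n → ℝ => c + w) ⁻¹' Metric.ball c ρ = Metric.ball 0 ρ := by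
    ext w; simp
  have p2 : (fun w : Fin n → ℝ => c - w) ⁻¹' Metric.ball c ρ = Metric.ball 0 ρ := by
    ext w; simp [dist_eq_norm]
  have i1 := m1.setIntegral_preimage_emb e1 φ (Metric.ball c ρ)
  have i2 := m2.setIntegral_preimage_emb e2 φ (Metric.ball c ρ)
  have g1 := (m1.integrableOn_comp_preimage e1 (s := Metric.ball c ρ)).2 hφ
  have g2 := (m2.integrableOn_comp_preimage e2 (s := Metric.ball c ρ)).2 hφ
  rw [p1] at i1 g1
  rw [p2] at i2 g2
  have hvol : volume.real (Metric.ball (0 : Fin n → ℝ) ρ) = (2 * ρ) ^ n := by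
    rw [measureReal_def, Real.volume_pi_ball _ hρ, ENNReal.toReal_ofReal (by positivity),
      Fintype.card_fin]
  have hfin : volume (Metric.ball (0 : Fin n → ℝ) ρ) ≠ ⊤ := measure_ball_lt_top.ne
  have key : ∫ w in Metric.ball (0 : Fin n → ℝ) ρ, (φ (c + w) + φ (c - w))
      ≤ ∫ w in Metric.ball (0 : Fin n → ℝ) ρ, (2 * φ c + 2 * B) := by
    refine setIntegral_mono_on (g1.add g2) (integrableOn_const hfin) measurableSet_ball h
  change IntegrableOn (fun w => φ (c + w)) _ _ at g1
  change IntegrableOn (fun w => φ (c - w)) _ _ at g2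
  rw [integral_add g1 g2, i1, i2, setIntegral_const, hvol, smul_eq_mul] at key
  linarith

lemma clm_apply_eq_sum {n : ℕ} (L : Eucl n →L[ℝ] ℝ) (w : Eucl n) :
    L w = ∑ i, w i * L (dir i) := by
  have h := (EuclideanSpace.basisFun (Fin n) ℝ).sum_repr w
  conv_lhs => rw [← h]
  simp [dir]

/-- A bound for second differences in terms of second partial derivatives. -/
lemma second_difference_le {n : ℕ} {S P : Set (Eucl n)} {g : Eucl n → ℝ} {B : ℝ}
    (hS : UniqueDiffOn ℝ S) (hg : ContDiffOn ℝ 2 g S) (hP : P ⊆ S) (hB : DerivBound S P 2 B g)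
    {c w : Eucl n} (hseg : ∀ s ∈ Icc (-1 : ℝ) 1, c + s • w ∈ P) :
    g (c + w) + g (c - w) ≤ 2 * g c + 2 * (B * (∑ i, |w i|) ^ 2) := by
  have hline : ∀ {G : Eucl n → ℝ}, DifferentiableOn ℝ G S → ∀ s ∈ Icc (-1 : ℝ) 1,
      HasDerivWithinAt (fun s : ℝ => G (c + s • w)) (∑ i, w i * pd S i G (c + s • w))
        (Icc (-1) 1) s := by
    intro G hG s hs
    have h1 : HasDerivWithinAt (fun s : ℝ => c + s • w) w (Icc (-1) 1) s := by
      have := ((hasDerivAt_id s).smul_const w).const_add c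
      simpa using this.hasDerivWithinAt
    have h2 := (hG _ (hP (hseg s hs))).hasFDerivWithinAt.comp_hasDerivWithinAt s h1
      (fun t ht => hP (hseg t ht))
    rw [clm_apply_eq_sum] at h2
    exact h2
  set φ : ℝ → ℝ := fun s => g (c + s • w) with hφ
  set ψ : ℝ → ℝ := fun s => ∑ i, w i * pd S i g (c + s • w) with hψ
  set K : ℝ := B * (∑ i, |w i|) ^ 2 with hK
  have d1 : ∀ s ∈ Icc (-1 : ℝ) 1, HasDerivWithinAt φ (ψ s) (Icc (-1) 1) s :=
    hline (hg.differentiableOn (by norm_num))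
  have d2 : ∀ s ∈ Icc (-1 : ℝ) 1, HasDerivWithinAt ψ
      (∑ i, w i * ∑ j, w j * pd S j (pd S i g) (c + s • w)) (Icc (-1) 1) s := by
    intro s hs
    exact HasDerivWithinAt.fun_sum fun i _ => (hline ((contDiffOn_pd hg hS (k := 1) (by norm_num)
      i).differentiableOn (by norm_num)) s hs).const_mul (w i)
  rw [derivBound_two_iff hS hg hP] at hB
  have hbd : ∀ s ∈ Icc (-1 : ℝ) 1,
      ‖∑ i, w i * ∑ j, w j * pd S j (pd S i g) (c + s • w)‖ ≤ K := by
    intro s hs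
    obtain ⟨-, -, b2⟩ := hB _ (hseg s hs)
    rw [hK, sq, Finset.sum_mul_sum, Finset.mul_sum]
    refine (norm_sum_le _ _).trans (Finset.sum_le_sum fun i _ => ?_)
    rw [norm_mul, Finset.mul_sum, Real.norm_eq_abs]
    refine (mul_le_mul_of_nonneg_left (norm_sum_le _ _) (abs_nonneg _)).trans ?_
    rw [Finset.mul_sum]
    refine Finset.sum_le_sum fun j _ => ?_
    rw [norm_mul, Real.norm_eq_abs, Real.norm_eq_abs]
    calc _ ≤ |w i| * (|w j| * B) := by gcongr; exact b2 j i
      _ = _ := by ring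
  have hcont : ContinuousOn φ (Icc (-1) 1) := fun s hs => (d1 s hs).continuousWithinAt
  have hd : ∀ s ∈ Ioo (-1 : ℝ) 1, HasDerivAt φ (ψ s) s := fun s hs =>
    (d1 s (Ioo_subset_Icc_self hs)).hasDerivAt (Icc_mem_nhds hs.1 hs.2)
  -- The two halves of the second difference are slopes `ψ a` and `ψ b` with `b < 0 < a` and `a - b
  -- ≤ 2`, so the bound `K` for the derivative of `ψ` gives `2 * K`.
  obtain ⟨a, ha, ha'⟩ := exists_hasDerivAt_eq_slope φ ψ (by norm_num : (0 : ℝ) < 1)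
    (hcont.mono (Icc_subset_Icc (by norm_num) le_rfl))
    (fun s hs => hd s ⟨by linarith [hs.1], hs.2⟩)
  obtain ⟨b, hb, hb'⟩ := exists_hasDerivAt_eq_slope φ ψ (by norm_num : (-1 : ℝ) < 0)
    (hcont.mono (Icc_subset_Icc le_rfl (by norm_num)))
    (fun s hs => hd s ⟨hs.1, by linarith [hs.2]⟩)
  have hlip := (convex_Icc (-1 : ℝ) 1).norm_image_sub_le_of_norm_hasDerivWithin_le d2 hbd
    (x := b) (y := a) ⟨hb.1.le, by linarith [hb.2]⟩ ⟨by linarith [ha.1], ha.2.le⟩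
  have hK0 : 0 ≤ K := (norm_nonneg _).trans (hbd 0 (by norm_num))
  rw [Real.norm_eq_abs, Real.norm_eq_abs, abs_of_pos (by linarith [ha.1, hb.2] : 0 < a - b)] at hlip
  have h3 : ψ a - ψ b ≤ K * 2 :=
    (le_abs_self _).trans (hlip.trans (mul_le_mul_of_nonneg_left
      (by linarith [ha.2, hb.1]) hK0))
  have e0 : φ 0 = g c := by simp [hφ]
  have e1 : φ 1 = g (c + w) := by simp [hφ]
  have e2 : φ (-1) = g (c - w) := by simp [hφ, sub_eq_add_neg]
  rw [ha', hb', e0, e1, e2] at h3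
  norm_num at h3
  linarith

lemma sum_abs_le_of_mem_ball {n : ℕ} {w : Fin n → ℝ} {ρ : ℝ} (hw : w ∈ Metric.ball 0 ρ) :
    ∑ i, |w i| ≤ n * ρ := by
  have h1 : ∀ i ∈ Finset.univ, |w i| ≤ ρ := fun i _ => by
    have := norm_le_pi_norm w i
    rw [mem_ball_zero_iff] at hw
    exact this.trans hw.le
  simpa using Finset.sum_le_card_nsmul _ _ _ h1

/-- The number of cubes and their total volume determine the side length: h² = (M hⁿ)^{2/n}
M^{-2/n}. -/
lemma rate_le {n M : ℕ} {h V : ℝ} (hn : n ≠ 0) (hh : 0 < h) (hV : M * h ^ n ≤ V) :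
    M * h ^ n * h ^ 2 ≤ V ^ (1 + 2 / (n : ℝ)) * (M : ℝ) ^ (-2 / (n : ℝ)) := by
  have hn' : (0 : ℝ) < n := by exact_mod_cast Nat.pos_of_ne_zero hn
  rcases Nat.eq_zero_or_pos M with rfl | hM
  · have hV0 : 0 ≤ V := by simpa using hV
    have : 0 ≤ V ^ (1 + 2 / (n : ℝ)) := Real.rpow_nonneg hV0 _
    simp only [Nat.cast_zero, zero_mul]
    exact mul_nonneg this (Real.rpow_nonneg le_rfl _)
  have hM' : (0 : ℝ) < M := by exact_mod_cast hM
  have h0 : 0 ≤ M * h ^ n := by positivity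
  calc M * h ^ n * h ^ 2 = (M * h ^ n) ^ (1 + 2 / (n : ℝ)) * (M : ℝ) ^ (-2 / (n : ℝ)) := by
        have e1 : (h ^ n) ^ (2 / (n : ℝ)) = h ^ 2 := by
          rw [← Real.rpow_natCast h n, ← Real.rpow_mul hh.le, mul_div_cancel₀ _ hn'.ne']
          norm_cast
        rw [Real.rpow_add (by positivity), Real.rpow_one, Real.mul_rpow hM'.le (by positivity), e1,
          neg_div, Real.rpow_neg hM'.le]
        have : (M : ℝ) ^ (2 / (n : ℝ)) ≠ 0 := (Real.rpow_pos_of_pos hM' _).ne'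
        field_simp
    _ ≤ _ := by
        gcongr

/-! ### Cube partitions -/

section Partition

variable {n k : ℕ} {Λ : Set (Eucl n)}

/-- Half the side length. -/
def CubePartition.half (P : CubePartition k Λ) : ℝ := 1 / (2 * (P.N : ℝ))

lemma CubePartition.half_pos (P : CubePartition k Λ) : 0 < P.half := by
  have := P.N_pos
  unfold half
  positivity

lemma CubePartition.two_mul_half (P : CubePartition k Λ) : 2 * P.half = 1 / (P.N : ℝ) := by
  have : (P.N : ℝ) ≠ 0 := by exact_mod_cast P.N_pos.ne'
  unfold half
  field_simp

lemma CubePartition.free_eq_univ (P : CubePartition n Λ) (m : Fin P.M) :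
    P.free m = Finset.univ :=
  Finset.eq_univ_of_card _ (by rw [P.card_free, Fintype.card_fin])

/-- The open cubes of a partition into cubes of full dimension. -/
def CubePartition.cell (P : CubePartition n Λ) (m : Fin P.M) : Set (Eucl n) :=
  {z | WithLp.ofLp z ∈ Metric.ball (WithLp.ofLp (P.center m)) P.half}

lemma CubePartition.mem_cell {P : CubePartition n Λ} {m : Fin P.M} {z : Eucl n} :
    z ∈ P.cell m ↔ ∀ i, |z i - P.center m i| < P.half := by
  change _ ∈ Metric.ball _ _ ↔ _
  rw [Metric.mem_ball, dist_pi_lt_iff P.half_pos]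
  rfl

lemma CubePartition.isOpen_cell (P : CubePartition n Λ) (m : Fin P.M) : IsOpen (P.cell m) :=
  Metric.isOpen_ball.preimage (PiLp.continuous_ofLp 2 _)

lemma CubePartition.mem_closure_iff_full {P : CubePartition n Λ} {z : Eucl n} :
    z ∈ closure Λ ↔ ∃ m, ∀ i, |z i - P.center m i| ≤ P.half := by
  rw [← P.cover]
  simp [P.free_eq_univ, half]

lemma CubePartition.disjoint_cell (P : CubePartition n Λ) :
    Pairwise fun m m' => Disjoint (P.cell m) (P.cell m') := by
  intro m m' hmm
  have h := P.disjoint hmm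
  simp only [P.free_eq_univ, Finset.mem_univ, if_true] at h
  refine h.mono ?_ ?_ <;> exact fun z hz => CubePartition.mem_cell.1 hz

lemma CubePartition.cell_subset_closure (P : CubePartition n Λ) (m : Fin P.M) :
    P.cell m ⊆ closure Λ := fun _ hz =>
  P.mem_closure_iff_full.2 ⟨m, fun i => (CubePartition.mem_cell.1 hz i).le⟩

lemma CubePartition.cell_subset (P : CubePartition n Λ) (hΛ : interior (closure Λ) = Λ)
    (m : Fin P.M) : P.cell m ⊆ Λ := by
  have h := (P.isOpen_cell m).subset_interior_iff.2 (P.cell_subset_closure m)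
  rwa [hΛ] at h

lemma volume_coord_eq_zero (i : Fin n) (a : ℝ) : volume {z : Eucl n | z i = a} = 0 := by
  have h1 : volume ((fun y : Fin n → ℝ => y i) ⁻¹' {a}) = 0 :=
    (Measure.quasiMeasurePreserving_eval (fun _ : Fin n => (volume : Measure ℝ)) i).preimage_null
      (measure_singleton a)
  exact (PiLp.volume_preserving_ofLp (Fin n)).quasiMeasurePreserving.preimage_null h1

/-- A point of `Λ` outside all open cubes lies on one of finitely many hyperplanes that carry the
faces of cubes. -/
lemma CubePartition.iUnion_cell_ae_eq (P : CubePartition n Λ) (hΛ : interior (closure Λ) = Λ) :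
    (⋃ m, P.cell m) =ᵐ[volume] Λ := by
  refine Filter.EventuallyLE.antisymm
    (LE.le.eventuallyLE (iUnion_subset fun m => P.cell_subset hΛ m)) ?_
  have hnull : volume (⋃ m : Fin P.M, ⋃ i : Fin n, ({z : Eucl n | z i = P.center m i + P.half} ∪
      {z | z i = P.center m i - P.half})) = 0 := by
    rw [measure_iUnion_null_iff]
    intro m
    rw [measure_iUnion_null_iff]
    intro i
    exact measure_union_null (volume_coord_eq_zero _ _) (volume_coord_eq_zero _ _)
  have hae := compl_mem_ae_iff.2 hnull
  filter_upwards [hae] with z hz hzΛ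
  obtain ⟨m, hm⟩ := P.mem_closure_iff_full.1 (subset_closure hzΛ)
  refine mem_iUnion.2 ⟨m, CubePartition.mem_cell.2 fun i => lt_of_le_of_ne (hm i) fun he => hz ?_⟩
  refine mem_iUnion.2 ⟨m, mem_iUnion.2 ⟨i, ?_⟩⟩
  rcases (abs_eq P.half_pos.le).1 he with h | h
  · exact Or.inl (show z i = _ by linarith)
  · exact Or.inr (show z i = _ by linarith)

lemma CubePartition.integral_eq_sum (P : CubePartition n Λ) (hΛ : interior (closure Λ) = Λ)
    {g : Eucl n → ℝ} (hg : IntegrableOn g Λ) :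
    ∫ z in Λ, g z = ∑ m, ∫ z in P.cell m, g z := by
  rw [← setIntegral_congr_set (P.iUnion_cell_ae_eq hΛ)]
  exact integral_iUnion_fintype (fun m => (P.isOpen_cell m).measurableSet) P.disjoint_cell
    (fun m => hg.mono_set (P.cell_subset hΛ m))

lemma setIntegral_ofLp_preimage {s : Set (Fin n → ℝ)} (g : Eucl n → ℝ) :
    ∫ z in {z : Eucl n | WithLp.ofLp z ∈ s}, g z = ∫ y in s, g (WithLp.toLp 2 y) :=
  (PiLp.volume_preserving_ofLp (Fin n)).setIntegral_preimage_emb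
    (MeasurableEquiv.toLp 2 (Fin n → ℝ)).symm.measurableEmbedding (fun y => g (WithLp.toLp 2 y)) s

lemma integrableOn_ofLp_preimage {s : Set (Fin n → ℝ)} {g : Eucl n → ℝ} :
    IntegrableOn (fun y => g (WithLp.toLp 2 y)) s ↔
      IntegrableOn g {z : Eucl n | WithLp.ofLp z ∈ s} :=
  ((PiLp.volume_preserving_ofLp (Fin n)).integrableOn_comp_preimage
    (MeasurableEquiv.toLp 2 (Fin n → ℝ)).symm.measurableEmbedding
    (f := fun y => g (WithLp.toLp 2 y))).symm

/-- The decomposition into cells, applied to the constant 1, identifies the quadrature weight with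
the volume of `Λ` divided by the number of cubes. -/
lemma CubePartition.card_mul_pow_eq (P : CubePartition n Λ) (hΛ : interior (closure Λ) = Λ)
    (hfin : volume Λ ≠ ⊤) : P.M * (1 / (P.N : ℝ)) ^ n = volume.real Λ := by
  have h1 := P.integral_eq_sum hΛ (g := fun _ => 1) (integrableOn_const hfin)
  have h2 : ∀ m, ∫ _ in P.cell m, (1 : ℝ) = (1 / (P.N : ℝ)) ^ n := by
    intro m
    unfold cell
    rw [setIntegral_ofLp_preimage (fun _ => 1), setIntegral_const, measureReal_def,
      Real.volume_pi_ball _ P.half_pos, P.two_mul_half, ENNReal.toReal_ofReal (by positivity)]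
    simp
  simp only [h2] at h1
  simpa using h1.symm

/-- The midpoint rule for a partition into cubes of full dimension. -/
lemma CubePartition.integral_le_quad (P : CubePartition n Λ) (hn : n ≠ 0)
    (hΛ : interior (closure Λ) = Λ) (hfin : volume Λ ≠ ⊤) {S : Set (Eucl n)}
    (hS : UniqueDiffOn ℝ S) (hΛS : Λ ⊆ S) {g : Eucl n → ℝ} {B : ℝ} (hg : ContDiffOn ℝ 2 g S)
    (hB0 : 0 ≤ B) (hB : DerivBound S Λ 2 B g) (hi : IntegrableOn g Λ) :
    ∫ z in Λ, g z ≤ P.quad g + (n : ℝ) ^ 2 / 4 * volume.real Λ ^ (1 + 2 / (n : ℝ)) * B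
      * (P.M : ℝ) ^ (-2 / (n : ℝ)) := by
  rw [P.integral_eq_sum hΛ hi]
  have hcell : ∀ m, ∫ z in P.cell m, g z
      ≤ (1 / (P.N : ℝ)) ^ n * (g (P.center m) + B * (n * P.half) ^ 2) := by
    intro m
    unfold cell
    rw [setIntegral_ofLp_preimage, ← P.two_mul_half]
    refine integral_ball_le_midpoint P.half_pos
      (integrableOn_ofLp_preimage.2 (hi.mono_set (P.cell_subset hΛ m))) fun w hw => ?_
    have h1 := second_difference_le hS hg hΛS hB (c := P.center m) (w := WithLp.toLp 2 w)
      (fun s hs => P.cell_subset hΛ m (CubePartition.mem_cell.2 fun i => ?_))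
    · have h2 : (∑ i, |(WithLp.toLp 2 w : Eucl n) i|) ^ 2 ≤ (n * P.half) ^ 2 :=
        pow_le_pow_left₀ (Finset.sum_nonneg fun _ _ => abs_nonneg _) (sum_abs_le_of_mem_ball hw) 2
      have h3 := mul_le_mul_of_nonneg_left h2 hB0
      have e1 : (WithLp.toLp 2 (WithLp.ofLp (P.center m) + w) : Eucl n)
        = P.center m + WithLp.toLp 2 w := rfl
      have e2 : (WithLp.toLp 2 (WithLp.ofLp (P.center m) - w) : Eucl n)
        = P.center m - WithLp.toLp 2 w := rfl
      rw [e1, e2]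
      change _ ≤ 2 * g (P.center m) + _
      linarith
    · have h2 : |w i| < P.half := by
        rw [mem_ball_zero_iff] at hw
        exact (norm_le_pi_norm w i).trans_lt hw
      have h3 : |s| ≤ 1 := abs_le.2 hs
      simp only [PiLp.add_apply, PiLp.smul_apply, smul_eq_mul, add_sub_cancel_left, abs_mul]
      exact (mul_le_of_le_one_left (abs_nonneg _) h3).trans_lt h2
  refine (Finset.sum_le_sum fun m _ => hcell m).trans ?_
  rw [← Finset.mul_sum, Finset.sum_add_distrib, mul_add]
  unfold quad
  refine add_le_add le_rfl ?_
  have hr := rate_le hn (by have := P.N_pos; positivity : 0 < 1 / (P.N : ℝ))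
    (P.card_mul_pow_eq hΛ hfin).le
  rw [Finset.sum_const, Finset.card_univ, Fintype.card_fin, nsmul_eq_mul]
  have hh : P.half = 1 / (P.N : ℝ) / 2 := by rw [← P.two_mul_half]; ring
  rw [hh]
  have := mul_le_mul_of_nonneg_left hr (by positivity : 0 ≤ B * ((n : ℝ) ^ 2 / 4))
  calc _ = B * ((n : ℝ) ^ 2 / 4) * (P.M * (1 / (P.N : ℝ)) ^ n * (1 / (P.N : ℝ)) ^ 2) := by ring
    _ ≤ _ := this
    _ = _ := by ring

end Partition

/-! ### Partitions into faces -/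

section Faces

variable {d : ℕ} {Λ : Set (Eucl (d + 1))}

lemma CubePartition.exists_normal (P : CubePartition d Λ) (m : Fin P.M) :
    ∃ i, ∀ j, j ∈ P.free m ↔ j ≠ i := by
  have h : (P.free m)ᶜ.card = 1 := by
    rw [Finset.card_compl, P.card_free, Fintype.card_fin]; omega
  obtain ⟨i, hi⟩ := Finset.card_eq_one.1 h
  refine ⟨i, fun j => ?_⟩
  rw [← not_iff_not, ← Finset.mem_compl, hi, Finset.mem_singleton, not_not]

/-- The direction orthogonal to a face. -/
def CubePartition.normal (P : CubePartition d Λ) (m : Fin P.M) : Fin (d + 1) :=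
  (P.exists_normal m).choose

lemma CubePartition.mem_free_iff {P : CubePartition d Λ} {m : Fin P.M} {j : Fin (d + 1)} :
    j ∈ P.free m ↔ j ≠ P.normal m := (P.exists_normal m).choose_spec j

/-- The position of a face along its normal. -/
def CubePartition.level (P : CubePartition d Λ) (m : Fin P.M) : ℝ := P.center m (P.normal m)

/-- The midpoint of a face in the coordinates orthogonal to the normal. -/
def CubePartition.trace (P : CubePartition d Λ) (m : Fin P.M) : Fin d → ℝ :=
  fun j => P.center m ((P.normal m).succAbove j)

lemma CubePartition.ins_level_trace (P : CubePartition d Λ) (m : Fin P.M) :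
    ins (P.normal m) (P.level m) (P.trace m) = P.center m := ins_self_removeNth _ _

lemma CubePartition.mem_closure_iff_face {P : CubePartition d Λ} {z : Eucl (d + 1)} :
    z ∈ closure Λ ↔ ∃ m, z (P.normal m) = P.level m ∧
      ∀ j, j ≠ P.normal m → |z j - P.center m j| ≤ P.half := by
  rw [← P.cover]
  simp only [mem_iUnion, mem_ofPred_eq, mem_free_iff]
  refine exists_congr fun m => ⟨fun h => ⟨?_, fun j hj => ?_⟩, fun h i => ?_⟩
  · have := h (P.normal m)
    rwa [if_neg (not_not.2 rfl)] at this
  · have := h j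
    rwa [if_pos hj] at this
  · by_cases hi : i = P.normal m
    · rw [if_neg (not_not.2 hi), hi]; exact h.1
    · rw [if_pos hi]; exact h.2 i hi

lemma CubePartition.ins_mem_closure (P : CubePartition d Λ) (m : Fin P.M) {y : Fin d → ℝ}
    (hy : y ∈ Metric.closedBall (P.trace m) P.half) :
    ins (P.normal m) (P.level m) y ∈ closure Λ := by
  refine P.mem_closure_iff_face.2 ⟨m, by simp, fun j hj => ?_⟩
  obtain ⟨l, rfl⟩ := Fin.exists_succAbove_eq hj
  rw [ins_succAbove]
  exact (dist_pi_le_iff P.half_pos.le).1 hy l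

lemma ins_add_smul {n : ℕ} (i : Fin (n + 1)) (a s : ℝ) (y w : Fin n → ℝ) :
    ins i a y + s • ins i 0 w = ins i a (y + s • w) := by
  ext j
  refine Fin.succAboveCases i ?_ (fun j => ?_) j <;> simp

lemma sum_abs_ins_zero {n : ℕ} (i : Fin (n + 1)) (w : Fin n → ℝ) :
    ∑ j, |ins i 0 w j| = ∑ j, |w j| := by
  rw [Fin.sum_univ_succAbove _ i]
  simp

lemma CubePartition.continuousOn_face (P : CubePartition d Λ) (hΛ : IsClosed Λ) {g : Eucl (d + 1) → ℝ}
    (hg : ContinuousOn g Λ) (m : Fin P.M) :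
    ContinuousOn (fun y => g (ins (P.normal m) (P.level m) y))
      (Metric.closedBall (P.trace m) P.half) := by
  refine hg.comp ((continuous_ins (P.normal m)).comp
    (continuous_const.prodMk continuous_id)).continuousOn fun y hy => ?_
  have := P.ins_mem_closure m hy
  rwa [hΛ.closure_eq] at this

lemma CubePartition.integrableOn_face (P : CubePartition d Λ) (hΛ : IsClosed Λ)
    {g : Eucl (d + 1) → ℝ} (hg : ContinuousOn g Λ) (m : Fin P.M) :
    IntegrableOn (fun y => g (ins (P.normal m) (P.level m) y))
      (Metric.ball (P.trace m) P.half) :=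
  ((P.continuousOn_face hΛ hg m).integrableOn_compact
    (isCompact_closedBall _ _)).mono_set Metric.ball_subset_closedBall

/-- The midpoint rule for a partition into faces. -/
lemma CubePartition.sum_integral_face_le (P : CubePartition d Λ) (hΛ : IsClosed Λ)
    {S : Set (Eucl (d + 1))} (hS : UniqueDiffOn ℝ S) (hΛS : Λ ⊆ S) {g : Eucl (d + 1) → ℝ} {B : ℝ}
    (hg : ContDiffOn ℝ 2 g S) (hB0 : 0 ≤ B) (hB : DerivBound S Λ 2 B g) :
    ∑ m, ∫ y in Metric.ball (P.trace m) P.half, g (ins (P.normal m) (P.level m) y)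
      ≤ P.quad g + (d : ℝ) ^ 2 / 4 * B * (P.M * (1 / (P.N : ℝ)) ^ d * (1 / (P.N : ℝ)) ^ 2) := by
  have hface : ∀ m, ∫ y in Metric.ball (P.trace m) P.half, g (ins (P.normal m) (P.level m) y)
      ≤ (1 / (P.N : ℝ)) ^ d * (g (P.center m) + B * (d * P.half) ^ 2) := by
    intro m
    rw [← P.two_mul_half]
    have hi := P.integrableOn_face hΛ (hg.continuousOn.mono hΛS) m
    refine (integral_ball_le_midpoint (B := B * (d * P.half) ^ 2) P.half_pos hi
      fun w hw => ?_).trans (by rw [P.ins_level_trace])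
    rw [mem_ball_zero_iff] at hw
    have h1 := second_difference_le hS hg hΛS hB (c := P.center m)
      (w := ins (P.normal m) 0 w) (fun s hs => ?_)
    · rw [sum_abs_ins_zero] at h1
      have h2 : (∑ i, |w i|) ^ 2 ≤ (d * P.half) ^ 2 :=
        pow_le_pow_left₀ (Finset.sum_nonneg fun _ _ => abs_nonneg _)
          (sum_abs_le_of_mem_ball (by simpa using hw)) 2
      have h3 := mul_le_mul_of_nonneg_left h2 hB0
      have e1 : ins (P.normal m) (P.level m) (P.trace m + w)
          = P.center m + ins (P.normal m) 0 w := by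
        have := ins_add_smul (P.normal m) (P.level m) 1 (P.trace m) w
        rw [one_smul, one_smul, P.ins_level_trace] at this
        exact this.symm
      have e2 : ins (P.normal m) (P.level m) (P.trace m - w)
          = P.center m - ins (P.normal m) 0 w := by
        have := ins_add_smul (P.normal m) (P.level m) (-1) (P.trace m) w
        rw [neg_one_smul, neg_one_smul, P.ins_level_trace, ← sub_eq_add_neg,
          ← sub_eq_add_neg] at this
        exact this.symm
      rw [e1, e2, P.ins_level_trace]
      linarith
    · rw [← P.ins_level_trace, ins_add_smul]
      have h3 : |s| ≤ 1 := abs_le.2 hs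
      refine hΛ.closure_subset (P.ins_mem_closure m ?_)
      rw [mem_closedBall_iff_norm, add_sub_cancel_left, norm_smul, Real.norm_eq_abs]
      exact (mul_le_of_le_one_left (norm_nonneg _) h3).trans hw.le
  refine (Finset.sum_le_sum fun m _ => hface m).trans ?_
  rw [← Finset.mul_sum, Finset.sum_add_distrib, mul_add]
  unfold quad
  refine add_le_add le_rfl (le_of_eq ?_)
  rw [Finset.sum_const, Finset.card_univ, Fintype.card_fin, nsmul_eq_mul]
  have hh : P.half = 1 / (P.N : ℝ) / 2 := by rw [← P.two_mul_half]; ring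
  rw [hh]
  ring

lemma volume_real_ball {n : ℕ} (c : Fin n → ℝ) {ρ : ℝ} (hρ : 0 < ρ) :
    volume.real (Metric.ball c ρ) = (2 * ρ) ^ n := by
  rw [measureReal_def, Real.volume_pi_ball _ hρ, ENNReal.toReal_ofReal (by positivity),
    Fintype.card_fin]

/-- The Cauchy–Schwarz inequality on the faces. -/
lemma CubePartition.sum_integral_abs_face_le (P : CubePartition d Λ) (hΛ : IsClosed Λ)
    {g : Eucl (d + 1) → ℝ} (hg : ContinuousOn g Λ) :
    ∑ m, ∫ y in Metric.ball (P.trace m) P.half, |g (ins (P.normal m) (P.level m) y)|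
      ≤ √(P.M * (1 / (P.N : ℝ)) ^ d)
        * √(∑ m, ∫ y in Metric.ball (P.trace m) P.half,
            g (ins (P.normal m) (P.level m) y) ^ 2) := by
  set X := ∑ m, ∫ y in Metric.ball (P.trace m) P.half, |g (ins (P.normal m) (P.level m) y)|
    with hX
  set Z := ∑ m, ∫ y in Metric.ball (P.trace m) P.half,
            g (ins (P.normal m) (P.level m) y) ^ 2 with hZ
  set A : ℝ := P.M * (1 / (P.N : ℝ)) ^ d with hA
  -- Integrating (lam - |g|)² over all faces gives a nonnegative quadratic polynomial in `lam`; its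
  -- discriminant is the Cauchy–Schwarz inequality.
  have hquad : ∀ lam : ℝ, 0 ≤ A * (lam * lam) + (-2 * X) * lam + Z := by
    intro lam
    have h1 : A * (lam * lam) + (-2 * X) * lam + Z
        = ∑ m, ∫ y in Metric.ball (P.trace m) P.half,
          (lam - |g (ins (P.normal m) (P.level m) y)|) ^ 2 := by
      have h2 : ∀ m, ∫ y in Metric.ball (P.trace m) P.half,
          (lam - |g (ins (P.normal m) (P.level m) y)|) ^ 2
          = (1 / (P.N : ℝ)) ^ d * (lam * lam)
            + (-2 * lam) * (∫ y in Metric.ball (P.trace m) P.half,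
                |g (ins (P.normal m) (P.level m) y)|)
            + ∫ y in Metric.ball (P.trace m) P.half, g (ins (P.normal m) (P.level m) y) ^ 2 := by
        intro m
        have i1 := P.integrableOn_face hΛ (g := fun z => (-2 * lam) * |g z|)
          (continuousOn_const.mul hg.abs) m
        have i2 := P.integrableOn_face hΛ (g := fun z => g z ^ 2) (hg.pow 2) m
        have i0 : IntegrableOn (fun _ : Fin d → ℝ => lam * lam)
            (Metric.ball (P.trace m) P.half) := integrableOn_const measure_ball_lt_top.ne
        have e : ∀ y, (lam - |g (ins (P.normal m) (P.level m) y)|) ^ 2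
            = lam * lam + (-2 * lam) * |g (ins (P.normal m) (P.level m) y)|
              + g (ins (P.normal m) (P.level m) y) ^ 2 := by
          intro y
          rw [← sq_abs (g _)]; ring
        simp only [e]
        have i01 : IntegrableOn (fun y => lam * lam
            + (-2 * lam) * |g (ins (P.normal m) (P.level m) y)|)
            (Metric.ball (P.trace m) P.half) := i0.add i1
        rw [integral_add i01 i2, integral_add i0 i1, setIntegral_const,
          volume_real_ball _ P.half_pos, P.two_mul_half, integral_const_mul, smul_eq_mul]
      simp only [h2, Finset.sum_add_distrib, ← Finset.mul_sum]
      rw [← hX, ← hZ, Finset.sum_const, Finset.card_univ, Fintype.card_fin, nsmul_eq_mul, hA]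
      ring
    rw [h1]
    exact Finset.sum_nonneg fun m _ => integral_nonneg fun y => sq_nonneg _
  have hd := discrim_le_zero hquad
  rw [discrim] at hd
  have hA0 : 0 ≤ A := by positivity
  rw [← Real.sqrt_mul hA0]
  exact Real.le_sqrt_of_sq_le (by linarith)

end Faces

/-! ### The surface area -/

section SurfaceArea

lemma isometry_ins {n : ℕ} (i : Fin (n + 1)) (a : ℝ) :
    Isometry fun y : Eucl n => ins i a (WithLp.ofLp y) := by
  refine Isometry.of_dist_eq fun x y => ?_
  rw [EuclideanSpace.dist_eq, EuclideanSpace.dist_eq, Fin.sum_univ_succAbove _ i]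
  simp

/-- The part of a hyperplane orthogonal to the direction `i` with the other coordinates in `s`. -/
def plate {n : ℕ} (i : Fin (n + 1)) (a : ℝ) (s : Set (Fin n → ℝ)) : Set (Eucl (n + 1)) :=
  {x | x i = a ∧ (fun j => x (i.succAbove j)) ∈ s}

/-- A plate is the isometric image of a subset of ℝⁿ, where the normalised Hausdorff measure is
Lebesgue measure. -/
lemma hausdorff_plate {n : ℕ} (i : Fin (n + 1)) (a : ℝ) (s : Set (Fin n → ℝ)) :
    (Measure.euclideanHausdorffMeasure n : Measure (Eucl (n + 1))) (plate i a s) = volume s := by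
  have h1 : plate i a s = (fun y : Eucl n => ins i a (WithLp.ofLp y)) '' {y | WithLp.ofLp y ∈ s} := by
    ext x
    simp only [plate, mem_ofPred_eq, mem_image]
    constructor
    · rintro ⟨rfl, h⟩
      exact ⟨WithLp.toLp 2 (fun j => x (i.succAbove j)), h, ins_self_removeNth i x⟩
    · rintro ⟨y, hy, rfl⟩
      simpa using hy
  rw [h1, (isometry_ins i a).euclideanHausdorffMeasure_image,
    EuclideanSpace.euclideanHausdorffMeasure_eq_volume]
  exact (PiLp.volume_preserving_ofLp (Fin n)).measure_preimage_emb
    (MeasurableEquiv.toLp 2 (Fin n → ℝ)).symm.measurableEmbedding s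

lemma measurableSet_plate {n : ℕ} (i : Fin (n + 1)) (a : ℝ) {s : Set (Fin n → ℝ)}
    (hs : MeasurableSet s) : MeasurableSet (plate i a s) := by
  refine MeasurableSet.inter ?_ ?_
  · exact (isClosed_eq (EuclideanSpace.proj (𝕜 := ℝ) i).continuous
      continuous_const).measurableSet
  · have : Continuous fun x : Eucl (n + 1) => fun j => x (i.succAbove j) :=
      continuous_pi fun j => (EuclideanSpace.proj (𝕜 := ℝ) (i.succAbove j)).continuous
    exact this.measurable hs

variable {d : ℕ} {Ω : Set (Eucl d)} {T : ℝ}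

lemma isClosed_lateral : IsClosed (cyl (frontier Ω) (Icc 0 T)) :=
  isClosed_cyl isClosed_frontier isClosed_Icc

/-- A face orthogonal to time would contain a full spatial neighbourhood of a point of ∂Ω. Such a
neighbourhood meets `Ω`, which is disjoint from its boundary. -/
lemma CubePartition.normal_ne_last (hΩ : IsOpen Ω)
    (P : CubePartition d (cyl (frontier Ω) (Icc 0 T))) (m : Fin P.M) :
    P.normal m ≠ Fin.last d := by
  intro hlast
  have hc : xpart (P.center m) ∈ frontier Ω := (P.center_mem m).1
  have hU : IsOpen {x : Eucl d | ∀ j, |x j - P.center m j.castSucc| < P.half} := by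
    simp only [Set.ofPred_forall]
    refine isOpen_iInter_of_finite fun j => ?_
    exact isOpen_lt (((EuclideanSpace.proj (𝕜 := ℝ) j).continuous.sub continuous_const).abs)
      continuous_const
  obtain ⟨x, hxU, hxΩ⟩ := mem_closure_iff.1 (frontier_subset_closure hc) _ hU
    (fun j => by simpa using P.half_pos)
  have hz : pair x (P.center m (Fin.last d)) ∈ closure (cyl (frontier Ω) (Icc 0 T)) := by
    refine P.mem_closure_iff_face.2 ⟨m, ?_, fun j hj => ?_⟩
    · rw [level, hlast, pair_apply_last]
    · rw [hlast] at hj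
      obtain ⟨l, rfl⟩ := Fin.exists_castSucc_eq.2 hj
      rw [pair_apply_castSucc]
      exact (hxU l).le
  rw [isClosed_lateral.closure_eq, pair_mem_cyl] at hz
  have := hz.1
  rw [hΩ.frontier_eq] at this
  exact this.2 hxΩ

/-- The faces of a partition of `∂Ω × [0, T]` have total area at most `T |∂Ω|`. -/
lemma CubePartition.card_mul_pow_le (hd : 1 ≤ d) (hΩ : IsOpen Ω) (hT : 0 < T)
    (P : CubePartition d (cyl (frontier Ω) (Icc 0 T))) :
    P.M * (1 / (P.N : ℝ)) ^ d ≤ T * surfaceArea Ω := by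
  obtain ⟨e, rfl⟩ : ∃ e, d = e + 1 := ⟨d - 1, by omega⟩
  have hnorm : ∀ m, ∃ i : Fin (e + 1), P.normal m = i.castSucc := fun m => by
    obtain ⟨i, hi⟩ := Fin.exists_castSucc_eq.2 (P.normal_ne_last hΩ m)
    exact ⟨i, hi.symm⟩
  choose ν hν using hnorm
  set κ : Fin P.M → Fin e → ℝ := fun m j => P.center m ((ν m).succAbove j).castSucc with hκ
  set τ : Fin P.M → ℝ := fun m => P.center m (Fin.last (e + 1)) with hτ
  have hne : ∀ m, Fin.last (e + 1) ≠ P.normal m := fun m => (P.normal_ne_last hΩ m).symm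
  -- points of a slice of a face
  have hmem : ∀ m t x, x ∈ plate (ν m) (P.level m) (Metric.closedBall (κ m) P.half) →
      |t - τ m| ≤ P.half → x ∈ frontier Ω ∧ t ∈ Icc 0 T := by
    intro m t x hx ht
    have hz : pair x t ∈ closure (cyl (frontier Ω) (Icc 0 T)) := by
      refine P.mem_closure_iff_face.2 ⟨m, ?_, fun j hj => ?_⟩
      · rw [hν, pair_apply_castSucc]; exact hx.1
      · by_cases hjl : j = Fin.last (e + 1)
        · subst hjl; rw [pair_apply_last]; exact ht
        · obtain ⟨l, rfl⟩ := Fin.exists_castSucc_eq.2 hjl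
          rw [pair_apply_castSucc]
          rw [hν] at hj
          obtain ⟨p, rfl⟩ := Fin.exists_succAbove_eq (fun h => hj (by rw [h]) : l ≠ ν m)
          exact (dist_pi_le_iff P.half_pos.le).1 hx.2 p
    rwa [isClosed_lateral.closure_eq, pair_mem_cyl] at hz
  have hcov : ∀ x ∈ frontier Ω, ∃ m, x ∈ plate (ν m) (P.level m)
      (Metric.closedBall (κ m) P.half) := by
    intro x hx
    have hz : pair x 0 ∈ closure (cyl (frontier Ω) (Icc 0 T)) :=
      subset_closure (pair_mem_cyl.2 ⟨hx, le_rfl, hT.le⟩)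
    obtain ⟨m, h1, h2⟩ := P.mem_closure_iff_face.1 hz
    refine ⟨m, ?_, ?_⟩
    · rw [hν, pair_apply_castSucc] at h1; exact h1
    · refine (dist_pi_le_iff P.half_pos.le).2 fun j => ?_
      have := h2 ((ν m).succAbove j).castSucc (by
        rw [hν]; exact fun h => Fin.succAbove_ne _ _ (Fin.castSucc_injective _ h))
      rwa [pair_apply_castSucc] at this
  -- Finiteness has to be checked because `surfaceArea` would turn an infinite measure into 0.
  have hfin : (Measure.euclideanHausdorffMeasure e : Measure (Eucl (e + 1))) (frontier Ω) ≠ ⊤ := by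
    have h1 : frontier Ω ⊆ ⋃ m, plate (ν m) (P.level m) (Metric.closedBall (κ m) P.half) :=
      fun x hx => mem_iUnion.2 (hcov x hx)
    refine ((measure_mono h1).trans_lt ((measure_iUnion_fintype_le _ _).trans_lt ?_)).ne
    refine ENNReal.sum_lt_top.2 fun m _ => ?_
    rw [hausdorff_plate]
    exact (isCompact_closedBall _ _).measure_lt_top
  -- the area of a slice
  have hslice : ∀ t : ℝ, ∑ m, (Metric.ball (τ m) P.half).indicator
      (fun _ => (1 / (P.N : ℝ)) ^ e) t ≤ surfaceArea Ω := by
    intro t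
    classical
    -- The faces whose open time interval contains `t`. Their slices at time `t` are disjoint open
    -- plates inside ∂Ω, since the relative interiors of the faces are disjoint.
    set J := Finset.univ.filter fun m => t ∈ Metric.ball (τ m) P.half with hJ
    have hdisj : (J : Set (Fin P.M)).PairwiseDisjoint
        fun m => plate (ν m) (P.level m) (Metric.ball (κ m) P.half) := by
      intro m hm m' hm' hmm
      rw [Function.onFun, Set.disjoint_left]
      intro x hx hx'
      have key : ∀ m, m ∈ J → x ∈ plate (ν m) (P.level m) (Metric.ball (κ m) P.half) →
          pair x t ∈ {z : Eucl (e + 1 + 1) | ∀ i, if i ∈ P.free m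
            then |z i - P.center m i| < 1 / (2 * (P.N : ℝ)) else z i = P.center m i} := by
        intro m hm hx j
        split_ifs with hj
        · rw [P.mem_free_iff] at hj
          by_cases hjl : j = Fin.last (e + 1)
          · subst hjl; rw [pair_apply_last]; exact (Finset.mem_filter.1 hm).2
          · obtain ⟨l, rfl⟩ := Fin.exists_castSucc_eq.2 hjl
            rw [pair_apply_castSucc]
            rw [hν] at hj
            obtain ⟨p, rfl⟩ := Fin.exists_succAbove_eq (fun h => hj (by rw [h]) : l ≠ ν m)
            exact (dist_pi_lt_iff P.half_pos).1 hx.2 p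
        · rw [P.mem_free_iff, not_not] at hj
          subst hj
          rw [hν, pair_apply_castSucc, ← hν]
          exact hx.1
      exact Set.disjoint_left.1 (P.disjoint hmm) (key m hm hx) (key m' hm' hx')
    have h1 : ∑ m ∈ J, (Measure.euclideanHausdorffMeasure e : Measure (Eucl (e + 1)))
        (plate (ν m) (P.level m) (Metric.ball (κ m) P.half))
        ≤ (Measure.euclideanHausdorffMeasure e : Measure (Eucl (e + 1))) (frontier Ω) := by
      rw [← measure_biUnion_finset hdisj
        fun m _ => measurableSet_plate _ _ Metric.isOpen_ball.measurableSet]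
      refine measure_mono (iUnion₂_subset fun m hm x hx => ?_)
      exact (hmem m t x ⟨hx.1, Metric.ball_subset_closedBall hx.2⟩
        (le_of_lt (Finset.mem_filter.1 hm).2)).1
    have h2 := ENNReal.toReal_mono hfin h1
    have h3 : ∀ m, (Measure.euclideanHausdorffMeasure e : Measure (Eucl (e + 1)))
        (plate (ν m) (P.level m) (Metric.ball (κ m) P.half))
        = ENNReal.ofReal ((1 / (P.N : ℝ)) ^ e) := fun m => by
      rw [hausdorff_plate, Real.volume_pi_ball _ P.half_pos, P.two_mul_half, Fintype.card_fin]
    simp only [h3] at h2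
    rw [ENNReal.toReal_sum (fun _ _ => ENNReal.ofReal_ne_top)] at h2
    simp only [ENNReal.toReal_ofReal (by positivity : 0 ≤ (1 / (P.N : ℝ)) ^ e)] at h2
    unfold surfaceArea
    rw [Nat.add_sub_cancel]
    refine le_trans (le_of_eq ?_) h2
    rw [hJ, Finset.sum_filter]
    exact Finset.sum_congr rfl fun m _ => by simp [Set.indicator_apply]
  -- integration in time
  have hsub : ∀ m, Metric.ball (τ m) P.half ⊆ Icc 0 T := by
    intro m t ht
    have hc : xpart (P.center m) ∈ plate (ν m) (P.level m) (Metric.closedBall (κ m) P.half) := by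
      refine ⟨?_, ?_⟩
      · rw [level, hν]; rfl
      · have : (fun j => xpart (P.center m) ((ν m).succAbove j)) = κ m := rfl
        rw [this]
        exact Metric.mem_closedBall_self P.half_pos.le
    exact (hmem m t _ hc (le_of_lt ht)).2
  have hint : ∀ m, IntegrableOn ((Metric.ball (τ m) P.half).indicator
      (fun _ : ℝ => (1 / (P.N : ℝ)) ^ e)) (Icc 0 T) := fun m =>
    (integrableOn_const (by simp)).indicator Metric.isOpen_ball.measurableSet
  have h4 : ∫ t in Icc 0 T, ∑ m, (Metric.ball (τ m) P.half).indicator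
      (fun _ => (1 / (P.N : ℝ)) ^ e) t ≤ ∫ _ in Icc 0 T, surfaceArea Ω :=
    setIntegral_mono_on (integrable_finsetSum _ fun m _ => hint m)
      (integrableOn_const (by simp)) measurableSet_Icc fun t _ => hslice t
  rw [integral_finsetSum _ fun m _ => hint m, setIntegral_const, measureReal_def, Real.volume_Icc,
    sub_zero, ENNReal.toReal_ofReal hT.le, smul_eq_mul] at h4
  refine le_trans (le_of_eq ?_) h4
  have h5 : ∀ m, ∫ t in Icc 0 T, (Metric.ball (τ m) P.half).indicator
      (fun _ => (1 / (P.N : ℝ)) ^ e) t = (1 / (P.N : ℝ)) ^ (e + 1) := by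
    intro m
    rw [setIntegral_indicator Metric.isOpen_ball.measurableSet,
      inter_eq_self_of_subset_right (hsub m), setIntegral_const, measureReal_def, Real.volume_ball,
      P.two_mul_half, ENNReal.toReal_ofReal (by positivity), smul_eq_mul, pow_succ, mul_comm]
  simp only [h5]
  simp

end SurfaceArea

/-! ### Integration by parts -/

section Lines

/-- If no interval begins where a given one ends, then there is a gap just to the right of that
endpoint: the other intervals are at least `2 * ρ` away in centre, and finitely many begin strictly
later. This detects the endpoints at which the line leaves the domain. -/
lemma exists_gap {ι : Type*} {J : Finset ι} {a : ι → ℝ} {ρ : ℝ}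
    (hsep : ∀ m ∈ J, ∀ m' ∈ J, m ≠ m' → 2 * ρ ≤ |a m - a m'|) {m : ι} (hm : m ∈ J)
    (hne : ∀ m' ∈ J, a m + ρ ≠ a m' - ρ) :
    ∀ᶠ δ in nhdsWithin (0 : ℝ) (Ioi 0), ∀ m' ∈ J, ¬ |a m + ρ + δ - a m'| ≤ ρ := by
  rw [Finset.eventually_all]
  intro m' hm'
  have h1 : ∀ᶠ δ in nhdsWithin (0 : ℝ) (Ioi 0), a m + ρ < a m' - ρ → a m + ρ + δ < a m' - ρ := by
    by_cases h : a m + ρ < a m' - ρ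
    · filter_upwards [Ioo_mem_nhdsGT (by linarith : (0 : ℝ) < a m' - ρ - (a m + ρ))] with δ hδ _
      linarith [hδ.2]
    · exact Filter.Eventually.of_forall fun δ h' => absurd h' h
  filter_upwards [h1, self_mem_nhdsWithin] with δ h2 (hδ : 0 < δ) habs
  obtain ⟨h3, h4⟩ := abs_le.1 habs
  have h5 : a m' - ρ < a m + ρ := by
    rcases lt_trichotomy (a m + ρ) (a m' - ρ) with h | h | h
    · linarith [h2 h]
    · exact absurd h (hne m' hm')
    · exact h
  have h6 : m ≠ m' := by
    rintro rfl
    linarith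
  have h7 := hsep m hm m' hm' h6
  rw [abs_of_neg (by linarith)] at h7
  linarith

/-- A sum of increments over intervals of equal length with disjoint interiors is bounded by the
values at the endpoints that belong to one interval only. -/
lemma abs_sum_increment_le {ι κ : Type*} {J : Finset ι} {K : Finset κ} {a : ι → ℝ}
    {b : κ → ℝ} {ρ : ℝ} (ha : ∀ m ∈ J, ∀ m' ∈ J, a m = a m' → m = m') (g : ℝ → ℝ)
    (h1 : ∀ m ∈ J, (∀ m' ∈ J, a m + ρ ≠ a m' - ρ) → ∃ l ∈ K, b l = a m + ρ)
    (h2 : ∀ m ∈ J, (∀ m' ∈ J, a m - ρ ≠ a m' + ρ) → ∃ l ∈ K, b l = a m - ρ) :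
    |∑ m ∈ J, (g (a m + ρ) - g (a m - ρ))| ≤ ∑ l ∈ K, |g (b l)| := by
  classical
  -- Points that are both a right and a left endpoint cancel, so only the two set differences
  -- survive; they are disjoint.
  set X := J.image fun m => a m + ρ with hX
  set Y := J.image fun m => a m - ρ with hY
  have e1 : ∑ m ∈ J, g (a m + ρ) = ∑ p ∈ X, g p :=
    (Finset.sum_image fun m hm m' hm' h => ha m hm m' hm' (by linarith)).symm
  have e2 : ∑ m ∈ J, g (a m - ρ) = ∑ p ∈ Y, g p :=
    (Finset.sum_image fun m hm m' hm' h => ha m hm m' hm' (by linarith)).symm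
  rw [Finset.sum_sub_distrib, e1, e2, ← Finset.sum_sdiff_sub_sum_sdiff]
  have hdisj : Disjoint (X \ Y) (Y \ X) := by
    rw [Finset.disjoint_left]
    intro p hp hp'
    exact (Finset.mem_sdiff.1 hp).2 (Finset.mem_sdiff.1 hp').1
  have hsub : (X \ Y) ∪ (Y \ X) ⊆ K.image b := by
    intro p hp
    rcases Finset.mem_union.1 hp with hp | hp
    · obtain ⟨hp1, hp2⟩ := Finset.mem_sdiff.1 hp
      obtain ⟨m, hm, rfl⟩ := Finset.mem_image.1 hp1
      obtain ⟨l, hl, hl'⟩ := h1 m hm fun m' hm' he =>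
        hp2 (Finset.mem_image.2 ⟨m', hm', he.symm⟩)
      exact Finset.mem_image.2 ⟨l, hl, hl'⟩
    · obtain ⟨hp1, hp2⟩ := Finset.mem_sdiff.1 hp
      obtain ⟨m, hm, rfl⟩ := Finset.mem_image.1 hp1
      obtain ⟨l, hl, hl'⟩ := h2 m hm fun m' hm' he =>
        hp2 (Finset.mem_image.2 ⟨m', hm', he.symm⟩)
      exact Finset.mem_image.2 ⟨l, hl, hl'⟩
  calc |∑ p ∈ X \ Y, g p - ∑ p ∈ Y \ X, g p|
      ≤ ∑ p ∈ X \ Y, |g p| + ∑ p ∈ Y \ X, |g p| :=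
        (abs_sub _ _).trans (add_le_add (Finset.abs_sum_le_sum_abs _ _)
          (Finset.abs_sum_le_sum_abs _ _))
    _ = ∑ p ∈ (X \ Y) ∪ (Y \ X), |g p| := (Finset.sum_union hdisj).symm
    _ ≤ ∑ p ∈ K.image b, |g p| :=
        Finset.sum_le_sum_of_subset_of_nonneg hsub fun _ _ _ => abs_nonneg _
    _ ≤ ∑ l ∈ K, |g (b l)| := by
        -- `b` may take a value several times; one index from each fibre already dominates the term
        -- of the image.
        rw [← Finset.sum_fiberwise_of_maps_to (t := K.image b) (g := b)
          (fun l hl => Finset.mem_image_of_mem b hl)]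
        refine Finset.sum_le_sum fun p hp => ?_
        obtain ⟨l, hl, rfl⟩ := Finset.mem_image.1 hp
        exact Finset.single_le_sum (f := fun l => |g (b l)|) (fun _ _ => abs_nonneg _)
          (Finset.mem_filter.2 ⟨hl, rfl⟩)

lemma ae_coord_ne {n : ℕ} (j : Fin n) (a : ℝ) : ∀ᵐ y : Fin n → ℝ, y j ≠ a := by
  have h : volume ((fun y : Fin n → ℝ => y j) ⁻¹' {a}) = 0 :=
    (Measure.quasiMeasurePreserving_eval (fun _ : Fin n => (volume : Measure ℝ)) j).preimage_null
      (measure_singleton a)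
  exact compl_mem_ae_iff.2 h

lemma ae_abs_coord_sub_ne {n : ℕ} (j : Fin n) (a ρ : ℝ) :
    ∀ᵐ y : Fin n → ℝ, |y j - a| ≠ ρ := by
  filter_upwards [ae_coord_ne j (a + ρ), ae_coord_ne j (a - ρ)] with y h1 h2 h
  have hρ : 0 ≤ ρ := h ▸ abs_nonneg _
  rcases (abs_eq hρ).1 h with h | h
  · exact h1 (by linarith)
  · exact h2 (by linarith)

end Lines

/-! ### Telescoping on lines through the cubes. -/

section Green

variable {d : ℕ} {Ω : Set (Eucl d)} {T : ℝ}

lemma interior_closure_cyl (hL : IsLipschitzDomain Ω) (hT : 0 < T) :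
    interior (closure (cyl Ω (Ioo 0 T))) = cyl Ω (Ioo 0 T) := by
  rw [closure_cyl_Ioo hT, interior_closedCyl hL]

/-- On almost every line parallel to the `i`-th axis, the increments of a function over the pieces
of the line inside the cylinder are controlled by its values on the lateral boundary. -/
lemma ae_abs_sum_increment_le (hL : IsLipschitzDomain Ω) (hT : 0 < T)
    (Q : CubePartition (d + 1) (cyl Ω (Ioo 0 T)))
    (P : CubePartition d (cyl (frontier Ω) (Icc 0 T))) {i : Fin (d + 1)} (hi : i ≠ Fin.last d)
    (F : Eucl (d + 1) → ℝ) :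
    ∀ᵐ y : Fin d → ℝ,
      |∑ m, (Metric.ball (fun j => Q.center m (i.succAbove j)) Q.half).indicator
        (fun y => F (ins i (Q.center m i + Q.half) y) - F (ins i (Q.center m i - Q.half) y)) y|
      ≤ ∑ m ∈ Finset.univ.filter (fun m => P.normal m = i),
          (Metric.ball (P.trace m) P.half).indicator
            (fun y => |F (ins (P.normal m) (P.level m) y)|) y := by
  classical
  -- A generic line avoids the lower-dimensional parts of cubes and faces (`g1`, `g3`), the faces
  -- whose normal is not `i` (`g2`), and the times 0 and `T` (`g4`).
  have g1 : ∀ᵐ y : Fin d → ℝ, ∀ m j, |y j - Q.center m (i.succAbove j)| ≠ Q.half :=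
    ae_all_iff.2 fun m => ae_all_iff.2 fun j => ae_abs_coord_sub_ne _ _ _
  have g2 : ∀ᵐ y : Fin d → ℝ, ∀ m j, y j ≠ P.center m (i.succAbove j) :=
    ae_all_iff.2 fun m => ae_all_iff.2 fun j => ae_coord_ne _ _
  have g3 : ∀ᵐ y : Fin d → ℝ, ∀ m j, |y j - P.center m (i.succAbove j)| ≠ P.half :=
    ae_all_iff.2 fun m => ae_all_iff.2 fun j => ae_abs_coord_sub_ne _ _ _
  have g4 : ∀ᵐ y : Fin d → ℝ, ∀ j, y j ≠ 0 ∧ y j ≠ T :=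
    ae_all_iff.2 fun j => (ae_coord_ne _ _).and (ae_coord_ne _ _)
  filter_upwards [g1, g2, g3, g4] with y hQ hP1 hP2 ht
  set ρ := Q.half with hρ
  set J := Finset.univ.filter fun m =>
    y ∈ Metric.ball (fun j => Q.center m (i.succAbove j)) ρ with hJ
  set K := (Finset.univ.filter fun m => P.normal m = i).filter fun m =>
    y ∈ Metric.ball (P.trace m) P.half with hK
  have hJmem : ∀ {m}, m ∈ J ↔ ∀ j, |y j - Q.center m (i.succAbove j)| < ρ := by
    intro m
    rw [hJ, Finset.mem_filter, Metric.mem_ball, dist_pi_lt_iff Q.half_pos]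
    simp [Real.dist_eq, hρ]
  have hcl : ∀ p : ℝ, ins i p y ∈ closure (cyl Ω (Ioo 0 T)) → ∃ m ∈ J, |p - Q.center m i| ≤ ρ := by
    intro p hp
    obtain ⟨m, hm⟩ := Q.mem_closure_iff_full.1 hp
    refine ⟨m, hJmem.2 fun j => lt_of_le_of_ne ?_ (hQ m j), by simpa using hm i⟩
    simpa using hm (i.succAbove j)
  have hcl' : ∀ m ∈ J, ∀ p : ℝ, |p - Q.center m i| ≤ ρ →
      ins i p y ∈ closure (cyl Ω (Ioo 0 T)) := by
    intro m hm p hp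
    refine Q.mem_closure_iff_full.2 ⟨m, fun j => ?_⟩
    refine Fin.succAboveCases i ?_ (fun j => ?_) j
    · simpa using hp
    · simpa using (hJmem.1 hm j).le
  -- If two cubes met by the line had closer centres, the point of the line halfway between them
  -- would lie in both open cubes.
  have hsep : ∀ m ∈ J, ∀ m' ∈ J, m ≠ m' → 2 * ρ ≤ |Q.center m i - Q.center m' i| := by
    intro m hm m' hm' hmm
    by_contra hlt
    rw [not_le] at hlt
    have hd : ∀ z, z ∈ Q.cell m → z ∉ Q.cell m' := fun z hz hz' =>
      Set.disjoint_left.1 (Q.disjoint_cell hmm) hz hz'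
    refine hd (ins i ((Q.center m i + Q.center m' i) / 2) y) ?_ ?_
    · refine CubePartition.mem_cell.2 fun j => ?_
      refine Fin.succAboveCases i ?_ (fun j => ?_) j
      · rw [ins_same, show (Q.center m i + Q.center m' i) / 2 - Q.center m i
          = -((Q.center m i - Q.center m' i) / 2) by ring, abs_neg, abs_div]
        norm_num; linarith
      · simpa using hJmem.1 hm j
    · refine CubePartition.mem_cell.2 fun j => ?_
      refine Fin.succAboveCases i ?_ (fun j => ?_) j
      · rw [ins_same, show (Q.center m i + Q.center m' i) / 2 - Q.center m' i
          = (Q.center m i - Q.center m' i) / 2 by ring, abs_div]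
        norm_num; linarith
      · simpa using hJmem.1 hm' j
  -- a boundary point of the line segment lies on a face
  have hface : ∀ p : ℝ, ins i p y ∈ closure (cyl Ω (Ioo 0 T)) → ins i p y ∉ cyl Ω (Ioo 0 T) →
      ∃ l ∈ K, P.level l = p := by
    intro p hp hp'
    rw [closure_cyl_Ioo hT] at hp
    obtain ⟨q, hq⟩ := Fin.exists_succAbove_eq hi.symm
    have htq : tpart (ins i p y) = y q := by
      rw [tpart, ← hq, ins_succAbove]
    have ht' : tpart (ins i p y) ∈ Ioo 0 T := by
      rw [htq]
      have h := hp.2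
      rw [htq] at h
      exact ⟨lt_of_le_of_ne h.1 (ht q).1.symm, lt_of_le_of_ne h.2 (ht q).2⟩
    have hz : ins i p y ∈ closure (cyl (frontier Ω) (Icc 0 T)) := by
      refine subset_closure ⟨⟨hp.1, fun h => hp' ⟨interior_subset h, ht'⟩⟩,
        Ioo_subset_Icc_self ht'⟩
    obtain ⟨l, hl1, hl2⟩ := P.mem_closure_iff_face.1 hz
    have hn : P.normal l = i := by
      by_contra hne
      obtain ⟨j, hj⟩ := Fin.exists_succAbove_eq hne
      rw [CubePartition.level, ← hj, ins_succAbove] at hl1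
      exact hP1 l j hl1
    refine ⟨l, ?_, ?_⟩
    · refine Finset.mem_filter.2 ⟨Finset.mem_filter.2 ⟨Finset.mem_univ _, hn⟩, ?_⟩
      rw [Metric.mem_ball, dist_pi_lt_iff P.half_pos]
      intro j
      rw [CubePartition.trace, hn, Real.dist_eq]
      refine lt_of_le_of_ne ?_ (hP2 l j)
      have := hl2 (i.succAbove j) (by rw [hn]; exact Fin.succAbove_ne _ _)
      simpa using this
    · rw [hn, ins_same] at hl1
      exact hl1.symm
  have hopen : IsOpen (cyl Ω (Ioo 0 T)) := isOpen_cyl hL.1 isOpen_Ioo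
  have hlim : ∀ p ε : ℝ, ins i p y ∈ cyl Ω (Ioo 0 T) →
      ∀ᶠ δ in nhdsWithin (0 : ℝ) (Ioi 0), ins i (p + ε * δ) y ∈ cyl Ω (Ioo 0 T) := by
    intro p ε hp
    have hc : Continuous fun δ : ℝ => ins i (p + ε * δ) y :=
      (continuous_ins i).comp ((by fun_prop : Continuous fun δ : ℝ => p + ε * δ).prodMk
        continuous_const)
    have := hc.tendsto 0
    simp only [mul_zero, add_zero] at this
    exact (this.mono_left nhdsWithin_le_nhds).eventually (hopen.mem_nhds hp)
  have key := abs_sum_increment_le (J := J) (K := K) (a := fun m => Q.center m i)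
    (b := fun l => P.level l) (ρ := ρ) ?_ (fun s => F (ins i s y)) ?_ ?_
  · have e1 : ∑ m, (Metric.ball (fun j => Q.center m (i.succAbove j)) ρ).indicator
        (fun y => F (ins i (Q.center m i + ρ) y) - F (ins i (Q.center m i - ρ) y)) y
        = ∑ m ∈ J, (F (ins i (Q.center m i + ρ) y) - F (ins i (Q.center m i - ρ) y)) := by
      rw [hJ, Finset.sum_filter]
      exact Finset.sum_congr rfl fun m _ => by rw [Set.indicator_apply]
    have e2 : ∑ m ∈ Finset.univ.filter (fun m => P.normal m = i),
          (Metric.ball (P.trace m) P.half).indicator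
            (fun y => |F (ins (P.normal m) (P.level m) y)|) y
        = ∑ m ∈ K, |F (ins i (P.level m) y)| := by
      rw [hK, Finset.sum_filter _ (fun m => |F (ins i (P.level m) y)|)]
      refine Finset.sum_congr rfl fun m hm => ?_
      rw [Set.indicator_apply, (Finset.mem_filter.1 hm).2]
    rw [e1, e2]
    exact key
  · intro m hm m' hm' he
    by_contra hne
    have := hsep m hm m' hm' hne
    simp only [he, sub_self, abs_zero] at this
    linarith [Q.half_pos]
  -- A free right endpoint cannot be in the open cylinder: points slightly beyond it would be in the
  -- cylinder as well, hence in some closed cube of `J`, where `exists_gap` leaves none.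
  · intro m hm hne
    refine hface _ (hcl' m hm _ (by simp [abs_of_pos Q.half_pos, hρ])) fun hin => ?_
    obtain ⟨δ, h1, h2⟩ := ((exists_gap hsep hm hne).and (hlim _ 1 hin)).exists
    obtain ⟨m', hm', h3⟩ := hcl _ (subset_closure h2)
    rw [one_mul] at h3
    exact h1 m' hm' h3
  · intro m hm hne
    refine hface _ (hcl' m hm _ (by simp [abs_of_pos Q.half_pos, hρ])) fun hin => ?_
    -- Left endpoints are right endpoints after reflection of the line.
    have hgap := exists_gap (a := fun m => -Q.center m i) (ρ := ρ) (fun m hm m' hm' h => by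
      have := hsep m hm m' hm' h
      rwa [neg_sub_neg, abs_sub_comm]) hm (fun m' hm' he => hne m' hm' (by linarith))
    obtain ⟨δ, h1, h2⟩ := (hgap.and (hlim _ (-1) hin)).exists
    obtain ⟨m', hm', h3⟩ := hcl _ (subset_closure h2)
    refine h1 m' hm' ?_
    rw [← abs_neg] at h3
    convert h3 using 2
    ring

end Green

/-! ### Integrals of spatial derivatives and the lateral boundary. -/

section Green

/-- Fubini's theorem for sets that are products in the coordinate `i` and the other coordinates. -/
lemma integral_ins {n : ℕ} (i : Fin (n + 1)) {A : Set ℝ} {B : Set (Fin n → ℝ)}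
    {g : Eucl (n + 1) → ℝ}
    (hg : IntegrableOn g {z | z i ∈ A ∧ (fun j => z (i.succAbove j)) ∈ B}) :
    ∫ z in {z : Eucl (n + 1) | z i ∈ A ∧ (fun j => z (i.succAbove j)) ∈ B}, g z
      = ∫ y in B, ∫ s in A, g (ins i s y) := by
  have hpre : (fun p : ℝ × (Fin n → ℝ) => ins i p.1 p.2) ⁻¹'
      {z | z i ∈ A ∧ (fun j => z (i.succAbove j)) ∈ B} = A ×ˢ B := by
    ext p; simp
  have hi : IntegrableOn (fun p : ℝ × (Fin n → ℝ) => g (ins i p.1 p.2)) (A ×ˢ B) := by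
    rw [← hpre]
    exact ((measurePreserving_ins i).integrableOn_comp_preimage (measurableEmbedding_ins i)).2 hg
  rw [← (measurePreserving_ins i).setIntegral_preimage_emb (measurableEmbedding_ins i), hpre]
  rw [Measure.volume_eq_prod] at hi ⊢
  rw [← setIntegral_prod_swap, setIntegral_prod]
  · rfl
  · exact hi.swap

variable {d : ℕ} {Ω : Set (Eucl d)} {T : ℝ}

lemma integrableOn_closedCyl (hL : IsLipschitzDomain Ω) {g : Eucl (d + 1) → ℝ}
    (hg : ContinuousOn g (closedCyl Ω T)) : IntegrableOn g (closedCyl Ω T) :=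
  hg.integrableOn_compact (isCompact_closedCyl hL T)

lemma ins_add_dir {n : ℕ} (i : Fin (n + 1)) (s t : ℝ) (y : Fin n → ℝ) :
    ins i (s + t) y = ins i s y + t • dir i := by
  ext j
  refine Fin.succAboveCases i ?_ (fun j => ?_) j <;> simp [dir_apply, Fin.succAbove_ne]

lemma hasDerivAt_ins {n : ℕ} (i : Fin (n + 1)) (s : ℝ) (y : Fin n → ℝ) :
    HasDerivAt (fun s => ins i s y) (dir i) s := by
  have h : (fun s => ins i s y) = fun s => ins i 0 y + s • dir i := by
    ext1 s
    rw [← ins_add_dir, zero_add]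
  rw [h]
  simpa using ((hasDerivAt_id s).smul_const (dir i : Eucl (n + 1))).const_add (ins i 0 y)

/-- Fundamental theorem of calculus along the lines in direction `i`, after Fubini. The cut-off at
time `τ` is constant on such lines, since time is the coordinate `q` of `y`. -/
lemma integral_cell_pd (hL : IsLipschitzDomain Ω) (hT : 0 < T)
    (Q : CubePartition (d + 1) (cyl Ω (Ioo 0 T))) {i : Fin (d + 1)} {q : Fin d}
    (hq : i.succAbove q = Fin.last d) {F : Eucl (d + 1) → ℝ}
    (hF : ContDiffOn ℝ 1 F (closedCyl Ω T)) (τ : ℝ) (m : Fin Q.M) :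
    ∫ z in Q.cell m, {z | tpart z ≤ τ}.indicator (pd (closedCyl Ω T) i F) z
      = ∫ y in Metric.ball (fun j => Q.center m (i.succAbove j)) Q.half,
        {y : Fin d → ℝ | y q ≤ τ}.indicator (fun y => F (ins i (Q.center m i + Q.half) y)
          - F (ins i (Q.center m i - Q.half) y)) y := by
  have hS := uniqueDiffOn_closedCyl hL hT
  have hpd : ContinuousOn (pd (closedCyl Ω T) i F) (closedCyl Ω T) :=
    (contDiffOn_pd hF hS (k := 0) (by norm_num) i).continuousOn
  have hcell : Q.cell m = {z : Eucl (d + 1) | z i ∈ Metric.ball (Q.center m i) Q.half ∧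
      (fun j => z (i.succAbove j)) ∈
        Metric.ball (fun j => Q.center m (i.succAbove j)) Q.half} := by
    ext z
    rw [CubePartition.mem_cell, mem_ofPred_eq, Fin.forall_iff_succAbove i, Metric.mem_ball,
      Metric.mem_ball, dist_pi_lt_iff Q.half_pos]
    rfl
  have hcc : Q.cell m ⊆ closedCyl Ω T := by
    rw [← closure_cyl_Ioo hT]; exact Q.cell_subset_closure m
  have hmeas : MeasurableSet {z : Eucl (d + 1) | tpart z ≤ τ} :=
    (isClosed_le continuous_tpart continuous_const).measurableSet
  have hint : IntegrableOn ({z | tpart z ≤ τ}.indicator (pd (closedCyl Ω T) i F)) (Q.cell m) :=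
    ((integrableOn_closedCyl hL hpd).mono_set hcc).indicator hmeas
  rw [hcell] at hint ⊢
  rw [integral_ins i hint]
  refine setIntegral_congr_fun Metric.isOpen_ball.measurableSet fun y hy => ?_
  have ht : ∀ s, tpart (ins i s y) = y q := fun s => by rw [tpart, ← hq, ins_succAbove]
  simp only [Set.indicator_apply, mem_ofPred_eq, ht]
  split_ifs
  · have hle : Q.center m i - Q.half ≤ Q.center m i + Q.half := by linarith [Q.half_pos]
    rw [Real.ball_eq_Ioo, ← integral_Ioc_eq_integral_Ioo, ← intervalIntegral.integral_of_le hle]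
    have hmem : ∀ s ∈ Icc (Q.center m i - Q.half) (Q.center m i + Q.half),
        ins i s y ∈ closedCyl Ω T := by
      intro s hs
      rw [← closure_cyl_Ioo hT]
      refine Q.mem_closure_iff_full.2 ⟨m, (Fin.forall_iff_succAbove i).2 ⟨?_, fun j => ?_⟩⟩
      · rw [ins_same, abs_le]
        exact ⟨by linarith [hs.1], by linarith [hs.2]⟩
      · rw [ins_succAbove]
        exact ((dist_pi_lt_iff Q.half_pos).1 hy j).le
    have hcont : Continuous fun s => ins i s y :=
      (continuous_ins i).comp (continuous_id.prodMk continuous_const)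
    refine intervalIntegral.integral_eq_sub_of_hasDerivAt_of_le hle
      (hF.continuousOn.comp hcont.continuousOn hmem) (fun s hs => ?_) ?_
    · have hz : ins i s y ∈ cyl Ω (Ioo 0 T) := by
        refine Q.cell_subset (interior_closure_cyl hL hT) m ?_
        rw [hcell]
        refine ⟨?_, by simpa using hy⟩
        rw [ins_same, Real.ball_eq_Ioo]
        exact hs
      have hnhds : closedCyl Ω T ∈ nhds (ins i s y) :=
        mem_interior_iff_mem_nhds.1 (by rwa [interior_closedCyl hL])
      have h1 := ((hF.differentiableOn (by norm_num)) _
        (mem_of_mem_nhds hnhds)).hasFDerivWithinAt.hasFDerivAt hnhds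
      exact h1.comp_hasDerivAt s (hasDerivAt_ins i s y)
    · exact (hpd.comp hcont.continuousOn hmem).intervalIntegrable_of_Icc hle
  · simp

/-- The integral of a spatial derivative is bounded by an integral over the lateral boundary. -/
theorem abs_integral_pd_le (hL : IsLipschitzDomain Ω) (hT : 0 < T)
    (Q : CubePartition (d + 1) (cyl Ω (Ioo 0 T)))
    (P : CubePartition d (cyl (frontier Ω) (Icc 0 T))) {i : Fin (d + 1)} (hi : i ≠ Fin.last d)
    {F : Eucl (d + 1) → ℝ} (hF : ContDiffOn ℝ 1 F (closedCyl Ω T)) {τ : ℝ} (hτ : τ ∈ Icc 0 T) :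
    |∫ z in cyl Ω (Icc 0 τ), pd (closedCyl Ω T) i F z|
      ≤ ∑ m ∈ Finset.univ.filter (fun m => P.normal m = i),
        ∫ y in Metric.ball (P.trace m) P.half, |F (ins (P.normal m) (P.level m) y)| := by
  have hS := uniqueDiffOn_closedCyl hL hT
  obtain ⟨q, hq⟩ := Fin.exists_succAbove_eq hi.symm
  have hpd : ContinuousOn (pd (closedCyl Ω T) i F) (closedCyl Ω T) :=
    (contDiffOn_pd hF hS (k := 0) (by norm_num) i).continuousOn
  have hmeas : MeasurableSet {z : Eucl (d + 1) | tpart z ≤ τ} :=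
    (isClosed_le continuous_tpart continuous_const).measurableSet
  have hmeas' : MeasurableSet {y : Fin d → ℝ | y q ≤ τ} :=
    (isClosed_le (continuous_apply q) continuous_const).measurableSet
  have hsub : cyl Ω (Ioo 0 T) ⊆ closedCyl Ω T := fun z hz =>
    ⟨subset_closure hz.1, Ioo_subset_Icc_self hz.2⟩
  have hint : IntegrableOn ({z | tpart z ≤ τ}.indicator (pd (closedCyl Ω T) i F))
      (cyl Ω (Ioo 0 T)) :=
    ((integrableOn_closedCyl hL hpd).mono_set hsub).indicator hmeas
  -- The upper time limit becomes a cut-off on the full cylinder, because the cubes partition the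
  -- full cylinder and not the part up to `τ`.
  have hae : cyl Ω (Icc 0 τ) =ᵐ[volume] (cyl Ω (Ioo 0 T) ∩ {z | tpart z ≤ τ} : Set _) := by
    have h0 := compl_mem_ae_iff.2 (volume_coord_eq_zero (Fin.last d) 0)
    have h1 := compl_mem_ae_iff.2 (volume_coord_eq_zero (Fin.last d) T)
    filter_upwards [h0, h1] with z hz0 hz1
    refine propext ⟨fun hz => ⟨⟨hz.1, lt_of_le_of_ne hz.2.1 (Ne.symm hz0),
      lt_of_le_of_ne (hz.2.2.trans hτ.2) hz1⟩, hz.2.2⟩, fun hz => ⟨hz.1.1, hz.1.2.1.le, hz.2⟩⟩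
  rw [setIntegral_congr_set hae, ← setIntegral_indicator hmeas,
    Q.integral_eq_sum (interior_closure_cyl hL hT) hint]
  simp only [integral_cell_pd hL hT Q hq hF τ]
  have hcont : ∀ (m : Fin Q.M) (s : ℝ), |s - Q.center m i| ≤ Q.half →
      IntegrableOn (fun y => F (ins i s y))
        (Metric.ball (fun j => Q.center m (i.succAbove j)) Q.half) := by
    intro m s hs
    refine IntegrableOn.mono_set (ContinuousOn.integrableOn_compact
      (isCompact_closedBall _ _) ?_) Metric.ball_subset_closedBall
    refine hF.continuousOn.comp ((continuous_ins i).comp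
      (continuous_const.prodMk continuous_id)).continuousOn fun y hy => ?_
    rw [← closure_cyl_Ioo hT]
    refine Q.mem_closure_iff_full.2 ⟨m, (Fin.forall_iff_succAbove i).2 ⟨?_, fun j => ?_⟩⟩
    · simpa using hs
    · have := (dist_pi_le_iff Q.half_pos.le).1 hy j
      simpa [Real.dist_eq] using this
  have hint1 : ∀ m : Fin Q.M, IntegrableOn ({y : Fin d → ℝ | y q ≤ τ}.indicator
      (fun y => F (ins i (Q.center m i + Q.half) y) - F (ins i (Q.center m i - Q.half) y)))
      (Metric.ball (fun j => Q.center m (i.succAbove j)) Q.half) := fun m =>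
    ((hcont m _ (by simp [abs_of_pos Q.half_pos])).sub
      (hcont m _ (by simp [abs_of_pos Q.half_pos]))).indicator hmeas'
  have hint2 : ∀ m : Fin P.M, IntegrableOn (fun y => |F (ins (P.normal m) (P.level m) y)|)
      (Metric.ball (P.trace m) P.half) := fun m =>
    P.integrableOn_face isClosed_lateral
      (hF.continuousOn.abs.mono cyl_frontier_subset) m
  simp only [← integral_indicator (Metric.isOpen_ball.measurableSet : MeasurableSet
    (Metric.ball (_ : Fin d → ℝ) _))]
  rw [← integral_finsetSum _ fun m _ =>
      (hint1 m).integrable_indicator Metric.isOpen_ball.measurableSet,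
    ← integral_finsetSum _ fun m _ =>
      (hint2 m).integrable_indicator Metric.isOpen_ball.measurableSet]
  rw [← Real.norm_eq_abs]
  refine norm_integral_le_of_norm_le (integrable_finsetSum _ fun m _ =>
    (hint2 m).integrable_indicator Metric.isOpen_ball.measurableSet) ?_
  filter_upwards [ae_abs_sum_increment_le hL hT Q P hi F] with y hy
  rw [Real.norm_eq_abs]
  -- The time of the line is the same in all cubes, so the cut-off keeps either the whole sum or
  -- nothing.
  by_cases hyτ : y q ≤ τ
  · refine le_trans (le_of_eq ?_) hy
    congr 1
    refine Finset.sum_congr rfl fun m _ => ?_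
    by_cases hb : y ∈ Metric.ball (fun j => Q.center m (i.succAbove j)) Q.half
    · rw [indicator_of_mem hb, indicator_of_mem hb]
      exact indicator_of_mem (s := {y : Fin d → ℝ | y q ≤ τ}) hyτ _
    · rw [indicator_of_notMem hb, indicator_of_notMem hb]
  · refine le_trans (le_of_eq ?_) ((abs_nonneg _).trans hy)
    rw [abs_eq_zero]
    refine Finset.sum_eq_zero fun m _ => ?_
    simp [hyτ]

end Green

/-! ### The energy identity -/

section Energy

variable {d : ℕ} {Ω : Set (Eucl d)} {T τ t : ℝ} {g w : Eucl (d + 1) → ℝ} {x : Eucl d}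

lemma hasDerivAt_pair_right (x : Eucl d) (t : ℝ) :
    HasDerivAt (fun s : ℝ => pair x s) (dir (Fin.last d)) t := by
  have := ((splitL d).symm.hasFDerivAt (x := (x, t))).comp_hasDerivAt t
    ((hasDerivAt_const t x).prodMk (hasDerivAt_id t))
  rw [← pair_zero_one]
  exact this

lemma continuousOn_time (hg : ContinuousOn g (closedCyl Ω T)) (hx : x ∈ closure Ω) :
    ContinuousOn (fun s => g (pair x s)) (Icc 0 T) :=
  hg.comp (continuous_pair.comp (Continuous.prodMk_right x)).continuousOn
    fun _ hs => pair_mem_cyl.2 ⟨hx, hs⟩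

lemma continuousOn_space (hg : ContinuousOn g (closedCyl Ω T)) (ht : t ∈ Icc 0 T) :
    ContinuousOn (fun x => g (pair x t)) (closure Ω) :=
  hg.comp (continuous_pair.comp (Continuous.prodMk_left t)).continuousOn
    fun _ hx => pair_mem_cyl.2 ⟨hx, ht⟩

lemma integrableOn_space (hL : IsLipschitzDomain Ω) (hg : ContinuousOn g (closedCyl Ω T))
    (ht : t ∈ Icc 0 T) : IntegrableOn (fun x => g (pair x t)) Ω :=
  ((continuousOn_space hg ht).integrableOn_compact hL.2.2.1.isCompact_closure).mono_set
    subset_closure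

lemma hasDerivWithinAt_time (hg : DifferentiableOn ℝ g (closedCyl Ω T)) (hx : x ∈ closure Ω)
    (ht : t ∈ Icc 0 T) :
    HasDerivWithinAt (fun s => g (pair x s)) (dt Ω T g (pair x t)) (Icc 0 T) t := by
  have hmap : MapsTo (fun s => pair x s) (Icc 0 T) (closedCyl Ω T) :=
    fun _ hs => pair_mem_cyl.2 ⟨hx, hs⟩
  exact (hg _ (hmap ht)).hasFDerivWithinAt.comp_hasDerivWithinAt t
    (hasDerivAt_pair_right x t).hasDerivWithinAt hmap

lemma hasDerivAt_time (hg : DifferentiableOn ℝ g (closedCyl Ω T)) (hx : x ∈ closure Ω)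
    (ht : t ∈ Ioo 0 T) :
    HasDerivAt (fun s => g (pair x s)) (dt Ω T g (pair x t)) t :=
  (hasDerivWithinAt_time hg hx (Ioo_subset_Icc_self ht)).hasDerivAt (Icc_mem_nhds ht.1 ht.2)

lemma integral_time (hL : IsLipschitzDomain Ω) (hT : 0 < T) (hg : ContDiffOn ℝ 1 g (closedCyl Ω T))
    (hx : x ∈ closure Ω) (hτ : τ ∈ Icc 0 T) :
    ∫ t in Icc 0 τ, dt Ω T g (pair x t) = g (pair x τ) - g (pair x 0) := by
  have hsub : Icc 0 τ ⊆ Icc 0 T := Icc_subset_Icc_right hτ.2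
  have hc : ContinuousOn (dt Ω T g) (closedCyl Ω T) :=
    (contDiffOn_pd (k := 0) hg (uniqueDiffOn_closedCyl hL hT) (by norm_num) _).continuousOn
  rw [integral_Icc_eq_integral_Ioc, ← intervalIntegral.integral_of_le hτ.1]
  refine intervalIntegral.integral_eq_sub_of_hasDerivAt_of_le hτ.1
    ((continuousOn_time hg.continuousOn hx).mono hsub)
    (fun t ht => hasDerivAt_time (hg.differentiableOn (by norm_num)) hx ⟨ht.1, ht.2.trans_le hτ.2⟩)
    ?_
  refine ContinuousOn.intervalIntegrable ?_
  rw [uIcc_of_le hτ.1]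
  exact (continuousOn_time hc hx).mono hsub

lemma integrableOn_cyl (hL : IsLipschitzDomain Ω) (hg : ContinuousOn g (closedCyl Ω T))
    (hτ : τ ≤ T) : IntegrableOn g (cyl Ω (Icc 0 τ)) :=
  (integrableOn_closedCyl hL hg).mono_set
    fun _ hz => ⟨subset_closure hz.1, hz.2.1, hz.2.2.trans hτ⟩

/-- The time derivative integrates to the difference of the slices. -/
lemma integral_dt (hL : IsLipschitzDomain Ω) (hT : 0 < T) (hg : ContDiffOn ℝ 1 g (closedCyl Ω T))
    (hτ : τ ∈ Icc 0 T) :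
    ∫ z in cyl Ω (Icc 0 τ), dt Ω T g z = (∫ x in Ω, g (pair x τ)) - ∫ x in Ω, g (pair x 0) := by
  have hc : ContinuousOn (dt Ω T g) (closedCyl Ω T) :=
    (contDiffOn_pd (k := 0) hg (uniqueDiffOn_closedCyl hL hT) (by norm_num) _).continuousOn
  rw [integral_cyl (integrableOn_cyl hL hc hτ.2), ← integral_sub
    (integrableOn_space hL hg.continuousOn hτ)
    (integrableOn_space hL hg.continuousOn ⟨le_rfl, hT.le⟩)]
  exact setIntegral_congr_fun hL.1.measurableSet
    fun x hx => integral_time hL hT hg (subset_closure hx) hτ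

/-- The energy density `w_t² + |∇w|²`. -/
def energy (Ω : Set (Eucl d)) (T : ℝ) (w : Eucl (d + 1) → ℝ) (z : Eucl (d + 1)) : ℝ :=
  dt Ω T w z ^ 2 + ∑ i, dx Ω T i w z ^ 2

lemma closure_interior_closedCyl (hL : IsLipschitzDomain Ω) (hT : 0 < T) :
    closure (interior (closedCyl Ω T)) = closedCyl Ω T := by
  rw [interior_closedCyl hL, closure_cyl_Ioo hT]

lemma contDiffOn_energy (hL : IsLipschitzDomain Ω) (hT : 0 < T)
    (hw : ContDiffOn ℝ 2 w (closedCyl Ω T)) : ContDiffOn ℝ 1 (energy Ω T w) (closedCyl Ω T) := by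
  have h1 : ∀ i, ContDiffOn ℝ 1 (pd (closedCyl Ω T) i w) (closedCyl Ω T) := fun i =>
    contDiffOn_pd hw (uniqueDiffOn_closedCyl hL hT) (by norm_num) _
  exact ((h1 _).pow 2).add (ContDiffOn.sum fun i _ => (h1 _).pow 2)

/-- The mixed term 2 w_i w_it equals 2 (w_t w_i)_i - 2 w_t w_ii by symmetry of second derivatives;
the last parts assemble into the Laplacian. -/
lemma dt_energy (hL : IsLipschitzDomain Ω) (hT : 0 < T) (hw : ContDiffOn ℝ 2 w (closedCyl Ω T))
    {z : Eucl (d + 1)} (hz : z ∈ closedCyl Ω T) :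
    dt Ω T (energy Ω T w) z
      = 2 * dt Ω T w z * (dt Ω T (dt Ω T w) z - ∑ i, dx Ω T i (dx Ω T i w) z)
        + ∑ i, 2 * dx Ω T i (fun z => dt Ω T w z * dx Ω T i w z) z := by
  have hS := uniqueDiffOn_closedCyl hL hT
  have h1 : ∀ i, DifferentiableOn ℝ (pd (closedCyl Ω T) i w) (closedCyl Ω T) := fun i =>
    (contDiffOn_pd (k := 1) hw hS (by norm_num) i).differentiableOn (by norm_num)
  have hcomm : ∀ i j, pd (closedCyl Ω T) i (pd (closedCyl Ω T) j w) z
      = pd (closedCyl Ω T) j (pd (closedCyl Ω T) i w) z := fun i j =>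
    pd_comm hS hw le_rfl hz (by rwa [closure_interior_closedCyl hL hT]) i j
  have e1 : dt Ω T (energy Ω T w) z = dt Ω T (fun z => dt Ω T w z * dt Ω T w z
      + ∑ i, dx Ω T i w z * dx Ω T i w z) z :=
    pd_congr (fun y _ => by simp [energy, pow_two]) hz _
  rw [e1]
  simp only [dt, dx]
  rw [pd_add hS hz ((h1 _).fun_mul (h1 _))
      (DifferentiableOn.fun_sum fun i _ => (h1 _).fun_mul (h1 _)),
    pd_sum hS hz (fun i _ => (h1 _).fun_mul (h1 _))]
  simp only [pd_mul hS hz (h1 _) (h1 _)]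
  simp only [hcomm (Fin.last d), mul_sub, Finset.mul_sum]
  rw [sub_add_eq_add_sub, add_sub_assoc, ← Finset.sum_sub_distrib]
  congr 1
  · ring
  · exact Finset.sum_congr rfl fun i _ => by ring

/-- The energy inequality. -/
lemma integral_dt_sq_le (hL : IsLipschitzDomain Ω) (hT : 0 < T)
    (hw : ContDiffOn ℝ 2 w (closedCyl Ω T)) (hτ : τ ∈ Icc 0 T) :
    ∫ x in Ω, dt Ω T w (pair x τ) ^ 2 ≤ (∫ x in Ω, energy Ω T w (pair x 0))
      + (∫ z in cyl Ω (Icc 0 τ),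
          2 * dt Ω T w z * (dt Ω T (dt Ω T w) z - ∑ i, dx Ω T i (dx Ω T i w) z))
      + 2 * ∑ i, |∫ z in cyl Ω (Icc 0 τ), dx Ω T i (fun z => dt Ω T w z * dx Ω T i w z) z| := by
  have hS := uniqueDiffOn_closedCyl hL hT
  have h1 : ∀ i, ContDiffOn ℝ 1 (pd (closedCyl Ω T) i w) (closedCyl Ω T) := fun i =>
    contDiffOn_pd hw hS (by norm_num) _
  have h0 : ∀ i j, ContinuousOn (pd (closedCyl Ω T) i (pd (closedCyl Ω T) j w)) (closedCyl Ω T) :=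
    fun i j => (contDiffOn_pd (k := 0) (h1 j) hS (by norm_num) _).continuousOn
  have h2 : ∀ i, ContinuousOn (dx Ω T i (fun z => dt Ω T w z * dx Ω T i w z)) (closedCyl Ω T) :=
    fun i => (contDiffOn_pd (k := 0) ((h1 _).mul (h1 _)) hS (by norm_num) _).continuousOn
  have h3 : ContinuousOn (fun z => 2 * dt Ω T w z * (dt Ω T (dt Ω T w) z
      - ∑ i, dx Ω T i (dx Ω T i w) z)) (closedCyl Ω T) :=
    (continuousOn_const.mul (h1 _).continuousOn).mul
      ((h0 _ _).sub (continuousOn_finsetSum _ fun i _ => h0 _ _))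
  have hE := contDiffOn_energy hL hT hw
  have key := integral_dt hL hT hE hτ
  have hm : MeasurableSet (cyl Ω (Icc 0 τ)) := measurableSet_cyl hL.1.measurableSet measurableSet_Icc
  rw [setIntegral_congr_fun hm (fun z hz => dt_energy hL hT hw (z := z)
      ⟨subset_closure hz.1, hz.2.1, hz.2.2.trans hτ.2⟩),
    integral_add (integrableOn_cyl hL h3 hτ.2)
      (integrable_finsetSum _ fun i _ => (integrableOn_cyl hL (h2 i) hτ.2).const_mul 2),
    integral_finsetSum _ fun i _ => (integrableOn_cyl hL (h2 i) hτ.2).const_mul 2] at key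
  simp only [integral_const_mul, ← Finset.mul_sum] at key
  -- The gradient part of the energy at the final time is nonnegative and is dropped.
  have hle : ∫ x in Ω, dt Ω T w (pair x τ) ^ 2 ≤ ∫ x in Ω, energy Ω T w (pair x τ) :=
    setIntegral_mono (integrableOn_space hL ((h1 _).continuousOn.pow 2) hτ)
      (integrableOn_space hL hE.continuousOn hτ)
      fun x => le_add_of_nonneg_right (Finset.sum_nonneg fun i _ => sq_nonneg _)
  have habs : ∑ i, ∫ z in cyl Ω (Icc 0 τ), dx Ω T i (fun z => dt Ω T w z * dx Ω T i w z) z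
      ≤ ∑ i, |∫ z in cyl Ω (Icc 0 τ), dx Ω T i (fun z => dt Ω T w z * dx Ω T i w z) z| :=
    Finset.sum_le_sum fun i _ => le_abs_self _
  linarith

end Energy

/-! ### The source terms -/

section Source

lemma rpow_add_le_mul_rpow_add_rpow {p a b : ℝ} (ha : 0 ≤ a) (hb : 0 ≤ b) (hp : 1 ≤ p) :
    (a + b) ^ p ≤ 2 ^ (p - 1) * (a ^ p + b ^ p) := by
  have h := NNReal.rpow_add_le_mul_rpow_add_rpow ⟨a, ha⟩ ⟨b, hb⟩ hp
  exact_mod_cast h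

/-- A function whose derivative grows like `c |s|^r` has increments as in the constant `cHat`. -/
lemma abs_sub_le_of_deriv_growth {φ φ' : ℝ → ℝ} {c r : ℝ} (hc : 0 ≤ c) (hr : 1 ≤ r)
    (hφ : ∀ s, HasDerivAt φ (φ' s) s) (hb : ∀ s, |φ' s| ≤ c * |s| ^ r) (p w : ℝ) :
    |φ (p + w) - φ p| ≤ 2 ^ (r - 1) * c * (|p| ^ r + 1 / (r + 1) * |w| ^ r) * |w| := by
  have hline : ∀ s : ℝ, HasDerivAt (fun s => φ (p + s * w) - φ p) (φ' (p + s * w) * w) s := by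
    intro s
    have h1 : HasDerivAt (fun s : ℝ => p + s * w) w s := by
      simpa using ((hasDerivAt_id s).mul_const w).const_add p
    exact ((hφ _).comp s h1).sub_const _
  -- The majorant along the segment from `p` to `p + w`: convexity splits |p + s w|^r into |p|^r and
  -- s^r |w|^r with the factor 2^{r-1}, and integrating s^r from 0 to 1 gives 1 / (r + 1).
  have hB : ∀ s : ℝ, HasDerivAt
      (fun s => 2 ^ (r - 1) * c * |w| * (s * |p| ^ r + s ^ (r + 1) * (1 / (r + 1) * |w| ^ r)))
      (2 ^ (r - 1) * c * |w| * (|p| ^ r + s ^ r * |w| ^ r)) s := by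
    intro s
    have h1 := (Real.hasDerivAt_rpow_const (x := s) (p := r + 1) (Or.inr (by linarith))).mul_const
      (1 / (r + 1) * |w| ^ r)
    have h2 := (((hasDerivAt_id s).mul_const (|p| ^ r)).add h1).const_mul (2 ^ (r - 1) * c * |w|)
    have h3 : r + 1 ≠ 0 := by linarith
    refine h2.congr_deriv ?_
    rw [add_sub_cancel_right]
    field_simp
  have key := image_norm_le_of_norm_deriv_right_le_deriv_boundary (a := 0) (b := 1)
    (f := fun s => φ (p + s * w) - φ p)
    (fun s _ => (hline s).continuousAt.continuousWithinAt) (fun s _ => (hline s).hasDerivWithinAt)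
    (by simp [Real.zero_rpow (show r + 1 ≠ 0 by linarith)]) hB ?_ (x := 1) ⟨zero_le_one, le_rfl⟩
  · simp only [one_mul, Real.one_rpow, Real.norm_eq_abs] at key
    exact key.trans (le_of_eq (by ring))
  · intro s hs
    have hs0 : 0 ≤ s := hs.1
    rw [Real.norm_eq_abs, abs_mul]
    have h1 : |p + s * w| ^ r ≤ 2 ^ (r - 1) * (|p| ^ r + s ^ r * |w| ^ r) := by
      rw [← Real.mul_rpow hs0 (abs_nonneg w)]
      refine le_trans (Real.rpow_le_rpow (abs_nonneg _) ?_ (by linarith))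
        (rpow_add_le_mul_rpow_add_rpow (abs_nonneg p) (by positivity) hr)
      refine (abs_add_le _ _).trans_eq ?_
      rw [abs_mul, abs_of_nonneg hs0]
    calc |φ' (p + s * w)| * |w| ≤ c * (2 ^ (r - 1) * (|p| ^ r + s ^ r * |w| ^ r)) * |w| := by
          gcongr
          exact (hb _).trans (by gcongr)
      _ = _ := by ring

variable {d : ℕ} {Ω : Set (Eucl d)} {T : ℝ} {D : WaveData d Ω T} {k : ℕ} {c r : ℝ}
  {u v : Eucl (d + 1) → ℝ} {z : Eucl (d + 1)}

lemma AssumptionA2.abs_sub_le {f : Eucl d → ℝ → ℝ} (hf : AssumptionA2 Ω f k c r)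
    (hL : IsLipschitzDomain Ω) {x : Eucl d} (hx : x ∈ closure Ω) (p q : ℝ) :
    |f x q - f x p| ≤ 2 ^ (r - 1) * c * (|p| ^ r + 1 / (r + 1) * |q - p| ^ r) * |q - p| := by
  have hder : ∀ s, HasDerivAt (f x) (pd (cyl (closure Ω) univ) (Fin.last d)
      (fun z => f (xpart z) (tpart z)) (pair x s)) s := by
    intro s
    have hmem : ∀ s, pair x s ∈ cyl (closure Ω) univ := fun s => pair_mem_cyl.2 ⟨hx, mem_univ _⟩
    have h2 := ((hf.contDiffOn.differentiableOn (by norm_num)) _ (hmem s)).hasFDerivWithinAt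
      |>.comp_hasDerivWithinAt s ((hasDerivAt_pair_right x s).hasDerivWithinAt (s := univ)) fun s _ => hmem s
    have h3 := h2.hasDerivAt Filter.univ_mem
    have h4 : ((fun z => f (xpart z) (tpart z)) ∘ fun s => pair x s) = f x := by
      ext s; simp
    rw [h4] at h3
    exact h3
  have h := abs_sub_le_of_deriv_growth hf.2.1.le hf.2.2.2.2.1 hder (fun s => ?_) p (q - p)
  · simpa using h
  · simpa using hf.bound_one hL (z := pair x s) (pair_mem_cyl.2 ⟨hx, mem_univ _⟩) (Fin.last d)

lemma cHat_nonneg (hc : 0 ≤ c) (hr : 1 ≤ r) : 0 ≤ cHat Ω T c r u v := by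
  have h1 := cNorm_nonneg (closedCyl Ω T) 0 u
  have h2 := cNorm_nonneg (closedCyl Ω T) 0 (fun z => v z - u z)
  unfold cHat
  positivity

lemma abs_nonlinearity_sub_le (hL : IsLipschitzDomain Ω) (hT : 0 < T)
    (hf : AssumptionA2 Ω D.f k c r) (hu : ContinuousOn u (closedCyl Ω T))
    (hv : ContinuousOn v (closedCyl Ω T)) (hz : z ∈ closedCyl Ω T) :
    |D.f (xpart z) (v z) - D.f (xpart z) (u z)| ≤ cHat Ω T c r u v * |v z - u z| := by
  have hS := uniqueDiffOn_closedCyl hL hT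
  have hc := isCompact_closedCyl hL T
  have h1 := (derivBound_cNorm_of_isCompact (m := 0) hS hc (contDiffOn_zero.2 hu)).abs_le hz
  have h2 := (derivBound_cNorm_of_isCompact (m := 0) (g := fun z => v z - u z) hS hc
    (contDiffOn_zero.2 (hv.sub hu))).abs_le hz
  have hc0 := hf.2.1.le
  have hr := hf.2.2.2.2.1
  refine (hf.abs_sub_le hL hz.1 _ _).trans ?_
  unfold cHat
  gcongr

/-- By continuity, the set of points of `Ω` with negative `a` is open; it would have positive
measure if it were nonempty. -/
lemma AssumptionA1.nonneg {a : Eucl d → ℝ} (h : AssumptionA1 Ω a) (hΩ : IsOpen Ω)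
    (ha : ContinuousOn a (closure Ω)) {x : Eucl d} (hx : x ∈ Ω) : 0 ≤ a x := by
  by_contra! hneg
  have hopen : IsOpen (Ω ∩ a ⁻¹' Iio 0) :=
    (ha.mono subset_closure).isOpen_inter_preimage hΩ isOpen_Iio
  have h0 : volume.restrict (closure Ω) (Ω ∩ a ⁻¹' Iio 0) = 0 :=
    measure_mono_null (fun y hy (hy' : 0 ≤ a y ∧ a y ≠ 0) => not_lt.2 hy'.1 hy.2) (ae_iff.1 h.1)
  rw [Measure.restrict_apply hopen.measurableSet,
    inter_eq_left.2 (inter_subset_left.trans subset_closure)] at h0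
  exact (hopen.measure_pos volume ⟨x, hx, hneg⟩).ne' h0

/-- Subtracting the equations expresses the source by the residual, the damping and the difference
of the nonlinearities. The damping contributes -2 a w_t² ≤ 0; the other two products are split by 2
x y ≤ x² + y². -/
lemma two_mul_source_le (hL : IsLipschitzDomain Ω) (hT : 0 < T)
    (ha : ContDiffOn ℝ 2 D.a (closure Ω)) (hA : AssumptionA1 Ω D.a)
    (hf : AssumptionA2 Ω D.f k c r)
    (hu : ContDiffOn ℝ 4 u (closedCyl Ω T)) (hsol : IsClassicalSolution D u)
    (hv : ContDiffOn ℝ 4 v (closedCyl Ω T)) (hz : z ∈ cyl Ω (Icc 0 T)) :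
    2 * dt Ω T (fun z => v z - u z) z * (dt Ω T (dt Ω T (fun z => v z - u z)) z
        - ∑ i, dx Ω T i (dx Ω T i (fun z => v z - u z)) z)
      ≤ resPDE D v z ^ 2 + (1 + cHat Ω T c r u v) * dt Ω T (fun z => v z - u z) z ^ 2
        + cHat Ω T c r u v * (v z - u z) ^ 2 := by
  have hS := uniqueDiffOn_closedCyl hL hT
  have hz' : z ∈ closedCyl Ω T := ⟨subset_closure hz.1, hz.2⟩
  have du := hu.differentiableOn (by norm_num)
  have dv := hv.differentiableOn (by norm_num)
  have du' : ∀ i, DifferentiableOn ℝ (pd (closedCyl Ω T) i u) (closedCyl Ω T) := fun i =>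
    (contDiffOn_pd (k := 1) hu hS (by norm_num) i).differentiableOn (by norm_num)
  have dv' : ∀ i, DifferentiableOn ℝ (pd (closedCyl Ω T) i v) (closedCyl Ω T) := fun i =>
    (contDiffOn_pd (k := 1) hv hS (by norm_num) i).differentiableOn (by norm_num)
  have h2 : ∀ i, pd (closedCyl Ω T) i (pd (closedCyl Ω T) i (fun z => v z - u z)) z
      = pd (closedCyl Ω T) i (pd (closedCyl Ω T) i v) z
        - pd (closedCyl Ω T) i (pd (closedCyl Ω T) i u) z := fun i => by
    rw [pd_congr (fun y hy => pd_sub hS hy dv du i) hz', pd_sub hS hz' (dv' i) (du' i)]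
  have heq : dt Ω T (dt Ω T (fun z => v z - u z)) z
        - ∑ i, dx Ω T i (dx Ω T i (fun z => v z - u z)) z
      = resPDE D v z - D.a (xpart z) * dt Ω T (fun z => v z - u z) z
        - (D.f (xpart z) (v z) - D.f (xpart z) (u z)) := by
    have h0 := hsol.2.1 z hz
    have h1 : dt Ω T (fun z => v z - u z) z = dt Ω T v z - dt Ω T u z := pd_sub hS hz' dv du _
    simp only [resPDE] at h0 ⊢
    rw [h1]
    simp only [dt, dx, h2, Finset.sum_sub_distrib] at h0 ⊢
    linarith
  have ha0 := hA.nonneg hL.1 ha.continuousOn hz.1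
  have hφ := abs_nonlinearity_sub_le hL hT hf hu.continuousOn hv.continuousOn hz'
  have hC := cHat_nonneg (Ω := Ω) (T := T) (u := u) (v := v) hf.2.1.le hf.2.2.2.2.1
  rw [heq]
  generalize dt Ω T (fun z => v z - u z) z = p at *
  generalize D.f (xpart z) (v z) - D.f (xpart z) (u z) = φ at *
  generalize cHat Ω T c r u v = C at *
  generalize v z - u z = w at *
  have h3 : -(2 * p * φ) ≤ C * (p ^ 2 + w ^ 2) := by
    calc -(2 * p * φ) ≤ 2 * (|p| * |φ|) := by
          rw [← abs_mul]; nlinarith [neg_abs_le (p * φ)]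
      _ ≤ 2 * (|p| * (C * |w|)) := by gcongr
      _ = C * (2 * |p| * |w|) := by ring
      _ ≤ C * (|p| ^ 2 + |w| ^ 2) := by gcongr; exact two_mul_le_add_sq _ _
      _ = _ := by simp
  nlinarith [sq_nonneg (p - resPDE D v z), mul_nonneg ha0 (sq_nonneg p)]

end Source

/-! ### The boundary terms -/

section Boundary

variable {d : ℕ} {Ω : Set (Eucl d)} {T : ℝ} {D : WaveData d Ω T} {u v w : Eucl (d + 1) → ℝ}

/-- Above a boundary point the solution vanishes on the whole segment [0, T], so its derivative
along the segment does too, one-sidedly at the ends. -/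
lemma IsClassicalSolution.dt_eq_zero (hsol : IsClassicalSolution D u) (hT : 0 < T)
    {z : Eucl (d + 1)} (hz : z ∈ cyl (frontier Ω) (Icc 0 T)) : dt Ω T u z = 0 := by
  have h1 := hasDerivWithinAt_time (hsol.1.differentiableOn (by norm_num))
    (frontier_subset_closure hz.1) hz.2
  have h2 : HasDerivWithinAt (fun s => u (pair (xpart z) s)) 0 (Icc 0 T) (tpart z) :=
    (hasDerivWithinAt_const _ _ (0 : ℝ)).congr
      (fun s hs => hsol.2.2.2.2 _ (pair_mem_cyl.2 ⟨hz.1, hs⟩))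
      (hsol.2.2.2.2 _ (pair_mem_cyl.2 hz))
  have h3 := (uniqueDiffOn_Icc hT).uniqueDiffWithinAt hz.2 |>.eq_deriv _ h1 h2
  rwa [pair_xpart_tpart] at h3

/-- The integral of `g` over the set that is partitioned, as a sum over the faces. -/
def faceIntegral {Λ : Set (Eucl (d + 1))} (P : CubePartition d Λ) (g : Eucl (d + 1) → ℝ) : ℝ :=
  ∑ m, ∫ y in Metric.ball (P.trace m) P.half, g (ins (P.normal m) (P.level m) y)

/-- Each face has exactly one normal, so summing the bounds over the spatial directions counts every
face once and loses no factor `d`. -/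
lemma sum_abs_integral_dx_le (hL : IsLipschitzDomain Ω) (hT : 0 < T) (S : TrainingSet Ω T)
    {p : Eucl (d + 1) → ℝ} {q : Fin d → Eucl (d + 1) → ℝ} {G τ : ℝ}
    (hp : ContDiffOn ℝ 1 p (closedCyl Ω T)) (hq : ∀ i, ContDiffOn ℝ 1 (q i) (closedCyl Ω T))
    (hG : ∀ i, ∀ z ∈ cyl (frontier Ω) (Icc 0 T), |q i z| ≤ G) (hτ : τ ∈ Icc 0 T) :
    ∑ i, |∫ z in cyl Ω (Icc 0 τ), dx Ω T i (fun z => p z * q i z) z|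
      ≤ G * faceIntegral S.s (fun z => |p z|) := by
  have hmem : ∀ m, ∀ y ∈ Metric.ball (S.s.trace m) S.s.half,
      ins (S.s.normal m) (S.s.level m) y ∈ cyl (frontier Ω) (Icc 0 T) := fun m y hy => by
    have := S.s.ins_mem_closure m (Metric.ball_subset_closedBall hy)
    rwa [isClosed_lateral.closure_eq] at this
  have hpc : ContinuousOn p (cyl (frontier Ω) (Icc 0 T)) := hp.continuousOn.mono cyl_frontier_subset
  have hqc : ∀ i, ContinuousOn (q i) (cyl (frontier Ω) (Icc 0 T)) := fun i =>
    (hq i).continuousOn.mono cyl_frontier_subset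
  set X : Fin S.s.M → ℝ := fun m => ∫ y in Metric.ball (S.s.trace m) S.s.half,
    |p (ins (S.s.normal m) (S.s.level m) y)| with hX
  -- The sign of `G` is read off at a boundary midpoint, so the case without faces is separate.
  rcases isEmpty_or_nonempty (Fin S.s.M) with hM | ⟨⟨m₀⟩⟩
  · have h0 : ∀ i : Fin d, |∫ z in cyl Ω (Icc 0 τ), dx Ω T i (fun z => p z * q i z) z| ≤ 0 := by
      intro i
      refine (abs_integral_pd_le hL hT S.pde S.s (Fin.castSucc_lt_last i).ne
        (hp.mul (hq i)) hτ).trans (le_of_eq ?_)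
      exact Finset.sum_eq_zero fun m _ => hM.elim m
    refine (Finset.sum_le_sum fun i _ => h0 i).trans (le_of_eq ?_)
    simp [faceIntegral]
  have hterm : ∀ i : Fin d, |∫ z in cyl Ω (Icc 0 τ), dx Ω T i (fun z => p z * q i z) z|
      ≤ ∑ m ∈ Finset.univ.filter (fun m => S.s.normal m = i.castSucc), G * X m := by
    intro i
    refine (abs_integral_pd_le hL hT S.pde S.s (Fin.castSucc_lt_last i).ne
        (hp.mul (hq i)) hτ).trans (Finset.sum_le_sum fun m _ => ?_)
    rw [hX, ← integral_const_mul]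
    refine setIntegral_mono_on (S.s.integrableOn_face isClosed_lateral (hpc.mul (hqc i)).abs m)
      ((S.s.integrableOn_face isClosed_lateral hpc.abs m).const_mul G) measurableSet_ball
      fun y hy => ?_
    rw [abs_mul, mul_comm]
    exact mul_le_mul_of_nonneg_right (hG i _ (hmem m y hy)) (abs_nonneg _)
  refine (Finset.sum_le_sum fun i _ => hterm i).trans ?_
  have hG0 : 0 ≤ G ∨ d = 0 := by
    rcases Nat.eq_zero_or_pos d with h | h
    · exact Or.inr h
    · exact Or.inl ((abs_nonneg _).trans (hG ⟨0, h⟩ _ (S.s.center_mem m₀)))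
  have hsum : ∑ i : Fin (d + 1), ∑ m ∈ Finset.univ.filter (fun m => S.s.normal m = i), G * X m
      = G * faceIntegral S.s (fun z => |p z|) := by
    rw [Finset.sum_fiberwise, ← Finset.mul_sum, faceIntegral]
  -- The extra summand, for faces orthogonal to time, is empty.
  rw [← hsum, Fin.sum_univ_castSucc]
  refine le_add_of_nonneg_right (Finset.sum_nonneg fun m hm => ?_)
  exact absurd (Finset.mem_filter.1 hm).2 (S.s.normal_ne_last hL.1 m)

lemma surfaceArea_nonneg : 0 ≤ surfaceArea Ω := ENNReal.toReal_nonneg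

lemma faceIntegral_abs_le (hd : 1 ≤ d) (hL : IsLipschitzDomain Ω) (hT : 0 < T)
    (P : CubePartition d (cyl (frontier Ω) (Icc 0 T))) {g : Eucl (d + 1) → ℝ}
    (hg : ContinuousOn g (cyl (frontier Ω) (Icc 0 T))) :
    faceIntegral P (fun z => |g z|) ≤ √(T * surfaceArea Ω) * √(faceIntegral P (fun z => g z ^ 2)) :=
  (P.sum_integral_abs_face_le isClosed_lateral hg).trans
    (mul_le_mul_of_nonneg_right (Real.sqrt_le_sqrt (P.card_mul_pow_le hd hL.1 hT))
      (Real.sqrt_nonneg _))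

lemma sqrt_add_le (x y : ℝ) : √(x + y) ≤ √x + √y := by
  have h : ∀ x : ℝ, x ≤ √x ^ 2 := fun x => by
    rcases le_total 0 x with hx | hx
    · rw [Real.sq_sqrt hx]
    · exact hx.trans (sq_nonneg _)
  exact Real.sqrt_le_iff.2 ⟨by positivity,
    by nlinarith [h x, h y, mul_nonneg (Real.sqrt_nonneg x) (Real.sqrt_nonneg y)]⟩

/-- The constant of the midpoint rule for a set of dimension `n` and measure `V`. -/
def midpointConst (n : ℕ) (V : ℝ) : ℝ := (n : ℝ) ^ 2 / 4 * V ^ (1 + 2 / (n : ℝ))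

lemma midpointConst_nonneg {n : ℕ} {V : ℝ} (hV : 0 ≤ V) : 0 ≤ midpointConst n V := by
  unfold midpointConst
  positivity

lemma faceIntegral_le_quad (hd : 1 ≤ d) (hL : IsLipschitzDomain Ω) (hT : 0 < T)
    (P : CubePartition d (cyl (frontier Ω) (Icc 0 T))) {g : Eucl (d + 1) → ℝ} {B : ℝ}
    (hg : ContDiffOn ℝ 2 g (closedCyl Ω T)) (hB0 : 0 ≤ B)
    (hB : DerivBound (closedCyl Ω T) (cyl (frontier Ω) (Icc 0 T)) 2 B g) :
    faceIntegral P g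
      ≤ P.quad g + midpointConst d (T * surfaceArea Ω) * B * (P.M : ℝ) ^ (-2 / (d : ℝ)) := by
  refine (P.sum_integral_face_le isClosed_lateral (uniqueDiffOn_closedCyl hL hT)
    cyl_frontier_subset hg hB0 hB).trans ?_
  have hN := P.N_pos
  have h1 := rate_le (n := d) (by omega) (by positivity : 0 < 1 / (P.N : ℝ))
    (P.card_mul_pow_le hd hL.1 hT)
  have h2 := mul_le_mul_of_nonneg_left h1 (by positivity : 0 ≤ (d : ℝ) ^ 2 / 4 * B)
  rw [add_le_add_iff_left]
  refine h2.trans (le_of_eq ?_)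
  unfold midpointConst
  ring

/-- The boundary residual enters the energy estimate unsquared, so the midpoint error appears under
a square root and the rate drops to M_s^{-1/d}. -/
lemma sqrt_faceIntegral_dt_sq_le (hd : 1 ≤ d) (hL : IsLipschitzDomain Ω) (hT : 0 < T)
    (S : TrainingSet Ω T) (hv : ContDiffOn ℝ 4 v (closedCyl Ω T)) :
    √(faceIntegral S.s (fun z => dt Ω T v z ^ 2))
      ≤ const4 Ω T v (midpointConst d (T * surfaceArea Ω)) * (S.s.M : ℝ) ^ (-1 / (d : ℝ))
        + √(trainSutSq v S) := by
  have hS := uniqueDiffOn_closedCyl hL hT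
  obtain ⟨B, hB⟩ := exists_derivBound_of_isCompact (m := 3) hS (isCompact_closedCyl hL T)
    (hv.of_le (by norm_num))
  obtain ⟨h1, h2⟩ := dt_sq_regular hL hT hv hB
  have h3 := faceIntegral_le_quad hd hL hT S.s h1 (cNormOn_nonneg _ _ _ _)
    (h2.mono le_rfl le_rfl cyl_frontier_subset).derivBound_cNormOn
  refine (Real.sqrt_le_sqrt h3).trans ?_
  rw [add_comm, ← trainSutSq]
  refine (sqrt_add_le _ _).trans ?_
  refine add_le_add (le_of_eq ?_) le_rfl
  rw [Real.sqrt_mul (mul_nonneg (midpointConst_nonneg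
    (mul_nonneg hT.le surfaceArea_nonneg)) (cNormOn_nonneg _ _ _ _)), const4]
  congr 1
  rw [show (-2 / (d : ℝ)) = (-1 / (d : ℝ)) * (2 : ℕ) by push_cast; ring,
    Real.rpow_mul_natCast (by positivity), Real.sqrt_sq (by positivity)]

end Boundary

/-! ### Grönwall's inequality and the error bound -/

section Gronwall

/-- Grönwall's inequality in integral form, integrated once more. -/
lemma integral_le_of_le_add_integral {s : ℝ → ℝ} {A κ T : ℝ} (hT : 0 < T) (hA : 0 ≤ A) (hκ : 0 ≤ κ)
    (hs : ContinuousOn s (Icc 0 T)) (hs0 : ∀ t ∈ Icc 0 T, 0 ≤ s t)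
    (h : ∀ τ ∈ Icc 0 T, s τ ≤ A + κ * ∫ t in Icc 0 τ, s t) :
    ∫ t in Icc 0 T, s t ≤ A * T * Real.exp (T * κ) := by
  -- Extending `s` by its values at the ends makes the integral differentiable everywhere.
  set s' : ℝ → ℝ := fun t => s (max 0 (min t T)) with hs'
  have hmem : ∀ t, max 0 (min t T) ∈ Icc 0 T := fun t =>
    ⟨le_max_left _ _, max_le hT.le (min_le_right _ _)⟩
  have heq : ∀ t ∈ Icc 0 T, s' t = s t := fun t ht => by
    simp only [hs', min_eq_left ht.2, max_eq_right ht.1]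
  have hcont : Continuous s' := hs.comp_continuous (by fun_prop) hmem
  have hint : ∀ τ ∈ Icc 0 T, ∫ t in Icc 0 τ, s t = ∫ t in (0 : ℝ)..τ, s' t := fun τ hτ => by
    rw [intervalIntegral.integral_of_le hτ.1, ← integral_Icc_eq_integral_Ioc]
    exact setIntegral_congr_fun measurableSet_Icc
      fun t ht => (heq t ⟨ht.1, ht.2.trans hτ.2⟩).symm
  set F : ℝ → ℝ := fun τ => A + κ * ∫ t in (0 : ℝ)..τ, s' t with hF
  have hder : ∀ τ, HasDerivAt F (κ * s' τ) τ := fun τ =>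
    ((hcont.integral_hasStrictDerivAt 0 τ).hasDerivAt.const_mul κ).const_add A
  have hsF : ∀ τ ∈ Icc 0 T, s τ ≤ F τ := fun τ hτ => by
    rw [hF]
    simp only
    rw [← hint τ hτ]
    exact h τ hτ
  have hF0 : ∀ τ ∈ Icc 0 T, 0 ≤ F τ := fun τ hτ => (hs0 τ hτ).trans (hsF τ hτ)
  have key := norm_le_gronwallBound_of_norm_deriv_right_le (f := F) (f' := fun τ => κ * s' τ)
    (δ := A) (K := κ) (ε := 0) (a := 0) (b := T)
    (fun τ _ => (hder τ).continuousAt.continuousWithinAt) (fun τ _ => (hder τ).hasDerivWithinAt)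
    (by simp [hF, abs_of_nonneg hA]) (fun τ hτ => by
      have hτ' := Ico_subset_Icc_self hτ
      rw [heq τ hτ', Real.norm_eq_abs, Real.norm_eq_abs, abs_of_nonneg (hF0 τ hτ'),
        abs_of_nonneg (mul_nonneg hκ (hs0 τ hτ')), add_zero]
      exact mul_le_mul_of_nonneg_left (hsF τ hτ') hκ)
  have hbound : ∀ τ ∈ Icc 0 T, s τ ≤ A * Real.exp (T * κ) := by
    intro τ hτ
    have h1 := key τ hτ
    rw [gronwallBound_ε0, Real.norm_eq_abs, sub_zero] at h1
    refine (hsF τ hτ).trans ((le_abs_self _).trans (h1.trans ?_))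
    refine mul_le_mul_of_nonneg_left (Real.exp_le_exp.2 ?_) hA
    rw [mul_comm]
    exact mul_le_mul_of_nonneg_right hτ.2 hκ
  calc ∫ t in Icc 0 T, s t ≤ ∫ t in Icc 0 T, A * Real.exp (T * κ) :=
        setIntegral_mono_on (hs.integrableOn_compact isCompact_Icc)
          (integrableOn_const (by simp)) measurableSet_Icc
          hbound
    _ = _ := by
        rw [setIntegral_const, measureReal_def, Real.volume_Icc, sub_zero,
          ENNReal.toReal_ofReal hT.le, smul_eq_mul]
        ring

/-- Expanding ∫ (τ g - I)² ≥ 0 with I = ∫ g gives τ (τ ∫ g² - I²) ≥ 0. -/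
lemma sq_integral_Icc_le {g : ℝ → ℝ} {τ : ℝ} (hτ : 0 ≤ τ) (hg : ContinuousOn g (Icc 0 τ)) :
    (∫ t in Icc 0 τ, g t) ^ 2 ≤ τ * ∫ t in Icc 0 τ, g t ^ 2 := by
  rcases hτ.eq_or_lt with rfl | hτ0
  · simp
  set I := ∫ t in Icc 0 τ, g t with hI
  have i1 : IntegrableOn g (Icc 0 τ) := hg.integrableOn_compact isCompact_Icc
  have i2 : IntegrableOn (fun t => g t ^ 2) (Icc 0 τ) :=
    (hg.pow 2).integrableOn_compact isCompact_Icc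
  have i3 : IntegrableOn (fun _ : ℝ => I ^ 2) (Icc 0 τ) := by simp
  have h0 : 0 ≤ ∫ t in Icc 0 τ, (τ * g t - I) ^ 2 := integral_nonneg fun t => sq_nonneg _
  have h1 : ∫ t in Icc 0 τ, (τ * g t - I) ^ 2
      = τ ^ 2 * (∫ t in Icc 0 τ, g t ^ 2) - 2 * τ * I * I + τ * I ^ 2 := by
    have e : ∀ t, (τ * g t - I) ^ 2 = τ ^ 2 * g t ^ 2 - 2 * τ * I * g t + I ^ 2 := fun t => by ring
    have i4 : IntegrableOn (fun t => τ ^ 2 * g t ^ 2 - 2 * τ * I * g t) (Icc 0 τ) :=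
      (i2.const_mul _).sub (i1.const_mul _)
    simp only [e]
    rw [integral_add i4 i3, integral_sub (i2.const_mul _) (i1.const_mul _), integral_const_mul,
      integral_const_mul, setIntegral_const, measureReal_def, Real.volume_Icc, sub_zero,
      ENNReal.toReal_ofReal hτ, smul_eq_mul]
  rw [h1] at h0
  by_contra! hlt
  nlinarith [mul_lt_mul_of_pos_left hlt hτ0]

variable {d : ℕ} {Ω : Set (Eucl d)} {T τ : ℝ} {w g : Eucl (d + 1) → ℝ}

/-- The factor 4√T holds for two different reasons. If √T ≤ 2, then w(τ) = w(0) + ∫ w_t and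
Cauchy–Schwarz give the factor 2τ ≤ 4√T. If √T ≥ 2, the derivative 2 w w_t of w² is at most w² +
w_t², which gives the factor 1. -/
lemma sq_le_initial_add_integral (hL : IsLipschitzDomain Ω) (hT : 0 < T)
    (hw : ContDiffOn ℝ 1 w (closedCyl Ω T)) {x : Eucl d} (hx : x ∈ closure Ω) (hτ : τ ∈ Icc 0 T) :
    w (pair x τ) ^ 2 ≤ 4 * w (pair x 0) ^ 2
      + 4 * √T * ∫ t in Icc 0 τ, (w (pair x t) ^ 2 + dt Ω T w (pair x t) ^ 2) := by
  have hS := uniqueDiffOn_closedCyl hL hT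
  have hsub : Icc 0 τ ⊆ Icc 0 T := Icc_subset_Icc_right hτ.2
  have c0 : ContinuousOn (fun t => w (pair x t)) (Icc 0 τ) :=
    (continuousOn_time hw.continuousOn hx).mono hsub
  have c1 : ContinuousOn (fun t => dt Ω T w (pair x t)) (Icc 0 τ) :=
    (continuousOn_time (contDiffOn_pd (k := 0) hw hS (by norm_num) _).continuousOn hx).mono hsub
  have i0 : IntegrableOn (fun t => w (pair x t) ^ 2) (Icc 0 τ) :=
    (c0.pow 2).integrableOn_compact isCompact_Icc
  have i1 : IntegrableOn (fun t => dt Ω T w (pair x t) ^ 2) (Icc 0 τ) :=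
    (c1.pow 2).integrableOn_compact isCompact_Icc
  have n0 : 0 ≤ ∫ t in Icc 0 τ, w (pair x t) ^ 2 := integral_nonneg fun t => sq_nonneg _
  have n1 : 0 ≤ ∫ t in Icc 0 τ, dt Ω T w (pair x t) ^ 2 := integral_nonneg fun t => sq_nonneg _
  rw [integral_add i0 i1]
  have hsq : √T ^ 2 = T := Real.sq_sqrt hT.le
  have hs0 : 0 ≤ √T := Real.sqrt_nonneg T
  rcases le_total (√T) 2 with h | h
  · have h1 := integral_time hL hT hw hx hτ
    have h2 := sq_integral_Icc_le hτ.1 c1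
    have h3 : w (pair x τ) = w (pair x 0) + ∫ t in Icc 0 τ, dt Ω T w (pair x t) := by linarith
    have h4 : 2 * τ ≤ 4 * √T := by nlinarith [hτ.2]
    rw [h3]
    nlinarith [sq_nonneg (w (pair x 0) - ∫ t in Icc 0 τ, dt Ω T w (pair x t)),
      mul_le_mul_of_nonneg_right h4 n1, mul_nonneg hs0 n0, sq_nonneg (w (pair x 0))]
  · have h1 := integral_time hL hT (hw.mul hw) hx hτ
    have h2 : ∫ t in Icc 0 τ, dt Ω T (fun z => w z * w z) (pair x t)
        ≤ ∫ t in Icc 0 τ, (w (pair x t) ^ 2 + dt Ω T w (pair x t) ^ 2) := by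
      have c2 : ContinuousOn (dt Ω T (fun z => w z * w z)) (closedCyl Ω T) :=
        (contDiffOn_pd (k := 0) (hw.mul hw) hS (by norm_num) _).continuousOn
      refine setIntegral_mono_on (((continuousOn_time c2 hx).mono hsub).integrableOn_compact
        isCompact_Icc) (i0.add i1) measurableSet_Icc fun t ht => ?_
      have hd := hw.differentiableOn (by norm_num)
      rw [dt, pd_mul hS (pair_mem_cyl.2 ⟨hx, hsub ht⟩) hd hd, ← dt]
      nlinarith [sq_nonneg (w (pair x t) - dt Ω T w (pair x t))]
    rw [integral_add i0 i1] at h2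
    nlinarith [sq_nonneg (w (pair x 0)), mul_nonneg hs0 n0, mul_nonneg hs0 n1,
      mul_le_mul_of_nonneg_right h n0, mul_le_mul_of_nonneg_right h n1]

lemma continuousOn_integral_space (hL : IsLipschitzDomain Ω)
    (hg : ContinuousOn g (closedCyl Ω T)) :
    ContinuousOn (fun t => ∫ x in Ω, g (pair x t)) (Icc 0 T) := by
  obtain ⟨B, hB⟩ := (isCompact_closedCyl hL T).exists_bound_of_continuousOn hg
  refine continuousOn_of_dominated (bound := fun _ => B)
    (fun t ht => (integrableOn_space hL hg ht).aestronglyMeasurable)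
    (fun t ht => (ae_restrict_iff' hL.1.measurableSet).2 (Filter.Eventually.of_forall
      fun x hx => hB _ (pair_mem_closedCyl hx ht))) ?_
    ((ae_restrict_iff' hL.1.measurableSet).2 (Filter.Eventually.of_forall
      fun x hx => continuousOn_time hg (subset_closure hx)))
  exact integrableOn_const hL.2.2.1.measure_lt_top.ne

lemma integral_sq_le (hL : IsLipschitzDomain Ω) (hT : 0 < T)
    (hw : ContDiffOn ℝ 1 w (closedCyl Ω T)) (hτ : τ ∈ Icc 0 T) :
    ∫ x in Ω, w (pair x τ) ^ 2 ≤ 4 * (∫ x in Ω, w (pair x 0) ^ 2)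
      + 4 * √T * ∫ z in cyl Ω (Icc 0 τ), (w z ^ 2 + dt Ω T w z ^ 2) := by
  have hS := uniqueDiffOn_closedCyl hL hT
  have c0 : ContinuousOn (fun z => w z ^ 2) (closedCyl Ω T) := hw.continuousOn.pow 2
  have c1 : ContinuousOn (fun z => w z ^ 2 + dt Ω T w z ^ 2) (closedCyl Ω T) :=
    c0.add ((contDiffOn_pd (k := 0) hw hS (by norm_num) _).continuousOn.pow 2)
  have i0 := integrableOn_space hL c0 ⟨le_rfl, hT.le⟩
  have hz := integrableOn_cyl hL c1 hτ.2
  have i1 : IntegrableOn (fun x => ∫ t in Icc 0 τ, (w (pair x t) ^ 2 + dt Ω T w (pair x t) ^ 2))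
      Ω := by
    have hpre : (fun p : Eucl d × ℝ => pair p.1 p.2) ⁻¹' cyl Ω (Icc 0 τ) = Ω ×ˢ Icc 0 τ := by
      ext p; simp
    have h2 := (measurePreserving_pair.integrableOn_comp_preimage measurableEmbedding_pair).2 hz
    rw [hpre, IntegrableOn, Measure.volume_eq_prod, ← Measure.prod_restrict] at h2
    exact h2.integral_prod_left
  rw [integral_cyl hz, ← integral_const_mul, ← integral_const_mul,
    ← integral_add (i0.const_mul 4) (i1.const_mul _)]
  exact setIntegral_mono_on (integrableOn_space hL c0 hτ) ((i0.const_mul 4).add (i1.const_mul _))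
    hL.1.measurableSet fun x hx => sq_le_initial_add_integral hL hT hw (subset_closure hx) hτ

end Gronwall

/-! ### The error estimate, with integrals and with midpoint rules. -/

section ErrorEstimate

variable {d : ℕ} {Ω : Set (Eucl d)} {T : ℝ} {D : WaveData d Ω T} {k : ℕ} {c r : ℝ}
  {u v : Eucl (d + 1) → ℝ}

/-- The error estimate in terms of integrals of the residuals. -/
lemma totalErrorSq_le_of_integrals (hL : IsLipschitzDomain Ω) (hT : 0 < T)
    (ha : ContDiffOn ℝ 2 D.a (closure Ω)) (hA : AssumptionA1 Ω D.a)
    (hf : AssumptionA2 Ω D.f k c r)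
    (hu : ContDiffOn ℝ 4 u (closedCyl Ω T)) (hsol : IsClassicalSolution D u)
    (hv : ContDiffOn ℝ 4 v (closedCyl Ω T)) {B : ℝ} (hB0 : 0 ≤ B)
    (hB : ∀ z ∈ closedCyl Ω T, ∀ i, |pd (closedCyl Ω T) i v z| ≤ B) (S : TrainingSet Ω T) :
    totalErrorSq Ω T u v ≤
      ((∫ x in Ω, resU1 D v x ^ 2) + (∫ x in Ω, resGradSq D v x)
        + (∫ z in cyl Ω (Icc 0 T), resPDE D v z ^ 2)
        + 2 * ((B + cNorm (closedCyl Ω T) 1 u) * faceIntegral S.s (fun z => |dt Ω T v z|))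
        + 4 * ∫ x in Ω, resU0 D v x ^ 2) * T
      * Real.exp (T * (1 + cHat Ω T c r u v + 4 * √T)) := by
  have hS := uniqueDiffOn_closedCyl hL hT
  set w : Eucl (d + 1) → ℝ := fun z => v z - u z with hw_def
  have hw : ContDiffOn ℝ 4 w (closedCyl Ω T) := hv.sub hu
  have hw2 : ContDiffOn ℝ 2 w (closedCyl Ω T) := hw.of_le (by norm_num)
  have hw1 : ContDiffOn ℝ 1 w (closedCyl Ω T) := hw.of_le (by norm_num)
  have du := hu.differentiableOn (n := 4) (by norm_num)
  have dv := hv.differentiableOn (n := 4) (by norm_num)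
  have hpd : ∀ i, ∀ z ∈ closedCyl Ω T, pd (closedCyl Ω T) i w z
      = pd (closedCyl Ω T) i v z - pd (closedCyl Ω T) i u z := fun i z hz => pd_sub hS hz dv du i
  have h0T : (0 : ℝ) ∈ Icc 0 T := ⟨le_rfl, hT.le⟩
  have hpw : ∀ i, ContDiffOn ℝ 1 (pd (closedCyl Ω T) i w) (closedCyl Ω T) := fun i =>
    contDiffOn_pd hw2 hS (by norm_num) i
  have cw : ContinuousOn (fun z => w z ^ 2) (closedCyl Ω T) := hw.continuousOn.pow 2
  have cp : ContinuousOn (fun z => dt Ω T w z ^ 2) (closedCyl Ω T) := (hpw _).continuousOn.pow 2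
  have hα := derivBound_cNorm_of_isCompact (m := 2) (uniqueDiffOn_closure hL)
    hL.2.2.1.isCompact_closure ha
  have hcomp := isCompact_closedCyl hL T
  have cR : ContinuousOn (fun z => resPDE D v z ^ 2) (closedCyl Ω T) :=
    (resPDE_regular hL hT ha hα hf hv
      (derivBound_cNorm_of_isCompact (m := 2) hS hcomp (hv.of_le (by norm_num)))
      (derivBound_cNorm_of_isCompact (m := 3) hS hcomp (hv.of_le (by norm_num)))
      (derivBound_cNorm_of_isCompact (m := 4) hS hcomp hv)).1.continuousOn.pow 2
  have hC := cHat_nonneg (Ω := Ω) (T := T) (u := u) (v := v) hf.2.1.le hf.2.2.2.2.1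
  set C := cHat Ω T c r u v with hC_def
  set G := B + cNorm (closedCyl Ω T) 1 u with hG_def
  have hG0 : 0 ≤ G := add_nonneg hB0 (cNorm_nonneg _ _ _)
  have hG : ∀ i : Fin d, ∀ z ∈ cyl (frontier Ω) (Icc 0 T), |dx Ω T i w z| ≤ G := by
    intro i z hz
    have hz' := cyl_frontier_subset hz
    rw [dx, hpd _ _ hz']
    refine (abs_sub _ _).trans (add_le_add (hB z hz' _) ?_)
    exact (derivBound_pd (m := 0) hS (hu.of_le (by norm_num)) Subset.rfl
      (derivBound_cNorm_of_isCompact (m := 1) hS hcomp (hu.of_le (by norm_num))) _).abs_le hz'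
  -- On the lateral boundary u_t = 0, so the trace of w_t is the boundary residual.
  have hface : faceIntegral S.s (fun z => |dt Ω T w z|) = faceIntegral S.s (fun z => |dt Ω T v z|) := by
    refine Finset.sum_congr rfl fun m _ => setIntegral_congr_fun measurableSet_ball fun y hy => ?_
    have hmem := S.s.ins_mem_closure m (Metric.ball_subset_closedBall hy)
    rw [isClosed_lateral.closure_eq] at hmem
    simp only
    rw [dt, hpd _ _ (cyl_frontier_subset hmem), ← dt, ← dt, hsol.dt_eq_zero hT hmem, sub_zero]
  have hE0 : ∫ x in Ω, energy Ω T w (pair x 0)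
      = (∫ x in Ω, resU1 D v x ^ 2) + ∫ x in Ω, resGradSq D v x := by
    have e1 : EqOn (fun x => resU1 D v x ^ 2) (fun x => dt Ω T w (pair x 0) ^ 2) Ω := fun x hx => by
      simp only [resU1, dt]
      rw [hpd _ _ (pair_mem_closedCyl hx h0T), ← hsol.2.2.2.1 x hx, dt]
    have e2 : EqOn (resGradSq D v) (fun x => ∑ i, dx Ω T i w (pair x 0) ^ 2) Ω := fun x hx => by
      refine Finset.sum_congr rfl fun i _ => ?_
      rw [pd_initial_eq hL hT hu hsol i hx]
      simp only [dx]
      rw [hpd _ _ (pair_mem_closedCyl hx h0T)]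
    rw [setIntegral_congr_fun hL.1.measurableSet e1, setIntegral_congr_fun hL.1.measurableSet e2]
    refine integral_add (integrableOn_space hL cp h0T)
      (integrableOn_space hL (g := fun z => ∑ i, dx Ω T i w z ^ 2) ?_ h0T)
    exact continuousOn_finsetSum _ fun i _ => (hpw _).continuousOn.pow 2
  have hU0 : ∫ x in Ω, w (pair x 0) ^ 2 = ∫ x in Ω, resU0 D v x ^ 2 :=
    setIntegral_congr_fun hL.1.measurableSet fun x hx => by
      simp only [resU0, hw_def, hsol.2.2.1 x hx]
  set A := (∫ x in Ω, resU1 D v x ^ 2) + (∫ x in Ω, resGradSq D v x)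
        + (∫ z in cyl Ω (Icc 0 T), resPDE D v z ^ 2)
        + 2 * (G * faceIntegral S.s (fun z => |dt Ω T v z|))
        + 4 * ∫ x in Ω, resU0 D v x ^ 2 with hA_def
  have hF0 : 0 ≤ faceIntegral S.s (fun z => |dt Ω T v z|) :=
    Finset.sum_nonneg fun m _ => integral_nonneg fun y => abs_nonneg _
  have n1 : 0 ≤ ∫ x in Ω, resU1 D v x ^ 2 := integral_nonneg fun x => sq_nonneg _
  have n2 : 0 ≤ ∫ x in Ω, resGradSq D v x :=
    integral_nonneg fun x => Finset.sum_nonneg fun i _ => sq_nonneg _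
  have n3 : 0 ≤ ∫ z in cyl Ω (Icc 0 T), resPDE D v z ^ 2 := integral_nonneg fun x => sq_nonneg _
  have n4 : 0 ≤ ∫ x in Ω, resU0 D v x ^ 2 := integral_nonneg fun x => sq_nonneg _
  have hA0 : 0 ≤ A := by positivity
  set s : ℝ → ℝ := fun t => ∫ x in Ω, (w (pair x t) ^ 2 + dt Ω T w (pair x t) ^ 2) with hs_def
  have hsint : ∀ τ ∈ Icc 0 T, ∫ z in cyl Ω (Icc 0 τ), (w z ^ 2 + dt Ω T w z ^ 2)
      = ∫ t in Icc 0 τ, s t := fun τ hτ =>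
    integral_cyl' (integrableOn_cyl hL (cw.add cp) hτ.2)
  -- The energy inequality bounds the half of `s` with w_t², the fundamental theorem in time bounds
  -- the half with w²; together they have the form required by Grönwall's inequality.
  have hmain : ∀ τ ∈ Icc 0 T, s τ ≤ A + (1 + C + 4 * √T) * ∫ t in Icc 0 τ, s t := by
    intro τ hτ
    have hm : MeasurableSet (cyl Ω (Icc 0 τ)) := measurableSet_cyl hL.1.measurableSet measurableSet_Icc
    have j0 := integrableOn_cyl hL cw hτ.2
    have j1 := integrableOn_cyl hL cp hτ.2
    have jR := integrableOn_cyl hL cR hτ.2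
    have h1 := integral_dt_sq_le hL hT hw2 hτ
    have h2 := sum_abs_integral_dx_le hL hT S (hpw (Fin.last d)) (fun i => hpw i.castSucc) hG hτ
    have h3 := integral_sq_le hL hT hw1 hτ
    have h4 : ∫ z in cyl Ω (Icc 0 τ), 2 * dt Ω T w z * (dt Ω T (dt Ω T w) z
          - ∑ i, dx Ω T i (dx Ω T i w) z)
        ≤ (∫ z in cyl Ω (Icc 0 τ), resPDE D v z ^ 2)
          + (1 + C) * (∫ z in cyl Ω (Icc 0 τ), dt Ω T w z ^ 2)
          + C * ∫ z in cyl Ω (Icc 0 τ), w z ^ 2 := by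
      have jj : IntegrableOn (fun z => resPDE D v z ^ 2 + (1 + C) * dt Ω T w z ^ 2)
        (cyl Ω (Icc 0 τ)) := jR.add (j1.const_mul _)
      rw [← integral_const_mul, ← integral_const_mul, ← integral_add jR (j1.const_mul _),
        ← integral_add jj (j0.const_mul _)]
      refine setIntegral_mono_on (integrableOn_cyl hL ?_ hτ.2) (jj.add (j0.const_mul _)) hm
        fun z hz => two_mul_source_le hL hT ha hA hf hu hsol hv ⟨hz.1, hz.2.1, hz.2.2.trans hτ.2⟩
      have h0 : ∀ i, ContinuousOn (pd (closedCyl Ω T) i (pd (closedCyl Ω T) i w))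
        (closedCyl Ω T) := fun i => (contDiffOn_pd (k := 0) (hpw i) hS (by norm_num) _).continuousOn
      exact (continuousOn_const.mul (hpw _).continuousOn).mul
        ((h0 _).sub (continuousOn_finsetSum _ fun i _ => h0 _))
    have h5 : ∫ z in cyl Ω (Icc 0 τ), resPDE D v z ^ 2
        ≤ ∫ z in cyl Ω (Icc 0 T), resPDE D v z ^ 2 :=
      setIntegral_mono_set (integrableOn_cyl hL cR le_rfl)
        (Filter.Eventually.of_forall fun z => sq_nonneg _)
        (LE.le.eventuallyLE fun z hz => ⟨hz.1, hz.2.1, hz.2.2.trans hτ.2⟩)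
    have h6 : s τ = (∫ x in Ω, w (pair x τ) ^ 2) + ∫ x in Ω, dt Ω T w (pair x τ) ^ 2 :=
      integral_add (integrableOn_space hL cw hτ) (integrableOn_space hL cp hτ)
    have h7 : ∫ t in Icc 0 τ, s t = (∫ z in cyl Ω (Icc 0 τ), w z ^ 2)
        + ∫ z in cyl Ω (Icc 0 τ), dt Ω T w z ^ 2 := by
      rw [← hsint τ hτ, integral_add j0 j1]
    have h8 : 0 ≤ ∫ z in cyl Ω (Icc 0 τ), w z ^ 2 := integral_nonneg fun x => sq_nonneg _
    rw [hsint τ hτ, hU0] at h3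
    have h2' : ∑ i, |∫ z in cyl Ω (Icc 0 τ), dx Ω T i (fun z => dt Ω T w z * dx Ω T i w z) z|
      ≤ G * faceIntegral S.s (fun z => |dt Ω T v z|) := hface ▸ h2
    rw [hE0] at h1
    have h9 : (1 + C) * (∫ z in cyl Ω (Icc 0 τ), dt Ω T w z ^ 2)
          + C * ∫ z in cyl Ω (Icc 0 τ), w z ^ 2 ≤ (1 + C) * ∫ t in Icc 0 τ, s t := by
      rw [h7]; nlinarith
    rw [h6]
    linarith
  have hfinal := integral_le_of_le_add_integral (s := s) hT hA0 (κ := 1 + C + 4 * √T) (by positivity)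
    (continuousOn_integral_space hL (cw.add cp))
    (fun t _ => integral_nonneg fun x => add_nonneg (sq_nonneg _) (sq_nonneg _)) hmain
  refine le_trans (le_of_eq ?_) hfinal
  rw [← hsint T ⟨hT.le, le_rfl⟩, integral_add (integrableOn_cyl hL cw le_rfl)
    (integrableOn_cyl hL cp le_rfl), totalErrorSq]
  congr 1
  · exact integral_congr_ae (Filter.Eventually.of_forall fun z => by simp only [sq_abs, hw_def])
  · refine setIntegral_congr_fun (measurableSet_cyl hL.1.measurableSet measurableSet_Icc)
      fun z hz => ?_
    simp only [sq_abs]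
    rw [dt, dt, dt, hpd _ _ ⟨subset_closure hz.1, hz.2⟩]

lemma integral_cyl_Icc_eq_Ioo {g : Eucl (d + 1) → ℝ} (hg : IntegrableOn g (cyl Ω (Icc 0 T))) :
    ∫ z in cyl Ω (Icc 0 T), g z = ∫ z in cyl Ω (Ioo 0 T), g z := by
  rw [integral_cyl' hg, integral_cyl' (hg.mono_set fun z hz => ⟨hz.1, Ioo_subset_Icc_self hz.2⟩),
    integral_Icc_eq_integral_Ioo]

/-- The error bound with the constants of the midpoint rule. -/
theorem totalErrorSq_le_errorBound (hd : 1 ≤ d) (hL : IsLipschitzDomain Ω) (hT : 0 < T)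
    (ha : ContDiffOn ℝ 2 D.a (closure Ω)) (hA : AssumptionA1 Ω D.a)
    (hf : AssumptionA2 Ω D.f k c r)
    (hu : ContDiffOn ℝ 4 u (closedCyl Ω T)) (hsol : IsClassicalSolution D u)
    (hv : ContDiffOn ℝ 4 v (closedCyl Ω T)) {B : ℝ} (hB0 : 0 ≤ B)
    (hB : ∀ z ∈ closedCyl Ω T, ∀ i, |pd (closedCyl Ω T) i v z| ≤ B) (S : TrainingSet Ω T)
    {Cpw : ℝ} (hP : 0 < Cpw) :
    totalErrorSq Ω T u v ≤ errorBound D v S u c r (midpointConst d (volume.real Ω))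
      (midpointConst (d + 1) (volume.real (cyl Ω (Ioo 0 T))))
      (midpointConst d (T * surfaceArea Ω)) Cpw B := by
  have hS := uniqueDiffOn_closedCyl hL hT
  have hcomp := isCompact_closedCyl hL T
  have hΩ := hL.1.uniqueDiffOn (𝕜 := ℝ)
  have hd0 : d ≠ 0 := by omega
  have hα := derivBound_cNorm_of_isCompact (m := 2) (uniqueDiffOn_closure hL)
    hL.2.2.1.isCompact_closure ha
  have bv : ∀ m : ℕ, m ≤ 4 → DerivBound (closedCyl Ω T) (closedCyl Ω T) m
      (cNorm (closedCyl Ω T) m v) v := fun m hm =>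
    derivBound_cNorm_of_isCompact hS hcomp (hv.of_le (by exact_mod_cast hm))
  have bu : ∀ m : ℕ, m ≤ 4 → DerivBound (closedCyl Ω T) (closedCyl Ω T) m
      (cNorm (closedCyl Ω T) m u) u := fun m hm =>
    derivBound_cNorm_of_isCompact hS hcomp (hu.of_le (by exact_mod_cast hm))
  obtain ⟨rP, bP⟩ := resPDE_regular hL hT ha hα hf hv (bv 2 (by norm_num)) (bv 3 (by norm_num))
    (bv 4 le_rfl)
  obtain ⟨r0, b0⟩ := resU0_regular hL hT hu hsol hv (bv 2 (by norm_num)) (bu 2 (by norm_num))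
  obtain ⟨r1, b1⟩ := resU1_regular hL hT hu hsol hv (bv 3 (by norm_num)) (bu 3 (by norm_num))
  obtain ⟨rG, bG⟩ := resGrad_regular hL hT hu hsol hv (bv 3 (by norm_num)) (bu 3 (by norm_num))
  have hfinΩ : volume Ω ≠ ⊤ := hL.2.2.1.measure_lt_top.ne
  have hbdd : Bornology.IsBounded (cyl Ω (Ioo 0 T)) := hcomp.isBounded.subset
    fun z hz => ⟨subset_closure hz.1, Ioo_subset_Icc_self hz.2⟩
  have hint : ∀ {g : Eucl d → ℝ} {C : ℝ}, ContDiffOn ℝ 2 g Ω → DerivBound Ω Ω 2 C g →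
      IntegrableOn g Ω := fun {g C} hg hC =>
    IntegrableOn.of_bound hfinΩ.lt_top
      (hg.continuousOn.aestronglyMeasurable hL.1.measurableSet)
      C ((ae_restrict_iff' hL.1.measurableSet).2 (Filter.Eventually.of_forall fun x hx => hC.abs_le hx))
  have hquad : ∀ {g : Eucl d → ℝ} {C : ℝ}, ContDiffOn ℝ 2 g Ω → DerivBound Ω Ω 2 C g →
      ∫ x in Ω, g x ≤ S.t.quad g + midpointConst d (volume.real Ω) * cNorm Ω 2 g
        * (S.t.M : ℝ) ^ (-2 / (d : ℝ)) := fun {g C} hg hC =>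
    S.t.integral_le_quad hd0 (interior_closure_eq hL) hfinΩ hΩ Subset.rfl hg
      (cNorm_nonneg _ _ _) hC.derivBound_cNormOn (hint hg hC)
  have q0 := hquad (r0.pow 2) (b0.sq hΩ Subset.rfl r0)
  have q1 := hquad (r1.pow 2) (b1.sq hΩ Subset.rfl r1)
  have qG := hquad rG bG
  have qP : ∫ z in cyl Ω (Icc 0 T), resPDE D v z ^ 2 ≤ trainPDESq D v S
      + const2 D v (midpointConst (d + 1) (volume.real (cyl Ω (Ioo 0 T))))
        * (S.pde.M : ℝ) ^ (-2 / ((d : ℝ) + 1)) := by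
    have hi := integrableOn_cyl hL (rP.pow 2).continuousOn le_rfl
    have hb := (bP.sq hS Subset.rfl rP).derivBound_cNormOn
    have hsub : cyl Ω (Ioo 0 T) ⊆ closedCyl Ω T :=
      fun z hz => ⟨subset_closure hz.1, Ioo_subset_Icc_self hz.2⟩
    have := S.pde.integral_le_quad (Nat.succ_ne_zero d) (interior_closure_cyl hL hT)
      hbdd.measure_lt_top.ne hS hsub (rP.pow 2) (cNormOn_nonneg _ _ _ _)
      (hb.mono le_rfl le_rfl hsub)
      (hi.mono_set fun z hz => ⟨hz.1, Ioo_subset_Icc_self hz.2⟩)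
    rw [integral_cyl_Icc_eq_Ioo hi]
    refine this.trans (le_of_eq ?_)
    rw [trainPDESq, const2, cNorm, midpointConst]
    push_cast
    rfl
  have hface : faceIntegral S.s (fun z => |dt Ω T v z|) ≤ √(T * surfaceArea Ω)
      * (const4 Ω T v (midpointConst d (T * surfaceArea Ω)) * (S.s.M : ℝ) ^ (-1 / (d : ℝ))
        + √(trainSutSq v S)) := by
    have hc : ContinuousOn (dt Ω T v) (cyl (frontier Ω) (Icc 0 T)) :=
      (contDiffOn_pd (k := 0) hv hS (by norm_num) _).continuousOn.mono cyl_frontier_subset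
    exact (faceIntegral_abs_le hd hL hT S.s hc).trans (mul_le_mul_of_nonneg_left
      (sqrt_faceIntegral_dt_sq_le hd hL hT S hv) (Real.sqrt_nonneg _))
  refine (totalErrorSq_le_of_integrals hL hT ha hA hf hu hsol hv hB0 hB S).trans ?_
  have hm1 : 1 ≤ max 1 (2 * Cpw ^ 2) := le_max_left _ _
  -- This is how the constants 4 and 4√T acquire the form with the Poincaré–Wirtinger constant: 2
  -- C_pw² · 2 / C_pw² = 4.
  have hm2 : 4 ≤ max 1 (2 * Cpw ^ 2) * (2 / Cpw ^ 2) := by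
    have h := mul_le_mul_of_nonneg_right (le_max_right 1 (2 * Cpw ^ 2))
      (by positivity : 0 ≤ 2 / Cpw ^ 2)
    refine le_trans (le_of_eq ?_) h
    field_simp
    norm_num
  have hC := cHat_nonneg (Ω := Ω) (T := T) (u := u) (v := v) hf.2.1.le hf.2.2.2.2.1
  have hκ : 1 + cHat Ω T c r u v + 4 * √T
      ≤ max 1 (2 * Cpw ^ 2) * (1 + cHat Ω T c r u v + 2 * √T / Cpw ^ 2) := by
    have h1 := mul_le_mul_of_nonneg_right hm1 (by positivity : 0 ≤ 1 + cHat Ω T c r u v)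
    have h2 := mul_le_mul_of_nonneg_right hm2 (Real.sqrt_nonneg T)
    calc _ ≤ max 1 (2 * Cpw ^ 2) * (1 + cHat Ω T c r u v)
          + max 1 (2 * Cpw ^ 2) * (2 / Cpw ^ 2) * √T := by linarith
      _ = _ := by ring
  have hG0 : 0 ≤ B + cNorm (closedCyl Ω T) 1 u := add_nonneg hB0 (cNorm_nonneg _ _ _)
  have hF0 : 0 ≤ faceIntegral S.s (fun z => |dt Ω T v z|) :=
    Finset.sum_nonneg fun m _ => integral_nonneg fun y => abs_nonneg _
  have n1 : 0 ≤ ∫ x in Ω, resU1 D v x ^ 2 := integral_nonneg fun x => sq_nonneg _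
  have n2 : 0 ≤ ∫ x in Ω, resGradSq D v x :=
    integral_nonneg fun x => Finset.sum_nonneg fun i _ => sq_nonneg _
  have n3 : 0 ≤ ∫ z in cyl Ω (Icc 0 T), resPDE D v z ^ 2 := integral_nonneg fun x => sq_nonneg _
  have n4 : 0 ≤ ∫ x in Ω, resU0 D v x ^ 2 := integral_nonneg fun x => sq_nonneg _
  have hAle : (∫ x in Ω, resU1 D v x ^ 2) + (∫ x in Ω, resGradSq D v x)
        + (∫ z in cyl Ω (Icc 0 T), resPDE D v z ^ 2)
        + 2 * ((B + cNorm (closedCyl Ω T) 1 u) * faceIntegral S.s (fun z => |dt Ω T v z|))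
        + 4 * ∫ x in Ω, resU0 D v x ^ 2
      ≤ constM D v S u (midpointConst d (volume.real Ω))
      (midpointConst (d + 1) (volume.real (cyl Ω (Ioo 0 T))))
      (midpointConst d (T * surfaceArea Ω)) Cpw B := by
    have hface' := mul_le_mul_of_nonneg_left hface hG0
    have q0' := mul_le_mul_of_nonneg_left q0 (by positivity : 0 ≤ 2 / Cpw ^ 2)
    have h4 := mul_le_mul_of_nonneg_right hm2 n4
    have hx : 0 ≤ (∫ x in Ω, resU1 D v x ^ 2) + (∫ x in Ω, resGradSq D v x)
        + (∫ z in cyl Ω (Icc 0 T), resPDE D v z ^ 2)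
        + 2 * ((B + cNorm (closedCyl Ω T) 1 u) * faceIntegral S.s (fun z => |dt Ω T v z|)) := by
      positivity
    calc _ ≤ max 1 (2 * Cpw ^ 2) * ((∫ x in Ω, resU1 D v x ^ 2) + (∫ x in Ω, resGradSq D v x)
        + (∫ z in cyl Ω (Icc 0 T), resPDE D v z ^ 2)
        + 2 * ((B + cNorm (closedCyl Ω T) 1 u) * faceIntegral S.s (fun z => |dt Ω T v z|)))
        + max 1 (2 * Cpw ^ 2) * (2 / Cpw ^ 2) * ∫ x in Ω, resU0 D v x ^ 2 :=
          add_le_add (le_mul_of_one_le_left hx hm1) h4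
      _ = max 1 (2 * Cpw ^ 2) * ((∫ x in Ω, resU1 D v x ^ 2) + (∫ x in Ω, resGradSq D v x)
        + (∫ z in cyl Ω (Icc 0 T), resPDE D v z ^ 2)
        + 2 * ((B + cNorm (closedCyl Ω T) 1 u) * faceIntegral S.s (fun z => |dt Ω T v z|))
        + 2 / Cpw ^ 2 * ∫ x in Ω, resU0 D v x ^ 2) := by ring
      _ ≤ _ := by
        refine mul_le_mul_of_nonneg_left ?_ (by linarith)
        rw [const1, const3, const5, trainU0Sq, trainU1Sq, trainGradSq]
        rw [show 2 * midpointConst d (volume.real Ω) / Cpw ^ 2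
          = 2 / Cpw ^ 2 * midpointConst d (volume.real Ω) by ring]
        linarith
  unfold errorBound
  have hc0 : 0 ≤ constM D v S u (midpointConst d (volume.real Ω))
      (midpointConst (d + 1) (volume.real (cyl Ω (Ioo 0 T))))
      (midpointConst d (T * surfaceArea Ω)) Cpw B := le_trans (by positivity) hAle
  gcongr

end ErrorEstimate

/-! ### The order of the error bound -/

section Order

variable {d : ℕ} {Ω : Set (Eucl d)} {T : ℝ} {D : WaveData d Ω T} {k : ℕ} {c r : ℝ}
  {u v : Eucl (d + 1) → ℝ}

lemma CubePartition.quad_nonneg {k n : ℕ} {Λ : Set (Eucl n)} (P : CubePartition k Λ)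
    {g : Eucl n → ℝ} (hg : ∀ z, 0 ≤ g z) : 0 ≤ P.quad g :=
  mul_nonneg (by positivity) (Finset.sum_nonneg fun m _ => hg _)

lemma cHat_le (hL : IsLipschitzDomain Ω) (hT : 0 < T) (hc : 0 ≤ c) (hr : 1 ≤ r)
    (hu : ContDiffOn ℝ 4 u (closedCyl Ω T)) {A : ℝ} (hA0 : 0 ≤ A)
    (hA : ∀ z ∈ closedCyl Ω T, |v z| ≤ A) :
    cHat Ω T c r u v ≤ 2 ^ (r - 1) * c * (cNorm (closedCyl Ω T) 0 u ^ r
      + 1 / (r + 1) * (A + cNorm (closedCyl Ω T) 0 u) ^ r) := by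
  have h0 := cNorm_nonneg (closedCyl Ω T) 0 u
  have h1 := derivBound_cNorm_of_isCompact (m := 0) (uniqueDiffOn_closedCyl hL hT)
    (isCompact_closedCyl hL T) (hu.of_le (by norm_num))
  have h2 : cNorm (closedCyl Ω T) 0 (fun z => v z - u z) ≤ A + cNorm (closedCyl Ω T) 0 u :=
    DerivBound.cNormOn_le (derivBound_zero fun z hz =>
      (abs_sub _ _).trans (add_le_add (hA z hz) (h1.abs_le hz))) (by positivity)
  have h3 := cNorm_nonneg (closedCyl Ω T) 0 (fun z => v z - u z)
  unfold cHat
  gcongr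

/-- The error bound is of the order of the training error and the midpoint rule, uniformly over
functions with bounded derivatives. -/
lemma exists_errorBound_le (hL : IsLipschitzDomain Ω) (hT : 0 < T)
    (ha : ContDiffOn ℝ 2 D.a (closure Ω)) (hf : AssumptionA2 Ω D.f k c r)
    (hu : ContDiffOn ℝ 4 u (closedCyl Ω T)) (hsol : IsClassicalSolution D u)
    {CΩ CΩT CΓ Cpw A B : ℝ} (hCΩ : 0 ≤ CΩ) (hCΩT : 0 ≤ CΩT) (hCΓ : 0 ≤ CΓ) (hA : 0 ≤ A)
    (hB : 0 ≤ B) :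
    ∃ K, 0 ≤ K ∧ ∀ v, ContDiffOn ℝ 4 v (closedCyl Ω T) →
      DerivBound (closedCyl Ω T) (closedCyl Ω T) 4 A v → ∀ S : TrainingSet Ω T,
      errorBound D v S u c r CΩ CΩT CΓ Cpw B
        ≤ K * (trainSq D v S + √(trainSutSq v S) + quadRate S) := by
  have hS := uniqueDiffOn_closedCyl hL hT
  have hcomp := isCompact_closedCyl hL T
  have hα := derivBound_cNorm_of_isCompact (m := 2) (uniqueDiffOn_closure hL)
    hL.2.2.1.isCompact_closure ha
  have hc0 := hf.2.1.le
  have hr := hf.2.2.2.2.1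
  set U := cNorm (closedCyl Ω T) 4 u with hU
  have hU0 : 0 ≤ U := cNorm_nonneg _ _ _
  have bu : DerivBound (closedCyl Ω T) (closedCyl Ω T) 4 U u :=
    derivBound_cNorm_of_isCompact hS hcomp hu
  set α := cNorm (closure Ω) 2 D.a
  set X₁ := 8 * CΩ * (A ^ 2 + U ^ 2)
  set X₂ := CΩT * (12 * (((d + 1) * A) ^ 2 + 16 * (α * A) ^ 2 + 25 * (c * A ^ (r + 1)) ^ 2))
  set X₃ := 8 * d * CΩ * (A ^ 2 + U ^ 2)
  set X₄ := 2 * √CΓ * A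
  set X₅ := 16 * CΩ / Cpw ^ 2 * (A ^ 2 + U ^ 2)
  set H := 2 * √(T * surfaceArea Ω) * (B + cNorm (closedCyl Ω T) 1 u)
  set Y := 2 / Cpw ^ 2
  set Ĥ := 2 ^ (r - 1) * c * (cNorm (closedCyl Ω T) 0 u ^ r
      + 1 / (r + 1) * (A + cNorm (closedCyl Ω T) 0 u) ^ r)
  set m := max 1 (2 * Cpw ^ 2)
  have hm : 0 ≤ m := zero_le_one.trans (le_max_left _ _)
  have hH : 0 ≤ H := mul_nonneg (by positivity) (add_nonneg hB (cNorm_nonneg _ _ _))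
  have hY : 0 ≤ Y := by positivity
  -- Every power of M, every squared training error in `constM` and the square root are at most `Q`,
  -- so `K` simply collects their coefficients; the pair `X₄ + 1` comes from the boundary term.
  refine ⟨m * (X₁ + 1 + X₂ + 1 + X₃ + 1 + H * (X₄ + 1) + X₅ + Y) * T
    * Real.exp (T * (m * (1 + Ĥ + 2 * √T / Cpw ^ 2))), by positivity, fun v hv bv S => ?_⟩
  have b2 := bv.mono (m' := 2) (by norm_num) le_rfl Subset.rfl
  have b3 := bv.mono (m' := 3) (by norm_num) le_rfl Subset.rfl
  have u2 := bu.mono (m' := 2) (by norm_num) le_rfl Subset.rfl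
  have u3 := bu.mono (m' := 3) (by norm_num) le_rfl Subset.rfl
  have l1 := const1_le hL hT hu hsol hv b3 u3 hCΩ
  have l2 := const2_le hL hT ha hα hf hv b2 b3 bv hCΩT
  have l3 := const3_le hL hT hu hsol hv b3 u3 hCΩ
  have l4 := const4_le hL hT hv hA b3 hCΓ
  have l5 := const5_le (Cpw := Cpw) hL hT hu hsol hv b2 u2 hCΩ
  have lH := cHat_le hL hT hc0 hr hu hA (fun z hz => bv.abs_le hz)
  set Q := trainSq D v S + √(trainSutSq v S) + quadRate S with hQ
  have e1 : 0 ≤ trainPDESq D v S := S.pde.quad_nonneg fun _ => sq_nonneg _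
  have e2 : 0 ≤ trainSuSq v S := S.s.quad_nonneg fun _ => sq_nonneg _
  have e3 : 0 ≤ trainSutSq v S := S.s.quad_nonneg fun _ => sq_nonneg _
  have e4 : 0 ≤ trainU0Sq D v S := S.t.quad_nonneg fun _ => sq_nonneg _
  have e5 : 0 ≤ trainU1Sq D v S := S.t.quad_nonneg fun _ => sq_nonneg _
  have e6 : 0 ≤ trainGradSq D v S :=
    S.t.quad_nonneg fun _ => Finset.sum_nonneg fun _ _ => sq_nonneg _
  have e7 := Real.sqrt_nonneg (trainSutSq v S)
  have e8 : 0 ≤ (S.t.M : ℝ) ^ (-2 / (d : ℝ)) := by positivity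
  have e9 : 0 ≤ (S.pde.M : ℝ) ^ (-2 / ((d : ℝ) + 1)) := by positivity
  have e10 : 0 ≤ (S.s.M : ℝ) ^ (-1 / (d : ℝ)) := by positivity
  rw [trainSq, quadRate] at hQ
  have hQ0 : 0 ≤ Q := by rw [hQ]; positivity
  have hX : ∀ {x X y : ℝ}, x ≤ X → 0 ≤ X → 0 ≤ y → y ≤ Q → x * y ≤ X * Q :=
    fun h1 h2 h3 h4 => mul_le_mul h1 h4 h3 h2
  have hM : constM D v S u CΩ CΩT CΓ Cpw B
      ≤ m * (X₁ + 1 + X₂ + 1 + X₃ + 1 + H * (X₄ + 1) + X₅ + Y) * Q := by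
    have t1 := hX l1 (by positivity) e8 (by linarith)
    have t2 := hX l2 (by positivity) e9 (by linarith)
    have t3 := hX l3 (by positivity) e8 (by linarith)
    have t4 := hX l4 (by positivity) e10 (by linarith)
    have t5 := hX l5 (by positivity) e8 (by linarith)
    have t6 := hX (le_refl Y) hY e4 (by linarith)
    have t7 : H * (const4 Ω T v CΓ * (S.s.M : ℝ) ^ (-1 / (d : ℝ)) + √(trainSutSq v S))
        ≤ H * ((X₄ + 1) * Q) := by
      refine mul_le_mul_of_nonneg_left ?_ hH
      linarith
    unfold constM
    refine (mul_le_mul_of_nonneg_left ?_ hm).trans_eq (mul_assoc _ _ _).symm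
    linarith
  have hE : 0 ≤ m * (X₁ + 1 + X₂ + 1 + X₃ + 1 + H * (X₄ + 1) + X₅ + Y) * Q := by positivity
  unfold errorBound
  calc _ ≤ m * (X₁ + 1 + X₂ + 1 + X₃ + 1 + H * (X₄ + 1) + X₅ + Y) * Q * T
      * Real.exp (T * (m * (1 + Ĥ + 2 * √T / Cpw ^ 2))) := by gcongr
    _ = _ := by ring

end Order

/-! ### Removing the square root for a fixed network. -/

section FixedNetwork

variable {d : ℕ} {Ω : Set (Eucl d)} {T : ℝ} {D : WaveData d Ω T} {k : ℕ} {c r : ℝ}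
  {u v : Eucl (d + 1) → ℝ}

/-- If the cubes are small, the midpoints near a fixed point carry a fixed proportion of the
midpoint rule. -/
lemma CubePartition.le_quad_of_cover {Λ : Set (Eucl (d + 1))} (P : CubePartition d Λ)
    (hΛ : IsClosed Λ) {g : Eucl (d + 1) → ℝ} (hg : ∀ z, 0 ≤ g z) {z₀ : Eucl (d + 1)} {δ ρ : ℝ}
    (hδ : 0 ≤ δ) (hnear : ∀ z ∈ Λ, (∀ j, |z j - z₀ j| < ρ) → δ ≤ g z) {i : Fin (d + 1)}
    {V : Set (Fin d → ℝ)} (hV : ∀ y ∈ V, ins i (z₀ i) y ∈ Λ ∧ ∀ j, |y j - z₀ (i.succAbove j)| < ρ / 2)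
    (hρ : P.half ≤ ρ / 2) : δ * volume.real V ≤ P.quad g := by
  classical
  set J := Finset.univ.filter (fun m => ∀ j, |P.center m j - z₀ j| < ρ) with hJ
  have hρ0 : 0 < ρ := by have := P.half_pos; linarith
  -- A face through a point over `V` has its midpoint within half a side length in every coordinate,
  -- whatever its normal. So these midpoints are near `z₀`, and cubes around their projections cover
  -- `V`.
  have hcov : V ⊆ ⋃ m ∈ J, Metric.closedBall (fun j => P.center m (i.succAbove j)) P.half := by
    intro y hy
    obtain ⟨hyΛ, hyz⟩ := hV y hy
    rw [← hΛ.closure_eq] at hyΛ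
    obtain ⟨m, hm1, hm2⟩ := P.mem_closure_iff_face.1 hyΛ
    have hm : ∀ j, |ins i (z₀ i) y j - P.center m j| ≤ P.half := by
      intro j
      by_cases hj : j = P.normal m
      · rw [hj, hm1, level, sub_self, abs_zero]
        exact P.half_pos.le
      · exact hm2 j hj
    have hz : ∀ j, |ins i (z₀ i) y j - z₀ j| < ρ / 2 := by
      intro j
      refine Fin.succAboveCases i ?_ (fun j => ?_) j
      · simpa using hρ0
      · simpa using hyz j
    refine mem_iUnion₂.2 ⟨m, Finset.mem_filter.2 ⟨Finset.mem_univ _, fun j => ?_⟩, ?_⟩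
    · have h1 := abs_le.1 (hm j)
      have h2 := abs_lt.1 (hz j)
      exact abs_lt.2 ⟨by linarith, by linarith⟩
    · refine (dist_pi_le_iff P.half_pos.le).2 fun j => ?_
      simpa [Real.dist_eq] using hm (i.succAbove j)
  have hvol : volume.real V ≤ J.card * (1 / (P.N : ℝ)) ^ d := by
    calc volume.real V
        ≤ volume.real (⋃ m ∈ J, Metric.closedBall (fun j => P.center m (i.succAbove j)) P.half) :=
          measureReal_mono hcov ((measure_biUnion_lt_top J.finite_toSet
            fun m _ => measure_closedBall_lt_top).ne)
      _ ≤ ∑ m ∈ J, volume.real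
            (Metric.closedBall (fun j => P.center m (i.succAbove j)) P.half) :=
          measureReal_biUnion_finset_le _ _
      _ = ∑ m ∈ J, (1 / (P.N : ℝ)) ^ d := by
          refine Finset.sum_congr rfl fun m _ => ?_
          rw [measureReal_def, Real.volume_pi_closedBall _ P.half_pos.le,
            ENNReal.toReal_ofReal (pow_nonneg (by linarith [P.half_pos]) _), Fintype.card_fin,
            P.two_mul_half]
      _ = _ := by rw [Finset.sum_const, nsmul_eq_mul]
  calc δ * volume.real V ≤ δ * (J.card * (1 / (P.N : ℝ)) ^ d) := mul_le_mul_of_nonneg_left hvol hδ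
    _ = (1 / (P.N : ℝ)) ^ d * ∑ m ∈ J, δ := by rw [Finset.sum_const, nsmul_eq_mul]; ring
    _ ≤ (1 / (P.N : ℝ)) ^ d * ∑ m ∈ J, g (P.center m) := by
        refine mul_le_mul_of_nonneg_left (Finset.sum_le_sum fun m hm => ?_) (by positivity)
        exact hnear _ (P.center_mem m) (Finset.mem_filter.1 hm).2
    _ ≤ P.quad g := by
        refine mul_le_mul_of_nonneg_left ?_ (by positivity)
        exact Finset.sum_le_sum_of_subset_of_nonneg (Finset.subset_univ _) fun m _ _ => hg _

/-- For a fixed function, the square root of the midpoint rule of its square is of the order of the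
midpoint rule and of `M^{-1/d}`. -/
lemma exists_sqrt_quad_sq_le (hd : 1 ≤ d) (hL : IsLipschitzDomain Ω) (hT : 0 < T)
    {p : Eucl (d + 1) → ℝ} (hp : ContinuousOn p (cyl (frontier Ω) (Icc 0 T))) :
    ∃ K, 0 ≤ K ∧ ∀ P : CubePartition d (cyl (frontier Ω) (Icc 0 T)),
      √(P.quad (fun z => p z ^ 2))
        ≤ K * (P.quad (fun z => p z ^ 2) + (P.M : ℝ) ^ (-1 / (d : ℝ))) := by
  have hΛ : IsClosed (cyl (frontier Ω) (Icc 0 T)) := isClosed_lateral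
  by_cases h0 : ∀ z ∈ cyl (frontier Ω) (Icc 0 T), p z = 0
  · refine ⟨0, le_rfl, fun P => ?_⟩
    have : P.quad (fun z => p z ^ 2) = 0 := by
      simp [CubePartition.quad, h0 _ (P.center_mem _)]
    simp [this]
  push Not at h0
  obtain ⟨z₀, hz₀, hpz⟩ := h0
  rcases isEmpty_or_nonempty (CubePartition d (cyl (frontier Ω) (Icc 0 T))) with hP | ⟨⟨P₀⟩⟩
  · exact ⟨0, le_rfl, fun P => hP.elim P⟩
  set δ := p z₀ ^ 2 / 2 with hδ_def
  have hδ : 0 < δ := by positivity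
  obtain ⟨ρ, hρ, hnear⟩ : ∃ ρ, 0 < ρ ∧ ∀ z ∈ cyl (frontier Ω) (Icc 0 T),
      (∀ j, |z j - z₀ j| < ρ) → δ ≤ p z ^ 2 := by
    have h1 : {z | δ < p z ^ 2} ∈ nhdsWithin z₀ (cyl (frontier Ω) (Icc 0 T)) :=
      ((hp.pow 2) z₀ hz₀).eventually (lt_mem_nhds (by
        change δ < p z₀ ^ 2
        rw [hδ_def]; linarith [show 0 < p z₀ ^ 2 by positivity]))
    obtain ⟨U, hU, hUs⟩ := mem_nhdsWithin_iff_exists_mem_nhds_inter.1 h1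
    have h2 : (WithLp.toLp 2 : (Fin (d + 1) → ℝ) → Eucl (d + 1)) ⁻¹' U ∈ nhds (WithLp.ofLp z₀) :=
      (PiLp.continuous_toLp 2 _).continuousAt.preimage_mem_nhds (by simpa using hU)
    obtain ⟨ρ, hρ, hball⟩ := Metric.mem_nhds_iff.1 h2
    refine ⟨ρ, hρ, fun z hz hzj => ?_⟩
    have h3 : WithLp.ofLp z ∈ Metric.ball (WithLp.ofLp z₀) ρ :=
      (dist_pi_lt_iff hρ).2 fun j => hzj j
    exact (hUs ⟨by simpa using hball h3, hz⟩ : δ < p z ^ 2).le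
  -- One reference partition `P₀` provides a flat piece of the boundary near `z₀`, of positive area
  -- and independent of the partition to be estimated.
  have hz₀' : z₀ ∈ closure (cyl (frontier Ω) (Icc 0 T)) := subset_closure hz₀
  obtain ⟨m₀, hm1, hm2⟩ := P₀.mem_closure_iff_face.1 hz₀'
  set i := P₀.normal m₀ with hi
  set y₀ : Fin d → ℝ := fun j => z₀ (i.succAbove j) with hy₀
  set V := Metric.ball (P₀.trace m₀) P₀.half ∩ Metric.ball y₀ (ρ / 2) with hV_def
  have hy₀mem : y₀ ∈ closure (Metric.ball (P₀.trace m₀) P₀.half) := by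
    rw [closure_ball _ P₀.half_pos.ne']
    exact (dist_pi_le_iff P₀.half_pos.le).2 fun j => hm2 _ (Fin.succAbove_ne i j)
  have hVne : V.Nonempty := by
    obtain ⟨y, hy1, hy2⟩ := mem_closure_iff.1 hy₀mem _ Metric.isOpen_ball
      (Metric.mem_ball_self (half_pos hρ))
    exact ⟨y, hy2, hy1⟩
  have hVpos : 0 < volume.real V :=
    ENNReal.toReal_pos ((Metric.isOpen_ball.inter Metric.isOpen_ball).measure_pos volume hVne).ne'
      ((measure_mono inter_subset_left).trans_lt measure_ball_lt_top).ne
  have hVprop : ∀ y ∈ V, ins i (z₀ i) y ∈ cyl (frontier Ω) (Icc 0 T) ∧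
      ∀ j, |y j - z₀ (i.succAbove j)| < ρ / 2 := by
    intro y hy
    refine ⟨?_, fun j => (dist_pi_lt_iff (half_pos hρ)).1 hy.2 j⟩
    rw [hm1]
    refine hΛ.closure_subset ?_
    exact P₀.ins_mem_closure m₀ (Metric.ball_subset_closedBall hy.1)
  obtain ⟨B, hB⟩ := ((isCompact_closedCyl hL T).of_isClosed_subset hΛ
    cyl_frontier_subset).exists_bound_of_continuousOn (hp.pow 2)
  have hB0 : 0 ≤ B := (norm_nonneg _).trans (hB z₀ hz₀)
  set a := δ * volume.real V with ha_def
  have ha : 0 < a := mul_pos hδ hVpos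
  set X := T * surfaceArea Ω with hX_def
  set β := (X / ρ ^ d) ^ (-1 / (d : ℝ)) with hβ_def
  have hX0 : 0 ≤ X := mul_nonneg hT.le surfaceArea_nonneg
  refine ⟨1 / √a + √(X * B) / β, by positivity, fun P => ?_⟩
  have hE0 : 0 ≤ P.quad (fun z => p z ^ 2) := P.quad_nonneg fun _ => sq_nonneg _
  have hM0 : 0 ≤ (P.M : ℝ) ^ (-1 / (d : ℝ)) := by positivity
  set E := P.quad (fun z => p z ^ 2) with hE_def
  rw [add_mul]
  -- Fine partitions have E ≥ a, hence √E ≤ E / √a. Coarse ones have at most X / ρ^d faces, hence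
  -- M^{-1/d} ≥ β, while E ≤ X B.
  rcases le_or_gt P.half (ρ / 2) with hhalf | hhalf
  · have h1 : a ≤ E := P.le_quad_of_cover hΛ (fun _ => sq_nonneg _) hδ.le hnear hVprop hhalf
    have h2 : √E ≤ 1 / √a * E := by
      rw [div_mul_eq_mul_div, one_mul, le_div_iff₀ (Real.sqrt_pos.2 ha)]
      calc √E * √a ≤ √E * √E := by gcongr
        _ = E := Real.mul_self_sqrt hE0
    have h3 : 1 / √a * E ≤ 1 / √a * (E + (P.M : ℝ) ^ (-1 / (d : ℝ))) := by gcongr; linarith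
    have h4 : 0 ≤ √(X * B) / β * (E + (P.M : ℝ) ^ (-1 / (d : ℝ))) := by positivity
    linarith
  · have hN : ρ < 1 / (P.N : ℝ) := by rw [← P.two_mul_half]; linarith
    have hcard := P.card_mul_pow_le hd hL.1 hT
    have hM1 : (1 : ℝ) ≤ P.M := by
      obtain ⟨m, -⟩ := P.mem_closure_iff_face.1 hz₀'
      exact_mod_cast (Nat.zero_le _).trans_lt m.2
    have hMX : (P.M : ℝ) ≤ X / ρ ^ d := by
      rw [le_div_iff₀ (by positivity)]
      refine le_trans ?_ hcard
      gcongr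
    have hβ : 0 < β := Real.rpow_pos_of_pos (by linarith) _
    have hβM : β ≤ (P.M : ℝ) ^ (-1 / (d : ℝ)) := by
      refine Real.rpow_le_rpow_of_nonpos (by linarith) hMX ?_
      rw [neg_div]
      exact neg_nonpos.2 (by positivity)
    have hEX : E ≤ X * B := by
      calc E ≤ (1 / (P.N : ℝ)) ^ d * ∑ m : Fin P.M, B := by
            refine mul_le_mul_of_nonneg_left (Finset.sum_le_sum fun m _ => ?_) (by positivity)
            exact (le_abs_self _).trans (hB _ (P.center_mem m))
        _ = P.M * (1 / (P.N : ℝ)) ^ d * B := by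
            rw [Finset.sum_const, Finset.card_univ, Fintype.card_fin, nsmul_eq_mul]; ring
        _ ≤ X * B := by gcongr
    have h2 : √E ≤ √(X * B) / β * (P.M : ℝ) ^ (-1 / (d : ℝ)) := by
      refine (Real.sqrt_le_sqrt hEX).trans ?_
      rw [div_mul_eq_mul_div, le_div_iff₀ hβ]
      gcongr
    have h3 : √(X * B) / β * (P.M : ℝ) ^ (-1 / (d : ℝ))
        ≤ √(X * B) / β * (E + (P.M : ℝ) ^ (-1 / (d : ℝ))) := by gcongr; linarith
    have h4 : 0 ≤ 1 / √a * (E + (P.M : ℝ) ^ (-1 / (d : ℝ))) := by positivity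
    linarith

end FixedNetwork

end PINN

end

/-! ### The theorem: assembly of the estimates. -/

theorem mainTheorem2 (d : ℕ) (hd : 1 ≤ d) (Ω : Set (Eucl d)) (hΩ : IsLipschitzDomain Ω) :
    -- constants of the midpoint rule, which depend only on the geometry
    ∃ CΩ : ℝ, 0 ≤ CΩ ∧ ∀ T : ℝ, 0 < T → ∃ CΩT CΓ : ℝ, 0 ≤ CΩT ∧ 0 ≤ CΓ ∧
      ∀ (D : WaveData d Ω T) (k : ℕ) (c r : ℝ),
        ContDiffOn ℝ 2 D.a (closure Ω) → AssumptionA1 Ω D.a → AssumptionA2 Ω D.f k c r →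
      ∀ u : Eucl (d + 1) → ℝ, ContDiffOn ℝ 4 u (closedCyl Ω T) → IsClassicalSolution D u →
      ∀ Cpw : ℝ, IsPoincareWirtingerConst Ω Cpw →
      ∀ σ : ℝ → ℝ, ContDiff ℝ 4 σ → (∀ n ≤ 4, ∃ b, ∀ x, |iteratedDeriv n σ x| ≤ b) →
        (∀ n ∈ Finset.Icc 1 4, 1 ≤ actNorm σ n) →
      ∀ (L W : ℕ) (R : ℝ), 1 ≤ R →
        -- the error bound, for all networks in the class and all training sets
        (∀ l ≤ L, ∀ θ : Net l (d + 1) 1, θ.SizeBound W R →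
          ∀ S : TrainingSet Ω T,
            totalErrorSq Ω T u (θ.fn σ) ≤
              errorBound D (θ.fn σ) S u c r CΩ CΩT CΓ Cpw (netBound σ d L W R 1)) ∧
        -- the five constants depend on the network only through its size
        (∀ l : ℕ, 2 ≤ l → l ≤ L → ∀ θ : Net l (d + 1) 1, θ.SizeBound W R →
          const1 D (θ.fn σ) CΩ ≤
              8 * CΩ * (netBound σ d L W R 3 ^ 2 + cNorm (closedCyl Ω T) 3 u ^ 2) ∧
          const2 D (θ.fn σ) CΩT ≤
              16 * CΩT * (((d : ℝ) + 1) * netBound σ d L W R 4 ^ 2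
                + 16 * cNorm (closure Ω) 2 D.a ^ 2 * netBound σ d L W R 3 ^ 2
                + c ^ 2 * netBound σ d L W R 2 ^ (2 * (r + 1))) ∧
          const3 D (θ.fn σ) CΩ ≤
              8 * d * CΩ * (netBound σ d L W R 3 ^ 2 + cNorm (closedCyl Ω T) 3 u ^ 2) ∧
          const4 Ω T (θ.fn σ) CΓ ≤ 2 * √CΓ * netBound σ d L W R 3 ∧
          const5 D (θ.fn σ) CΩ Cpw ≤
              16 * CΩ / Cpw ^ 2 * (netBound σ d L W R 2 ^ 2 + cNorm (closedCyl Ω T) 2 u ^ 2)) ∧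
        -- the order of the bound, uniformly over the networks in the class
        (∃ K : ℝ, ∀ l ≤ L, ∀ θ : Net l (d + 1) 1, θ.SizeBound W R →
          ∀ S : TrainingSet Ω T,
            errorBound D (θ.fn σ) S u c r CΩ CΩT CΓ Cpw (netBound σ d L W R 1) ≤
              K * (trainSq D (θ.fn σ) S + √(trainSutSq (θ.fn σ) S) + quadRate S)) ∧
        -- the order of the bound for a given network, as the training set varies
        (∀ l ≤ L, ∀ θ : Net l (d + 1) 1, θ.SizeBound W R →
          ∃ K : ℝ, ∀ S : TrainingSet Ω T,
            errorBound D (θ.fn σ) S u c r CΩ CΩT CΓ Cpw (netBound σ d L W R 1) ≤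
              K * (trainSq D (θ.fn σ) S + quadRate S)) := by
  refine ⟨midpointConst d (volume.real Ω), midpointConst_nonneg measureReal_nonneg,
    fun T hT => ⟨midpointConst (d + 1) (volume.real (cyl Ω (Ioo 0 T))),
      midpointConst d (T * surfaceArea Ω), midpointConst_nonneg measureReal_nonneg,
      midpointConst_nonneg (mul_nonneg hT.le surfaceArea_nonneg), ?_⟩⟩
  intro D k c r ha hA hf u hu hsol Cpw hP σ hσ hσb hσ1 L W R hR
  have hCΩ : 0 ≤ midpointConst d (volume.real Ω) := midpointConst_nonneg measureReal_nonneg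
  have hCΩT : 0 ≤ midpointConst (d + 1) (volume.real (cyl Ω (Ioo 0 T))) :=
    midpointConst_nonneg measureReal_nonneg
  have hCΓ : 0 ≤ midpointConst d (T * surfaceArea Ω) :=
    midpointConst_nonneg (mul_nonneg hT.le surfaceArea_nonneg)
  have hS := uniqueDiffOn_closedCyl hΩ hT
  have hB0 : 0 ≤ netBound σ d L W R 1 := netBound_nonneg (zero_le_one.trans hR) 1
  have hreg : ∀ {l : ℕ} (θ : Net l (d + 1) 1), ContDiffOn ℝ 4 (θ.fn σ) (closedCyl Ω T) :=
    fun θ => (θ.contDiff_fn hσ).contDiffOn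
  obtain ⟨A, hA0, hbound⟩ := Net.exists_derivBound_fn (d := d) (W := W) hσ hσb hσ1 hR hS
    (isCompact_closedCyl hΩ T).isBounded L
  obtain ⟨K, hK0, hK⟩ := exists_errorBound_le (Cpw := Cpw) hΩ hT ha hf hu hsol hCΩ hCΩT hCΓ hA0 hB0
  have huniform : ∀ l ≤ L, ∀ θ : Net l (d + 1) 1, θ.SizeBound W R → ∀ S : TrainingSet Ω T, _ :=
    fun l hl θ hθ S => hK (θ.fn σ) (hreg θ) (hbound l hl θ hθ) S
  refine ⟨fun l hl θ hθ S => ?_, fun l hl hlL θ hθ => ?_, ⟨K, huniform⟩, fun l hl θ hθ => ?_⟩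
  · exact totalErrorSq_le_errorBound hd hΩ hT ha hA hf hu hsol (hreg θ) hB0
      (fun z hz i => θ.abs_pd_fn_le hσ hσb hσ1 hR hS hl hθ hz i) S hP.1
  · exact constants_le hΩ hT hCΩ hCΩT hCΓ ha hf hu hsol Cpw hσ hσb hσ1 hR hl hlL θ hθ
  · have hc : ContinuousOn (dt Ω T (θ.fn σ)) (cyl (frontier Ω) (Icc 0 T)) :=
      (contDiffOn_pd (k := 0) (hreg θ) hS (by norm_num) _).continuousOn.mono cyl_frontier_subset
    obtain ⟨K', hK'0, hK'⟩ := exists_sqrt_quad_sq_le hd hΩ hT hc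
    -- `K` is the uniform constant; `K'` belongs to this network and trades the root of the boundary
    -- error for its square plus M_s^{-1/d}, both of which already occur in the bound.
    refine ⟨K * (1 + K'), fun S => (huniform l hl θ hθ S).trans ?_⟩
    rw [mul_assoc]
    refine mul_le_mul_of_nonneg_left ?_ hK0
    have h1 := hK' S.s
    have e1 : 0 ≤ trainPDESq D (θ.fn σ) S := S.pde.quad_nonneg fun _ => sq_nonneg _
    have e2 : 0 ≤ trainSuSq (θ.fn σ) S := S.s.quad_nonneg fun _ => sq_nonneg _
    have e4 : 0 ≤ trainU0Sq D (θ.fn σ) S := S.t.quad_nonneg fun _ => sq_nonneg _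
    have e5 : 0 ≤ trainU1Sq D (θ.fn σ) S := S.t.quad_nonneg fun _ => sq_nonneg _
    have e6 : 0 ≤ trainGradSq D (θ.fn σ) S :=
      S.t.quad_nonneg fun _ => Finset.sum_nonneg fun _ _ => sq_nonneg _
    have e8 : 0 ≤ (S.t.M : ℝ) ^ (-2 / (d : ℝ)) := by positivity
    have e9 : 0 ≤ (S.pde.M : ℝ) ^ (-2 / ((d : ℝ) + 1)) := by positivity
    have h2 : trainSutSq (θ.fn σ) S + (S.s.M : ℝ) ^ (-1 / (d : ℝ))
        ≤ trainSq D (θ.fn σ) S + quadRate S := by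
      unfold trainSq quadRate
      linarith
    have h3 : √(trainSutSq (θ.fn σ) S) ≤ K' * (trainSq D (θ.fn σ) S + quadRate S) :=
      h1.trans (mul_le_mul_of_nonneg_left h2 hK'0)
    linarith
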